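/- Let $(Z_H(t))_{H\in(0,1),\,t\ge 0}$ be a fractional Gaussian field on a probability space $(\Omega,\mathcal F,\mathbb P)$, i.e. a centered jointly Gaussian family with $$\mathbb E[Z_H(t)Z_{H'}(s)]=\frac{a_{H,H'}}{2}\left(t^{H+H'}+s^{H+H'}-|t-s|^{H+H'}\right)\qquad(H,H'\in(0,1),\ s,t\ge 0),$$ where $$a_{H,H'}=-\tfrac{2}{\pi}\sqrt{\Gamma(2H+1)\sin(\pi H)}\,\sqrt{\Gamma(2H'+1)\sin(\pi H')}\;\Gamma(-(H+H'))\cos\left((H'-H)\tfrac{\pi}{2}\right)\cos\left((H+H')\tfrac{\pi}{2}\right)$$ if $H+H'\neq 1$, and $a_{H,1-H}=a_H:=\sqrt{\Gamma(2H+1)\Gamma(3-2H)}\,\sin^2(\pi H)$. Fix $H\in(0,1)$ and put $$\mathcal F^H_t=\sigma(Z_H(r):0\le r\le t),\qquad M_H(t)=\mathbb E[Z_{1-H}(t)\mid\mathcal F^H_t],$$ $$c_M=\frac{a_H^2\,\Gamma(3/2-H)}{2H\,\Gamma(H+1/2)\,\Gamma(3-2H)},\qquad c_\Psi=\frac{2H\,\Gamma(3-2H)\,\Gamma(H+1/2)}{a_H\,\Gamma(3/2-H)},\qquad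 C=c_\Psi\sqrt{c_M(2-2H)}.$$ Let $V_H(t)=c_\Psi t^{2H-1}M_H(t)$ be the Dobri\'c--Ojeda process, with $V_H(0)=0$ almost surely. Let $0\le t_0<T$ and $\delta>0$. For $n\ge 1$ let $m=m(n)=\lfloor n^{1+\delta}\rfloor$ and let $t_i=t_i^{(n)}=\frac{iT}{m}$, $0\le i\le m$. Let $i_0=i_0(n)\ge 0$ be any integers with $\left|i_0-\frac{t_0 m}{T}\right|\le 1$ (for example $\frac{t_0m}{T}$ itself if it is an integer, or $\frac{t_0m}{T}$ rounded up or down), so that $t_{i_0},t_{i_0+1},\dots,t_m$ is the equally spaced partition of $[t_0,T]$ of mesh $T/m$, with left endpoint within one mesh of $t_0$. Set $$S_n=\sum_{i=i_0+1}^{m}\left(V_H(t_i)-V_H(t_{i-1})\right)^2,\qquad I=\frac{C^2}{2H}\left(T^{2H}-t_0^{2H}\right).$$ Then $S_n\in L^2(\mathbb P)$ for all $n$, and, as $n\to\infty$, $S_n\to I$ in $L^2$, i.e. $\left\|S_n-I\right\|_2\to 0$, and $S_n\to I$ almost surely. -/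

import Mathlib

open MeasureTheory ProbabilityTheory Filter
open scoped NNReal Topology

/-- The constant `a_{H,H'}` of the fractional Gaussian field. -/
noncomputable def fieldConst (H H' : ℝ) : ℝ :=
  if H + H' = 1 then
    √(Real.Gamma (2 * H + 1) * Real.Gamma (3 - 2 * H)) * Real.sin (Real.pi * H) ^ 2
  else
    -(2 / Real.pi) * √(Real.Gamma (2 * H + 1) * Real.sin (Real.pi * H))
      * √(Real.Gamma (2 * H' + 1) * Real.sin (Real.pi * H'))
      * Real.Gamma (-(H + H'))
      * Real.cos ((H' - H) * (Real.pi / 2)) * Real.cos ((H + H') * (Real.pi / 2))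

/-- `Z H t`, for `0 < H < 1` and `t ≥ 0`, is a fractional Gaussian field: a centered, jointly
Gaussian family with the covariance
`E[Z_H(t) Z_{H'}(s)] = a_{H,H'} / 2 * (t^(H+H') + s^(H+H') - |t-s|^(H+H'))`.
Values of `Z H` for `H` outside `(0, 1)` are irrelevant. -/
structure IsFractionalGaussianField {Ω : Type*} [MeasurableSpace Ω]
    (Z : ℝ → ℝ≥0 → Ω → ℝ) (P : Measure Ω) : Prop where
  measurable : ∀ H ∈ Set.Ioo (0 : ℝ) 1, ∀ t : ℝ≥0, Measurable (Z H t)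
  gaussian : IsGaussianProcess
    (fun p : Set.Ioo (0 : ℝ) 1 × ℝ≥0 => Z (p.1 : ℝ) p.2) P
  centered : ∀ H ∈ Set.Ioo (0 : ℝ) 1, ∀ t : ℝ≥0, ∫ ω, Z H t ω ∂P = 0
  covariance : ∀ H ∈ Set.Ioo (0 : ℝ) 1, ∀ H' ∈ Set.Ioo (0 : ℝ) 1, ∀ t s : ℝ≥0,
    ∫ ω, Z H t ω * Z H' s ω ∂P =
      fieldConst H H' / 2 *
        ((t : ℝ) ^ (H + H') + (s : ℝ) ^ (H + H') - |(t : ℝ) - (s : ℝ)| ^ (H + H'))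

/-- The σ-algebra `F_t^H = σ(Z_H(r) : 0 ≤ r ≤ t)`. -/
abbrev pastSigma {Ω : Type*} (Z : ℝ → ℝ≥0 → Ω → ℝ) (H : ℝ) (t : ℝ≥0) : MeasurableSpace Ω :=
  ⨆ r : ℝ≥0, ⨆ _ : r ≤ t, MeasurableSpace.comap (Z H r) (borel ℝ)

/-- The process `M_H(t) = E[Z_{1-H}(t) | F_t^H]`. -/
noncomputable def martM {Ω : Type*} [MeasurableSpace Ω] (P : Measure Ω)
    (Z : ℝ → ℝ≥0 → Ω → ℝ) (H : ℝ) (t : ℝ≥0) : Ω → ℝ :=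
  P[Z (1 - H) t | pastSigma Z H t]

/-- The constant `c_M`, where `a_H = a_{H,1-H}`. -/
noncomputable def constM (H : ℝ) : ℝ :=
  fieldConst H (1 - H) ^ 2 * Real.Gamma (3 / 2 - H) /
    (2 * H * Real.Gamma (H + 1 / 2) * Real.Gamma (3 - 2 * H))

/-- The constant `c_Ψ`, where `a_H = a_{H,1-H}`. -/
noncomputable def constPsi (H : ℝ) : ℝ :=
  2 * H * Real.Gamma (3 - 2 * H) * Real.Gamma (H + 1 / 2) /
    (fieldConst H (1 - H) * Real.Gamma (3 / 2 - H))

/-- The Dobrić–Ojeda process `V_H(t) = Ψ_H(t) M_H(t)` with `Ψ_H(t) = c_Ψ t^(2H-1)`.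
At `t = 0` one has `M_H(0) = 0` almost surely, hence `V_H(0) = 0` almost surely. -/
noncomputable def dobricOjeda {Ω : Type*} [MeasurableSpace Ω] (P : Measure Ω)
    (Z : ℝ → ℝ≥0 → Ω → ℝ) (H : ℝ) (t : ℝ≥0) (ω : Ω) : ℝ :=
  constPsi H * (t : ℝ) ^ (2 * H - 1) * martM P Z H t ω

/-- The constant `C = c_Ψ √(c_M (2 - 2H))`. -/
noncomputable def constC (H : ℝ) : ℝ :=
  constPsi H * √(constM H * (2 - 2 * H))

/-- The number `⌊n^(1+δ)⌋` of grid steps in `[0, T]`. -/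
noncomputable def gridSize (δ : ℝ) (n : ℕ) : ℕ := ⌊(n : ℝ) ^ (1 + δ)⌋₊

/-- The grid point `t_i = i T / m`. -/
noncomputable def gridPoint (T : ℝ≥0) (m i : ℕ) : ℝ≥0 := (i : ℝ≥0) * T / (m : ℝ≥0)

/-- The sum of the squared increments of `X` between consecutive grid points
`t_k, t_{k+1}, …, t_m`, where `t_i = i T / m`. -/
noncomputable def sumSqIncr {Ω : Type*} (X : ℝ≥0 → Ω → ℝ) (T : ℝ≥0) (m k : ℕ) (ω : Ω) : ℝ :=
  ∑ i ∈ Finset.Ioc k m, (X (gridPoint T m i) ω - X (gridPoint T m (i - 1)) ω) ^ 2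

/-- The limit `I = C² / (2H) * (T^(2H) - t₀^(2H))`. -/
noncomputable def limitI (H : ℝ) (t₀ T : ℝ≥0) : ℝ :=
  constC H ^ 2 / (2 * H) * ((T : ℝ) ^ (2 * H) - (t₀ : ℝ) ^ (2 * H))

/-! V_H is a power of t times a Gaussian martingale with an explicit clock, so its quadratic
variation is a matter of concentration for sums of independent Gaussian squares.

The martingale. For r ≤ t the covariance of Z_H(r) and Z_{1-H}(t) is a_H r, whatever t is. Since the
field is Gaussian, M_H(t) is the L² projection of Z_{1-H}(t) to the closed span of Z_H(r), r ≤ t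
(`martM_ae_eq`), and ⟨M(s), M(t)⟩ = ‖M(s)‖² for s ≤ t (`inner_projM_of_le`): the increments are
orthogonal, hence independent.

The clock ‖M(t)‖² = c_M t^(2-2H) (`norm_sq_projM`). After scaling to [0, 1], the projection is a
multiple of the Wiener integral of (u(1-u))^(1/2-H) against Z_H, because this weight turns the
kernel ∂_u of the fractional Brownian covariance into a linear function of r
(`integral_betaWeight_mul_fbmCovDeriv`). That equation rests on `singularBeta_sub`, where one
substitution removes r from the integrand. No stochastic integral is built: Riemann sums that are
bounded in L² (`exists_sum_sum_betaWeight_le`) and have the right limiting inner products converge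
weakly, which is enough to read off the norm (`norm_sq_starProjection_of_tendsto`).

The quadratic variation. An increment of V_H is A_i + B_i (`martIncr`, `driftIncr`). The A_i are
independent, their variances add up to I in the limit, and each variance is O(n^(-H)), so ∑ A_i²
concentrates exponentially. The variances of the B_i have sum O(n^(-H)); convexity of exp handles ∑
B_i² without independence. Cauchy–Schwarz bounds the cross term. Exponential moments at a
polynomially small scale make every moment small, which gives both modes of convergence
(`tendsto_of_expMomentDecay`). -/

/-! ### The incomplete singular beta integral and its reflection identity -/

/-- The inverse of the substitution `x = (r - u) / √(u (1 - u))`. -/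
noncomputable def sqrtSubst (r x : ℝ) : ℝ :=
  (2 * r + x ^ 2 - x * √(x ^ 2 + 4 * r * (1 - r))) / (2 * (1 + x ^ 2))

/-- The incomplete singular beta integral `∫₀^r u^a (1-u)^a (r-u)^(-2a) du`. -/
noncomputable def singularBeta (a r : ℝ) : ℝ :=
  ∫ u in Set.Ioo 0 r, u ^ a * (1 - u) ^ a * (r - u) ^ (-2 * a)

lemma sqrtSubst_mem {r x : ℝ} (hr : 0 < r) (hr1 : r ≤ 1) (hx : 0 < x) :
    sqrtSubst r x ∈ Set.Ioo 0 r := by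
  have h0 : 0 ≤ x ^ 2 + 4 * r * (1 - r) := by nlinarith [mul_nonneg hr.le (sub_nonneg.2 hr1)]
  have hs := Real.sq_sqrt h0
  have hs0 := Real.sqrt_nonneg (x ^ 2 + 4 * r * (1 - r))
  unfold sqrtSubst
  set s := √(x ^ 2 + 4 * r * (1 - r))
  have hxs : x ≤ s := by
    apply le_of_sq_le_sq _ hs0
    nlinarith [mul_nonneg hr.le (sub_nonneg.2 hr1)]
  constructor
  · apply div_pos _ (by positivity)
    have : x * s < 2 * r + x ^ 2 := by
      apply lt_of_pow_lt_pow_left₀ 2 (by positivity)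
      rw [mul_pow, hs]
      nlinarith [mul_pos hr hr, mul_pos hx hx, mul_pos (mul_pos hr hr) (mul_pos hx hx)]
    linarith
  · rw [div_lt_iff₀ (by positivity)]
    nlinarith [mul_pos hr (mul_pos hx hx), mul_le_mul_of_nonneg_left hxs hx.le]

lemma sqrtSubst_spec {r x : ℝ} (hr : 0 < r) (hr1 : r ≤ 1) :
    (r - sqrtSubst r x) ^ 2 = x ^ 2 * (sqrtSubst r x * (1 - sqrtSubst r x)) := by
  have h0 : 0 ≤ x ^ 2 + 4 * r * (1 - r) := by nlinarith [mul_nonneg hr.le (sub_nonneg.2 hr1)]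
  have hs := Real.sq_sqrt h0
  unfold sqrtSubst
  set s := √(x ^ 2 + 4 * r * (1 - r))
  have hx : 1 + x ^ 2 ≠ 0 := by positivity
  field_simp
  linear_combination (x ^ 2 + x ^ 4) * hs

/-- The quantity (r-u)²/(u(1-u)) is the product of (r-u)/u, strictly decreasing, and (r-u)/(1-u),
nonincreasing because r ≤ 1. This one fact gives both monotonicity and surjectivity of the
substitution. -/
lemma sqrtSubst_lt_of_lt {r x y u v : ℝ} (hr1 : r ≤ 1) (hx : 0 < x) (hu : u ∈ Set.Ioo 0 r)
    (hv : v ∈ Set.Ioo 0 r) (hxu : (r - u) ^ 2 = x ^ 2 * (u * (1 - u)))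
    (hyv : (r - v) ^ 2 = y ^ 2 * (v * (1 - v))) (huv : u < v) : y < x := by
  obtain ⟨hu0, hur⟩ := hu
  obtain ⟨hv0, hvr⟩ := hv
  have h1 : (r - v) * u < (r - u) * v := by nlinarith
  have h2 : (r - v) * (1 - u) ≤ (r - u) * (1 - v) := by nlinarith
  have h3 : ((r - v) * u) * ((r - v) * (1 - u)) < ((r - u) * v) * ((r - u) * (1 - v)) := by
    apply mul_lt_mul h1 h2
    · exact mul_pos (by linarith) (by linarith)
    · exact mul_nonneg (by linarith) hv0.le
  have h4 : y ^ 2 * ((v * (1 - v)) * (u * (1 - u))) < x ^ 2 * ((v * (1 - v)) * (u * (1 - u))) := by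
    calc _ = ((r - v) * u) * ((r - v) * (1 - u)) := by linear_combination (-(u * (1 - u))) * hyv
      _ < _ := h3
      _ = _ := by linear_combination (v * (1 - v)) * hxu
  have h5 : 0 < (v * (1 - v)) * (u * (1 - u)) :=
    mul_pos (mul_pos hv0 (by linarith)) (mul_pos hu0 (by linarith))
  exact lt_of_pow_lt_pow_left₀ 2 hx.le (lt_of_mul_lt_mul_right h4 h5.le)

lemma sqrtSubst_antitoneOn {r : ℝ} (hr : 0 < r) (hr1 : r ≤ 1) :
    AntitoneOn (sqrtSubst r) (Set.Ioi 0) := by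
  intro x hx y hy hxy
  by_contra! h
  exact absurd (sqrtSubst_lt_of_lt hr1 hx (sqrtSubst_mem hr hr1 hx) (sqrtSubst_mem hr hr1 hy)
    (sqrtSubst_spec hr hr1) (sqrtSubst_spec hr hr1) h) (not_lt.2 hxy)

lemma sqrtSubst_image {r : ℝ} (hr : 0 < r) (hr1 : r ≤ 1) :
    sqrtSubst r '' Set.Ioi 0 = Set.Ioo 0 r := by
  apply Set.Subset.antisymm
  · rintro _ ⟨x, hx, rfl⟩
    exact sqrtSubst_mem hr hr1 hx
  · intro u hu
    have h0 : 0 < u * (1 - u) := mul_pos hu.1 (by linarith [hu.2])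
    set x := (r - u) / √(u * (1 - u)) with hxd
    have hx : 0 < x := div_pos (by linarith [hu.2]) (Real.sqrt_pos.2 h0)
    have hxu : (r - u) ^ 2 = x ^ 2 * (u * (1 - u)) := by
      rw [hxd, div_pow, Real.sq_sqrt h0.le, div_mul_cancel₀ _ h0.ne']
    refine ⟨x, hx, ?_⟩
    have hm := sqrtSubst_mem hr hr1 hx
    have hsp := sqrtSubst_spec (x := x) hr hr1
    rcases lt_trichotomy (sqrtSubst r x) u with h | h | h
    · exact absurd (sqrtSubst_lt_of_lt hr1 hx hm hu hsp hxu h) (lt_irrefl _)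
    · exact h
    · exact absurd (sqrtSubst_lt_of_lt hr1 hx hu hm hxu hsp h) (lt_irrefl _)

lemma differentiableAt_sqrtSubst {r x : ℝ} (hr : 0 ≤ r) (hr1 : r ≤ 1) (hx : 0 < x) :
    DifferentiableAt ℝ (sqrtSubst r) x := by
  have h0 : x ^ 2 + 4 * r * (1 - r) ≠ 0 := by
    have := mul_nonneg hr (sub_nonneg.2 hr1)
    have := mul_pos hx hx
    nlinarith
  have h1 : 2 * (1 + x ^ 2) ≠ 0 := by positivity
  unfold sqrtSubst
  fun_prop (disch := assumption)

/-- The radicand x² + 4r(1-r) is symmetric under r ↦ 1-r, so the square roots cancel in the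
difference; at r = 1 the root is x itself and the value is 1/(1+x²). -/
lemma sqrtSubst_sub {r x : ℝ} (hx : 0 < x) :
    sqrtSubst r x - sqrtSubst (1 - r) x = (2 * r - 1) * sqrtSubst 1 x := by
  have h1 : x ^ 2 + 4 * (1 - r) * (1 - (1 - r)) = x ^ 2 + 4 * r * (1 - r) := by ring
  have h2 : √(x ^ 2 + 4 * 1 * (1 - 1)) = x := by simp [Real.sqrt_sq hx.le]
  unfold sqrtSubst
  rw [h1, h2]
  have hx : 1 + x ^ 2 ≠ 0 := by positivity
  field_simp
  ring

/-- Since (r-u)² = x² u(1-u), the powers of u(1-u) cancel and the integrand no longer depends on r;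
all dependence on r moves into the Jacobian. -/
lemma integrand_sqrtSubst {a r x : ℝ} (hr : 0 < r) (hr1 : r ≤ 1) (hx : 0 < x) :
    sqrtSubst r x ^ a * (1 - sqrtSubst r x) ^ a * (r - sqrtSubst r x) ^ (-2 * a) = x ^ (-2 * a) := by
  have hm := sqrtSubst_mem hr hr1 hx
  have hsp := sqrtSubst_spec (x := x) hr hr1
  set u := sqrtSubst r x
  have hu1 : 0 < 1 - u := by linarith [hm.2]
  have hru : 0 < r - u := by linarith [hm.2]
  have h1 : (r - u) ^ (-2 * a) = ((r - u) ^ 2) ^ (-a) := by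
    rw [← Real.rpow_natCast, ← Real.rpow_mul hru.le]; congr 1; push_cast; ring
  have h2 : x ^ (-2 * a) = (x ^ 2) ^ (-a) := by
    rw [← Real.rpow_natCast, ← Real.rpow_mul hx.le]; congr 1; push_cast; ring
  have hp : 0 < u * (1 - u) := mul_pos hm.1 hu1
  rw [h1, h2, hsp, Real.mul_rpow (by positivity) hp.le, ← Real.mul_rpow hm.1.le hu1.le,
    mul_left_comm, ← Real.rpow_add hp]
  simp

lemma integrableOn_Ioo_rpow {s r : ℝ} (hs : -1 < s) :
    IntegrableOn (fun u : ℝ => u ^ s) (Set.Ioo 0 r) := by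
  have := (intervalIntegral.intervalIntegrable_rpow' (a := 0) (b := r) hs).1
  exact this.mono_set Set.Ioo_subset_Ioc_self

lemma integrableOn_Ioo_sub_rpow {s r : ℝ} (hs : -1 < s) :
    IntegrableOn (fun u : ℝ => (r - u) ^ s) (Set.Ioo 0 r) := by
  have := ((intervalIntegral.intervalIntegrable_rpow' (a := 0) (b := r) hs).comp_sub_left r).2
  simp only [sub_zero, sub_self] at this
  exact this.mono_set Set.Ioo_subset_Ioc_self

/-- Dominated by u^a + (r-u)^(-2a): for a ≥ 0 the first two factors are at most 1; for a < 0, r ≤ 1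
gives (1-u)^a ≤ (r-u)^a, which leaves (r-u)^(-a) ≤ 1. -/
lemma integrableOn_singularBeta {a r : ℝ} (ha : -(1 / 2) < a) (ha' : a < 1 / 2)
    (hr1 : r ≤ 1) :
    IntegrableOn (fun u : ℝ => u ^ a * (1 - u) ^ a * (r - u) ^ (-2 * a)) (Set.Ioo 0 r) := by
  have hI := (integrableOn_Ioo_rpow (s := a) (by linarith)).add
    (integrableOn_Ioo_sub_rpow (r := r) (s := -2 * a) (by linarith))
  refine Integrable.mono' hI (by fun_prop) ?_
  filter_upwards [ae_restrict_mem measurableSet_Ioo] with u hu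
  obtain ⟨h0, h1⟩ := hu
  have hu1 : 0 < 1 - u := by linarith
  have hru : 0 < r - u := by linarith
  rw [Real.norm_of_nonneg (by positivity)]
  simp only [Pi.add_apply]
  rcases le_or_gt 0 a with h | h
  · have e1 : u ^ a ≤ 1 := Real.rpow_le_one h0.le (by linarith) h
    have e2 : (1 - u) ^ a ≤ 1 := Real.rpow_le_one hu1.le (by linarith) h
    have e3 : u ^ a * (1 - u) ^ a ≤ 1 := mul_le_one₀ e1 (by positivity) e2
    have e4 : 0 ≤ u ^ a := by positivity
    have e5 : 0 ≤ (r - u) ^ (-2 * a) := by positivity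
    nlinarith
  · have e1 : (1 - u) ^ a ≤ (r - u) ^ a :=
      Real.rpow_le_rpow_of_nonpos hru (by linarith) h.le
    have e2 : (r - u) ^ a * (r - u) ^ (-2 * a) ≤ 1 := by
      rw [← Real.rpow_add hru]
      exact Real.rpow_le_one hru.le (by linarith) (by linarith)
    have e3 : (1 - u) ^ a * (r - u) ^ (-2 * a) ≤ 1 :=
      (mul_le_mul_of_nonneg_right e1 (by positivity)).trans e2
    have e4 : 0 ≤ u ^ a := by positivity
    have e5 : 0 ≤ (r - u) ^ (-2 * a) := by positivity
    nlinarith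

lemma singularBeta_eq {a r : ℝ} (hr : 0 < r) (hr1 : r ≤ 1) :
    singularBeta a r = ∫ x in Set.Ioi 0, -deriv (sqrtSubst r) x * x ^ (-2 * a) := by
  unfold singularBeta
  rw [← sqrtSubst_image hr hr1, integral_image_eq_integral_deriv_smul_of_antitoneOn
    measurableSet_Ioi
    (fun x hx => (differentiableAt_sqrtSubst hr.le hr1 hx).hasDerivAt.hasDerivWithinAt)
    (sqrtSubst_antitoneOn hr hr1)]
  refine setIntegral_congr_fun measurableSet_Ioi fun x hx => ?_
  simp only [smul_eq_mul]
  rw [integrand_sqrtSubst hr hr1 hx]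

lemma integrableOn_deriv_sqrtSubst {a r : ℝ} (ha : -(1 / 2) < a) (ha' : a < 1 / 2) (hr : 0 < r)
    (hr1 : r ≤ 1) :
    IntegrableOn (fun x : ℝ => -deriv (sqrtSubst r) x * x ^ (-2 * a)) (Set.Ioi 0) := by
  have h := integrableOn_singularBeta ha ha' hr1
  rw [← sqrtSubst_image hr hr1, integrableOn_image_iff_integrableOn_deriv_smul_of_antitoneOn
    measurableSet_Ioi
    (fun x hx => (differentiableAt_sqrtSubst hr.le hr1 hx).hasDerivAt.hasDerivWithinAt)
    (sqrtSubst_antitoneOn hr hr1)] at h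
  refine h.congr_fun (fun x hx => ?_) measurableSet_Ioi
  simp only [smul_eq_mul]
  rw [integrand_sqrtSubst hr hr1 hx]

lemma singularBeta_zero (a : ℝ) : singularBeta a 0 = 0 := by simp [singularBeta]

/-- The antisymmetrized singular beta integral is an affine function. -/
theorem singularBeta_sub {a r : ℝ} (ha : -(1 / 2) < a) (ha' : a < 1 / 2) (hr : 0 ≤ r)
    (hr1 : r ≤ 1) :
    singularBeta a r - singularBeta a (1 - r) = (2 * r - 1) * singularBeta a 1 := by
  rcases hr.eq_or_lt with rfl | h0
  · simp [singularBeta_zero]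
  rcases hr1.eq_or_lt with rfl | h1
  · norm_num [singularBeta_zero]
  rw [singularBeta_eq h0 hr1, singularBeta_eq (by linarith) (by linarith),
    singularBeta_eq one_pos le_rfl, ← integral_sub (integrableOn_deriv_sqrtSubst ha ha' h0 hr1)
    (integrableOn_deriv_sqrtSubst ha ha' (by linarith) (by linarith)), ← integral_const_mul]
  refine setIntegral_congr_fun measurableSet_Ioi fun x hx => ?_
  have d1 := (differentiableAt_sqrtSubst h0.le hr1 hx).hasDerivAt
  have d2 := (differentiableAt_sqrtSubst (r := 1 - r) (by linarith) (by linarith) hx).hasDerivAt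
  have d3 := (differentiableAt_sqrtSubst zero_le_one le_rfl hx).hasDerivAt.const_mul (2 * r - 1)
  -- `sqrtSubst_sub` holds on a neighbourhood of x, so it can be differentiated; the linear relation
  -- passes to the Jacobians.
  have d4 := (d1.sub d2).congr_of_eventuallyEq (f₁ := fun x => (2 * r - 1) * sqrtSubst 1 x) (by
    filter_upwards [Ioi_mem_nhds hx] with y hy
    exact (sqrtSubst_sub hy).symm)
  have := d3.unique d4
  linear_combination (x ^ (-2 * a)) * this

/-! ### The covariance of fractional Brownian motion and the integral equation for the beta weight
-/

/-- The odd power function `sign x * |x| ^ p`. -/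
noncomputable def oddPow (p x : ℝ) : ℝ := if 0 < x then x ^ p else -(-x) ^ p

/-- The covariance `(u^(2H) + r^(2H) - |u - r|^(2H)) / 2` of fractional Brownian motion. -/
noncomputable def fbmCov (H u r : ℝ) : ℝ :=
  (u ^ (2 * H) + r ^ (2 * H) - |u - r| ^ (2 * H)) / 2

/-- The derivative of `fbmCov H u r` in `u`. -/
noncomputable def fbmCovDeriv (H r u : ℝ) : ℝ :=
  H * (u ^ (2 * H - 1) + oddPow (2 * H - 1) (r - u))

lemma oddPow_of_pos {p x : ℝ} (hx : 0 < x) : oddPow p x = x ^ p := if_pos hx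

lemma oddPow_of_nonpos {p x : ℝ} (hx : x ≤ 0) : oddPow p x = -(-x) ^ p := if_neg hx.not_gt

lemma intervalIntegrable_oddPow {p : ℝ} (hp : -1 < p) (a b : ℝ) :
    IntervalIntegrable (oddPow p) volume a b := by
  have h1 := intervalIntegral.intervalIntegrable_rpow' (a := a) (b := b) hp
  have h2 := (intervalIntegral.intervalIntegrable_rpow' (a := -a) (b := -b) hp).comp_sub_left 0
  simp only [zero_sub, neg_neg] at h2
  rw [intervalIntegrable_iff] at h1 h2 ⊢
  have h3 := (Integrable.indicator h1 (measurableSet_Ioi (a := (0 : ℝ)))).sub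
    (Integrable.indicator h2 (measurableSet_Iic (a := (0 : ℝ))))
  refine h3.congr (Eventually.of_forall fun x => ?_)
  by_cases hx : 0 < x
  · simp [oddPow, hx]
  · simp [oddPow, hx, not_lt.1 hx]

lemma intervalIntegrable_fbmCovDeriv {H : ℝ} (hH : 0 < H) (r a b : ℝ) :
    IntervalIntegrable (fbmCovDeriv H r) volume a b := by
  have h1 := intervalIntegral.intervalIntegrable_rpow' (a := a) (b := b)
    (r := 2 * H - 1) (by linarith)
  have h2 := (intervalIntegrable_oddPow (p := 2 * H - 1) (by linarith) (r - a) (r - b)).comp_sub_left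
    r
  simp only [sub_sub_cancel] at h2
  exact (h1.add h2).const_mul H

lemma hasDerivAt_abs_rpow_oddPow {q x : ℝ} (hx : x ≠ 0) :
    HasDerivAt (fun x : ℝ => |x| ^ q) (q * oddPow (q - 1) x) x := by
  rcases hx.lt_or_gt with h | h
  · have := ((hasDerivAt_neg x).rpow_const (p := q) (Or.inl (by linarith)))
    rw [oddPow_of_nonpos h.le]
    refine (this.congr_of_eventuallyEq ?_).congr_deriv (by ring)
    filter_upwards [Iio_mem_nhds h] with y hy
    rw [abs_of_neg hy]
  · have := ((hasDerivAt_id x).rpow_const (p := q) (Or.inl h.ne'))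
    rw [oddPow_of_pos h]
    refine (this.congr_of_eventuallyEq ?_).congr_deriv (by simp)
    filter_upwards [Ioi_mem_nhds h] with y hy
    rw [abs_of_pos hy]; rfl

lemma oddPow_neg {p x : ℝ} (hx : x ≠ 0) : oddPow p (-x) = -oddPow p x := by
  rcases hx.lt_or_gt with h | h
  · rw [oddPow_of_nonpos h.le, oddPow_of_pos (by linarith), neg_neg]
  · rw [oddPow_of_pos h, oddPow_of_nonpos (by linarith), neg_neg]

/-- The fundamental theorem of calculus for the covariance of fractional Brownian motion. -/
lemma integral_fbmCovDeriv {H : ℝ} (hH : 0 < H) (r : ℝ) {a b : ℝ} (ha : 0 ≤ a) (hab : a ≤ b) :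
    ∫ u in a..b, fbmCovDeriv H r u = fbmCov H b r - fbmCov H a r := by
  -- The kernel may be singular at u = r, so this point is put in the exceptional set.
  refine integral_eq_of_hasDerivAt_off_countable_of_le (fun u => fbmCov H u r) _ hab
    (s := {r}) (Set.countable_singleton _) ?_ ?_ (intervalIntegrable_fbmCovDeriv hH r a b)
  · unfold fbmCov
    have h2 : (0 : ℝ) ≤ 2 * H := by linarith
    have h3 : Continuous fun u : ℝ => u ^ (2 * H) := Real.continuous_rpow_const h2
    have h4 : Continuous fun u : ℝ => |u - r| ^ (2 * H) :=
      h3.comp (by fun_prop : Continuous fun u : ℝ => |u - r|)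
    fun_prop
  · rintro u ⟨hu, hur⟩
    have hu0 : u ≠ 0 := by linarith [hu.1]
    have hur : u - r ≠ 0 := sub_ne_zero.2 hur
    have h1 := (Real.hasDerivAt_rpow_const (p := 2 * H) (x := u) (Or.inl hu0))
    have h2 := (hasDerivAt_abs_rpow_oddPow (q := 2 * H) hur).comp u ((hasDerivAt_id u).sub_const r)
    have h3 := ((h1.add_const (r ^ (2 * H))).sub h2).div_const 2
    refine h3.congr_deriv ?_
    rw [fbmCovDeriv, ← neg_sub u r, oddPow_neg hur]
    ring

/-- The weight `u^a (1-u)^a`. -/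
noncomputable def betaWeight (a u : ℝ) : ℝ := u ^ a * (1 - u) ^ a

lemma betaWeight_one_sub (a u : ℝ) : betaWeight a (1 - u) = betaWeight a u := by
  rw [betaWeight, betaWeight, sub_sub_cancel, mul_comm]

lemma integral_Ioo_beta {s t : ℝ} (hs : 0 < s) (ht : 0 < t) :
    ∫ u in Set.Ioo (0 : ℝ) 1, u ^ (s - 1) * (1 - u) ^ (t - 1) =
      Real.Gamma s * Real.Gamma t / Real.Gamma (s + t) := by
  have h := beta_eq_betaIntegralReal s t hs ht
  rw [ProbabilityTheory.beta] at h
  rw [h, Complex.betaIntegral, intervalIntegral.integral_of_le (by norm_num),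
    ← integral_Ioc_eq_integral_Ioo, ← RCLike.re_to_complex, ← integral_re]
  · refine setIntegral_congr_fun measurableSet_Ioc fun x ⟨hx1, hx2⟩ => ?_
    norm_cast
    rw [← Complex.ofReal_cpow, ← Complex.ofReal_cpow, RCLike.re_to_complex, Complex.re_mul_ofReal,
      Complex.ofReal_re]
    all_goals linarith
  · convert! Complex.betaIntegral_convergent (u := s) (v := t) (by simpa) (by simpa)
    rw [intervalIntegrable_iff_integrableOn_Ioc_of_le (by simp), IntegrableOn]

/-- At r = 1 the last two factors merge into (1-u)^(-a), which gives a complete beta integral with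
denominator Γ(2) = 1. -/
lemma singularBeta_one {a : ℝ} (ha : -(1 / 2) < a) (ha' : a < 1 / 2) :
    singularBeta a 1 = Real.Gamma (1 + a) * Real.Gamma (1 - a) := by
  have := integral_Ioo_beta (s := 1 + a) (t := 1 - a) (by linarith) (by linarith)
  rw [show 1 + a + (1 - a) = 2 by ring, Real.Gamma_two, div_one] at this
  rw [← this, singularBeta]
  refine setIntegral_congr_fun measurableSet_Ioo fun x hx => ?_
  have : 0 < 1 - x := by linarith [hx.2]
  rw [mul_assoc, ← Real.rpow_add this]
  ring_nf

lemma intervalIntegrable_iff_integrableOn_Ioo {f : ℝ → ℝ} {a b : ℝ} (hab : a ≤ b) :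
    IntervalIntegrable f volume a b ↔ IntegrableOn f (Set.Ioo a b) := by
  rw [intervalIntegrable_iff_integrableOn_Ioc_of_le hab, integrableOn_Ioc_iff_integrableOn_Ioo]

section
variable {H : ℝ} (h0 : 0 < H) (h1 : H < 1)
include h0 h1

lemma integrableOn_betaWeight : IntegrableOn (betaWeight (1 / 2 - H)) (Set.Ioo 0 1) := by
  have hI := (integrableOn_Ioo_rpow (r := 1) (s := 1 / 2 - H) (by linarith)).add
    (integrableOn_Ioo_sub_rpow (r := 1) (s := 1 / 2 - H) (by linarith))
  rcases le_or_gt H (1 / 2) with h | h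
  · refine Integrable.mono' (g := fun _ => 1) (by simp) (by unfold betaWeight; fun_prop) ?_
    filter_upwards [ae_restrict_mem measurableSet_Ioo] with u hu
    have hu1 : 0 < 1 - u := by linarith [hu.2]
    have hu0 := hu.1
    unfold betaWeight
    rw [Real.norm_of_nonneg (by positivity)]
    exact mul_le_one₀ (Real.rpow_le_one hu0.le hu.2.le (by linarith)) (by positivity)
      (Real.rpow_le_one hu1.le (by linarith) (by linarith))
  · refine Integrable.mono' (hI.const_mul 2) (by unfold betaWeight; fun_prop) ?_
    filter_upwards [ae_restrict_mem measurableSet_Ioo] with u hu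
    have hu1 : 0 < 1 - u := by linarith [hu.2]
    have hu0 := hu.1
    unfold betaWeight
    rw [Real.norm_of_nonneg (by positivity)]
    simp only [Pi.add_apply]
    have key : ∀ v : ℝ, 1 / 2 ≤ v → v ^ (1 / 2 - H) ≤ 2 := fun v hv => by
      calc v ^ (1 / 2 - H) ≤ (1 / 2 : ℝ) ^ (1 / 2 - H) :=
            Real.rpow_le_rpow_of_nonpos (by norm_num) hv (by linarith)
        _ ≤ (1 / 2 : ℝ) ^ (-1 : ℝ) :=
            Real.rpow_le_rpow_of_exponent_ge (by norm_num) (by norm_num) (by linarith)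
        _ = 2 := by rw [Real.rpow_neg_one]; norm_num
    have p1 : 0 ≤ u ^ (1 / 2 - H) := by positivity
    have p2 : 0 ≤ (1 - u) ^ (1 / 2 - H) := by positivity
    rcases le_total u (1 / 2) with h | h
    · nlinarith [key (1 - u) (by linarith)]
    · nlinarith [key u h]

lemma integral_betaWeight :
    ∫ u in Set.Ioo 0 1, betaWeight (1 / 2 - H) u = Real.Gamma (3 / 2 - H) ^ 2 / Real.Gamma (3 - 2 * H) := by
  have := integral_Ioo_beta (s := 3 / 2 - H) (t := 3 / 2 - H) (by linarith) (by linarith)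
  rw [show 3 / 2 - H + (3 / 2 - H) = 3 - 2 * H by ring, show 3 / 2 - H - 1 = 1 / 2 - H by ring] at this
  rw [sq, ← this]
  rfl

lemma intervalIntegrable_betaWeight_mul_oddPow {r : ℝ} (hr : 0 ≤ r) (hr1 : r ≤ 1) :
    IntervalIntegrable (fun u => betaWeight (1 / 2 - H) u * oddPow (2 * H - 1) (r - u)) volume 0 r ∧
    ∫ u in 0..r, betaWeight (1 / 2 - H) u * oddPow (2 * H - 1) (r - u) =
      singularBeta (1 / 2 - H) r := by
  have e : ∀ u ∈ Set.Ioo 0 r, u ^ (1 / 2 - H) * (1 - u) ^ (1 / 2 - H) * (r - u) ^ (-2 * (1 / 2 - H)) =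
      betaWeight (1 / 2 - H) u * oddPow (2 * H - 1) (r - u) := fun u hu => by
    rw [oddPow_of_pos (by linarith [hu.2]), betaWeight]
    ring_nf
  constructor
  · rw [intervalIntegrable_iff_integrableOn_Ioo hr]
    exact (integrableOn_singularBeta (a := 1 / 2 - H) (by linarith) (by linarith) hr1).congr_fun e
      measurableSet_Ioo
  · rw [intervalIntegral.integral_of_le hr, integral_Ioc_eq_integral_Ioo, singularBeta]
    exact (setIntegral_congr_fun measurableSet_Ioo e).symm

/-- The reflection u ↦ 1-u fixes the weight and changes the sign of the odd power, so the part
beyond r is the part before 1-r with a minus sign. -/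
lemma intervalIntegrable_betaWeight_mul_oddPow' {r : ℝ} (hr : 0 ≤ r) (hr1 : r ≤ 1) :
    IntervalIntegrable (fun u => betaWeight (1 / 2 - H) u * oddPow (2 * H - 1) (r - u)) volume r 1 ∧
    ∫ u in r..1, betaWeight (1 / 2 - H) u * oddPow (2 * H - 1) (r - u) =
      -singularBeta (1 / 2 - H) (1 - r) := by
  obtain ⟨hi, he⟩ := intervalIntegrable_betaWeight_mul_oddPow h0 h1 (r := 1 - r) (by linarith)
    (by linarith)
  have key : ∀ u, r < u → betaWeight (1 / 2 - H) u * oddPow (2 * H - 1) (r - u) =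
      -(betaWeight (1 / 2 - H) (1 - u) * oddPow (2 * H - 1) (1 - r - (1 - u))) := fun u hu => by
    rw [betaWeight_one_sub, show 1 - r - (1 - u) = -(r - u) by ring, oddPow_neg (by linarith)]
    ring
  constructor
  · have hi' := (hi.comp_sub_left 1).neg.symm
    simp only [sub_zero, sub_sub_cancel] at hi'
    rw [intervalIntegrable_iff_integrableOn_Ioo hr1] at hi' ⊢
    exact hi'.congr_fun (fun u hu => (key u hu.1).symm) measurableSet_Ioo
  · rw [← he, intervalIntegral.integral_of_le hr1]
    rw [setIntegral_congr_fun measurableSet_Ioc fun u hu => key u hu.1,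
      ← intervalIntegral.integral_of_le hr1, intervalIntegral.integral_neg,
      intervalIntegral.integral_comp_sub_left
        (fun v => betaWeight (1 / 2 - H) v * oddPow (2 * H - 1) (1 - r - v))]
    simp

/-- The weight `u^(1/2-H) (1-u)^(1/2-H)` solves the integral equation whose right-hand side is
linear. -/
theorem integral_betaWeight_mul_fbmCovDeriv {r : ℝ} (hr : 0 ≤ r) (hr1 : r ≤ 1) :
    IntegrableOn (fun u => betaWeight (1 / 2 - H) u * fbmCovDeriv H r u) (Set.Ioo 0 1) ∧
    ∫ u in Set.Ioo 0 1, betaWeight (1 / 2 - H) u * fbmCovDeriv H r u =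
      2 * H * Real.Gamma (3 / 2 - H) * Real.Gamma (H + 1 / 2) * r := by
  obtain ⟨i1, e1⟩ := intervalIntegrable_betaWeight_mul_oddPow h0 h1 hr hr1
  obtain ⟨i2, e2⟩ := intervalIntegrable_betaWeight_mul_oddPow' h0 h1 hr hr1
  have i3 := i1.trans i2
  have e3 := intervalIntegral.integral_add_adjacent_intervals i1 i2
  obtain ⟨i4, e4⟩ := intervalIntegrable_betaWeight_mul_oddPow' h0 h1 le_rfl zero_le_one
  have hJ := singularBeta_sub (a := 1 / 2 - H) (by linarith) (by linarith) hr hr1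
  have hJ1 := singularBeta_one (a := 1 / 2 - H) (by linarith) (by linarith)
  rw [show 1 + (1 / 2 - H) = 3 / 2 - H by ring, show 1 - (1 / 2 - H) = H + 1 / 2 by ring] at hJ1
  rw [intervalIntegrable_iff_integrableOn_Ioo zero_le_one] at i3 i4
  rw [intervalIntegral.integral_of_le zero_le_one, integral_Ioc_eq_integral_Ioo] at e3 e4
  -- The term u^(2H-1) is minus the odd power kernel at r = 0. Its contribution is the constant J(1)
  -- (J is `singularBeta (1 / 2 - H)`), which turns (2r-1) J(1) into 2r J(1).
  have key : ∀ u ∈ Set.Ioo (0 : ℝ) 1, betaWeight (1 / 2 - H) u * fbmCovDeriv H r u =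
      H * (betaWeight (1 / 2 - H) u * oddPow (2 * H - 1) (r - u)
        - betaWeight (1 / 2 - H) u * oddPow (2 * H - 1) (0 - u)) := fun u hu => by
    rw [fbmCovDeriv, zero_sub, oddPow_neg hu.1.ne', oddPow_of_pos hu.1]
    ring
  constructor
  · exact IntegrableOn.congr_fun ((i3.sub i4).const_mul H) (fun u hu => (key u hu).symm) measurableSet_Ioo
  · rw [setIntegral_congr_fun measurableSet_Ioo key, integral_const_mul, integral_sub i3 i4, ← e3,
      e1, e2, e4, sub_zero, hJ1]
    rw [hJ1] at hJ
    linear_combination H * hJ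
end

/-! ### Riemann-type sums for a weight singular at the endpoints -/

lemma floor_mul_eq_of_mem {n j : ℕ} (hn : 0 < n) {u : ℝ}
    (hu : u ∈ Set.Ioo ((j : ℝ) / n) ((j + 1 : ℕ) / n)) : ⌊(n : ℝ) * u⌋₊ = j := by
  have hn' : (0 : ℝ) < n := by exact_mod_cast hn
  obtain ⟨h1, h2⟩ := hu
  rw [div_lt_iff₀' hn'] at h1
  rw [lt_div_iff₀' hn'] at h2
  rw [Nat.floor_eq_iff (by linarith [(Nat.cast_nonneg j : (0 : ℝ) ≤ j)])]
  push_cast at h2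
  exact ⟨h1.le, h2⟩

/-- A sum over the uniform grid as an integral of a step function. -/
lemma sum_mul_integral_grid {n : ℕ} (hn : 0 < n) (f : ℕ → ℝ) {g : ℝ → ℝ}
    (hg : IntervalIntegrable g volume 0 1) :
    IntervalIntegrable (fun u => f ⌊(n : ℝ) * u⌋₊ * g u) volume 0 1 ∧
    ∑ j ∈ Finset.range n, f j * ∫ u in ((j : ℝ) / n)..((j + 1 : ℕ) / n), g u =
      ∫ u in 0..1, f ⌊(n : ℝ) * u⌋₊ * g u := by
  have hn' : (0 : ℝ) < n := by exact_mod_cast hn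
  have hle : ∀ j : ℕ, (j : ℝ) / n ≤ (j + 1 : ℕ) / n := fun j => by
    push_cast; gcongr; linarith
  have hi : ∀ j < n, IntervalIntegrable (fun u => f ⌊(n : ℝ) * u⌋₊ * g u) volume
      ((j : ℝ) / n) ((j + 1 : ℕ) / n) := fun j hj => by
    have : IntervalIntegrable g volume ((j : ℝ) / n) ((j + 1 : ℕ) / n) := by
      refine hg.mono_set ?_
      rw [Set.uIcc_of_le (hle j), Set.uIcc_of_le zero_le_one]
      refine Set.Icc_subset_Icc (by positivity) ?_
      rw [div_le_one hn']
      exact_mod_cast hj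
    rw [intervalIntegrable_iff_integrableOn_Ioo (hle j)] at this ⊢
    refine IntegrableOn.congr_fun (Integrable.const_mul this (f j)) (fun u hu => ?_) measurableSet_Ioo
    simp only [floor_mul_eq_of_mem hn hu]
  have h1 := intervalIntegral.sum_integral_adjacent_intervals (a := fun j : ℕ => (j : ℝ) / n) hi
  have h2 := IntervalIntegrable.trans_iterate (a := fun j : ℕ => (j : ℝ) / n) hi
  simp only [Nat.cast_zero, zero_div, div_self hn'.ne'] at h1 h2
  refine ⟨h2, ?_⟩
  rw [← h1]
  refine Finset.sum_congr rfl fun j _ => ?_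
  rw [intervalIntegral.integral_of_le (hle j), intervalIntegral.integral_of_le (hle j),
    integral_Ioc_eq_integral_Ioo, integral_Ioc_eq_integral_Ioo, ← integral_const_mul]
  refine setIntegral_congr_fun measurableSet_Ioo fun u hu => ?_
  simp only [floor_mul_eq_of_mem hn hu]

lemma betaWeight_nonneg {a u : ℝ} (hu : 0 ≤ u) (hu1 : u ≤ 1) : 0 ≤ betaWeight a u :=
  mul_nonneg (Real.rpow_nonneg hu _) (Real.rpow_nonneg (by linarith) _)

lemma betaWeight_le_one {a u : ℝ} (ha : 0 ≤ a) (hu : 0 ≤ u) (hu1 : u ≤ 1) : betaWeight a u ≤ 1 :=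
  mul_le_one₀ (Real.rpow_le_one hu hu1 ha) (Real.rpow_nonneg (by linarith) _)
    (Real.rpow_le_one (by linarith) (by linarith) ha)

lemma floor_div_mem {n : ℕ} (hn : 0 < n) {u : ℝ} (hu : u ∈ Set.Ioo (0 : ℝ) 1) :
    0 ≤ (⌊(n : ℝ) * u⌋₊ : ℝ) / n ∧ (⌊(n : ℝ) * u⌋₊ : ℝ) / n ≤ u := by
  have hn' : (0 : ℝ) < n := by exact_mod_cast hn
  refine ⟨by positivity, ?_⟩
  rw [div_le_iff₀' hn']
  exact Nat.floor_le (mul_nonneg hn'.le hu.1.le)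

/-- Domination of the discretized weight when it blows up: off the first cell, u < (j+1)/n ≤ 2j/n,
so moving u to its left grid point costs at most 2^(-a) ≤ 2 in the first factor, and the second
factor only decreases. -/
lemma betaWeight_floor_le {a : ℝ} (ha : -(1 / 2) < a) (ha' : a ≤ 0) {n : ℕ} (hn : 0 < n) {u : ℝ}
    (hu : u ∈ Set.Ioo (0 : ℝ) 1) :
    betaWeight a ((⌊(n : ℝ) * u⌋₊ : ℝ) / n) ≤ 2 * betaWeight a u := by
  have hn' : (0 : ℝ) < n := by exact_mod_cast hn
  obtain ⟨f0, f1⟩ := floor_div_mem hn hu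
  have hw := betaWeight_nonneg (a := a) hu.1.le hu.2.le
  rcases ha'.eq_or_lt with rfl | ha'
  · simp [betaWeight]
  have hj : ⌊(n : ℝ) * u⌋₊ < (n : ℝ) * u + 1 :=
    (Nat.floor_le (mul_nonneg hn'.le hu.1.le)).trans_lt (by linarith)
  have hj' := Nat.lt_floor_add_one ((n : ℝ) * u)
  rcases Nat.eq_zero_or_pos ⌊(n : ℝ) * u⌋₊ with h | h
  · rw [h, betaWeight]
    -- `0 ^ a` is `0` for a < 0, so the weight at the left endpoint counts as zero, not as infinite.
    simp only [Nat.cast_zero, zero_div, Real.zero_rpow ha'.ne, zero_mul]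
    positivity
  · have h' : (1 : ℝ) ≤ ⌊(n : ℝ) * u⌋₊ := by exact_mod_cast h
    have f2 : 1 / 2 * u ≤ (⌊(n : ℝ) * u⌋₊ : ℝ) / n := by
      rw [le_div_iff₀' hn']; linarith
    have hu0 := hu.1
    have hu1 : 0 < 1 - u := by linarith [hu.2]
    have e1 : ((⌊(n : ℝ) * u⌋₊ : ℝ) / n) ^ a ≤ 2 * u ^ a := by
      calc _ ≤ (1 / 2 * u) ^ a := Real.rpow_le_rpow_of_nonpos (by positivity) f2 ha'.le
        _ = (1 / 2 : ℝ) ^ a * u ^ a := Real.mul_rpow (by norm_num) hu0.le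
        _ ≤ (1 / 2 : ℝ) ^ (-1 : ℝ) * u ^ a := by
          gcongr ?_ * _
          exact Real.rpow_le_rpow_of_exponent_ge (by norm_num) (by norm_num) (by linarith)
        _ = _ := by rw [Real.rpow_neg_one]; norm_num
    have e2 : (1 - (⌊(n : ℝ) * u⌋₊ : ℝ) / n) ^ a ≤ (1 - u) ^ a :=
      Real.rpow_le_rpow_of_nonpos hu1 (by linarith) ha'.le
    unfold betaWeight
    calc _ ≤ (2 * u ^ a) * (1 - u) ^ a :=
          mul_le_mul e1 e2 (Real.rpow_nonneg (by linarith) _) (by positivity)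
      _ = _ := by ring

lemma tendsto_betaWeight_floor (a : ℝ) {u : ℝ} (hu : u ∈ Set.Ioo (0 : ℝ) 1) :
    Tendsto (fun n : ℕ => betaWeight a ((⌊(n : ℝ) * u⌋₊ : ℝ) / n)) atTop (𝓝 (betaWeight a u)) := by
  have h1 : Tendsto (fun n : ℕ => (⌊(n : ℝ) * u⌋₊ : ℝ) / n) atTop (𝓝 u) := by
    have := (tendsto_nat_floor_mul_div_atTop hu.1.le).comp tendsto_natCast_atTop_atTop
    refine this.congr fun n => ?_
    simp [mul_comm]
  have hu1 : 0 < 1 - u := by linarith [hu.2]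
  exact (h1.rpow_const (Or.inl hu.1.ne')).mul ((h1.const_sub 1).rpow_const (Or.inl hu1.ne'))

/-- Riemann-type sums of `w g` for the singular weight `w`. -/
lemma tendsto_sum_betaWeight {a : ℝ} (ha : -(1 / 2) < a) {g : ℝ → ℝ}
    (hg : IntervalIntegrable g volume 0 1)
    (hwg : IntegrableOn (fun u => betaWeight a u * g u) (Set.Ioo 0 1)) :
    Tendsto (fun n : ℕ => ∑ j ∈ Finset.range n,
      betaWeight a ((j : ℝ) / n) * ∫ u in ((j : ℝ) / n)..((j + 1 : ℕ) / n), g u) atTop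
      (𝓝 (∫ u in Set.Ioo 0 1, betaWeight a u * g u)) := by
  have hg' := (intervalIntegrable_iff_integrableOn_Ioo zero_le_one).1 hg
  have h1 : Tendsto (fun n : ℕ => ∫ u in Set.Ioo (0 : ℝ) 1,
      betaWeight a ((⌊(n : ℝ) * u⌋₊ : ℝ) / n) * g u) atTop
      (𝓝 (∫ u in Set.Ioo 0 1, betaWeight a u * g u)) := by
    refine tendsto_integral_filter_of_dominated_convergence
      -- The first term dominates when a ≥ 0 (weight at most 1), the second when a ≤ 0
      -- (`betaWeight_floor_le`).
      (fun u => |g u| + 2 * |betaWeight a u * g u|) ?_ ?_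
      ((Integrable.abs hg').add ((Integrable.abs hwg).const_mul 2)) ?_
    · filter_upwards [eventually_gt_atTop 0] with n hn
      have := (sum_mul_integral_grid hn (fun j => betaWeight a ((j : ℝ) / n)) hg).1
      exact ((intervalIntegrable_iff_integrableOn_Ioo zero_le_one).1 this).aestronglyMeasurable
    · filter_upwards [eventually_gt_atTop 0] with n hn
      filter_upwards [ae_restrict_mem measurableSet_Ioo] with u hu
      obtain ⟨f0, f1⟩ := floor_div_mem hn hu
      have hw := betaWeight_nonneg (a := a) f0 (f1.trans hu.2.le)
      have hw' := betaWeight_nonneg (a := a) hu.1.le hu.2.le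
      rw [Real.norm_eq_abs, abs_mul, abs_mul, abs_of_nonneg hw, abs_of_nonneg hw']
      have hg0 := abs_nonneg (g u)
      rcases le_total 0 a with h | h
      · have := betaWeight_le_one h f0 (f1.trans hu.2.le)
        have := mul_nonneg hw' hg0
        nlinarith
      · have := betaWeight_floor_le ha h hn hu
        nlinarith
    · filter_upwards [ae_restrict_mem measurableSet_Ioo] with u hu
      exact (tendsto_betaWeight_floor a hu).mul_const _
  refine h1.congr' ?_
  filter_upwards [eventually_gt_atTop 0] with n hn
  rw [(sum_mul_integral_grid hn (fun j => betaWeight a ((j : ℝ) / n)) hg).2,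
    intervalIntegral.integral_of_le zero_le_one, integral_Ioc_eq_integral_Ioo]

section
variable {H : ℝ} (h0 : 0 < H) (h1 : H < 1)
include h0 h1

theorem tendsto_sum_betaWeight_fbmCov {r : ℝ} (hr : 0 ≤ r) (hr1 : r ≤ 1) :
    Tendsto (fun n : ℕ => ∑ j ∈ Finset.range n, betaWeight (1 / 2 - H) ((j : ℝ) / n) *
      (fbmCov H ((j + 1 : ℕ) / n) r - fbmCov H (j / n) r)) atTop
      (𝓝 (2 * H * Real.Gamma (3 / 2 - H) * Real.Gamma (H + 1 / 2) * r)) := by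
  obtain ⟨hi, he⟩ := integral_betaWeight_mul_fbmCovDeriv h0 h1 hr hr1
  rw [← he]
  refine (tendsto_sum_betaWeight (by linarith) (intervalIntegrable_fbmCovDeriv h0 r 0 1) hi).congr
    fun n => Finset.sum_congr rfl fun j _ => ?_
  rw [integral_fbmCovDeriv h0 r (by positivity) (by push_cast; gcongr; linarith)]

theorem tendsto_sum_betaWeight_one :
    Tendsto (fun n : ℕ => ∑ j ∈ Finset.range n, betaWeight (1 / 2 - H) ((j : ℝ) / n) * (1 / n)) atTop
      (𝓝 (Real.Gamma (3 / 2 - H) ^ 2 / Real.Gamma (3 - 2 * H))) := by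
  rw [← integral_betaWeight h0 h1]
  have := tendsto_sum_betaWeight (a := 1 / 2 - H) (by linarith) (g := fun _ => 1) (by simp)
    (by simpa using integrableOn_betaWeight h0 h1)
  simp only [mul_one] at this
  refine this.congr fun n => Finset.sum_congr rfl fun j _ => ?_
  congr 1
  simp only [intervalIntegral.integral_const, smul_eq_mul, mul_one]
  push_cast; ring
end

/-! ### A variance bound for the Riemann sums, uniform in the number of cells -/

/-- The covariance of the `j`-th and `k`-th increments of fractional Brownian motion on the
uniform grid with `n` cells. -/
noncomputable def gridIncrCov (H : ℝ) (n j k : ℕ) : ℝ :=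
  fbmCov H ((j + 1 : ℕ) / n) ((k + 1 : ℕ) / n) - fbmCov H (j / n) ((k + 1 : ℕ) / n) -
    (fbmCov H ((j + 1 : ℕ) / n) (k / n) - fbmCov H (j / n) (k / n))

/-- The derivative in `u` of the covariance of the value at `u` with the `k`-th increment. -/
noncomputable def gridKernel (H : ℝ) (n k : ℕ) (u : ℝ) : ℝ :=
  fbmCovDeriv H ((k + 1 : ℕ) / n) u - fbmCovDeriv H (k / n) u

lemma oddPow_monotone {p : ℝ} (hp : 0 ≤ p) : Monotone (oddPow p) := by
  intro x y hxy
  rcases lt_or_ge 0 x with hx | hx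
  · rw [oddPow_of_pos hx, oddPow_of_pos (hx.trans_le hxy)]
    exact Real.rpow_le_rpow hx.le hxy hp
  · rw [oddPow_of_nonpos hx]
    have h := Real.rpow_nonneg (neg_nonneg.2 hx) p
    rcases lt_or_ge 0 y with hy | hy
    · rw [oddPow_of_pos hy]
      have := Real.rpow_nonneg hy.le p
      linarith
    · rw [oddPow_of_nonpos hy]
      have := Real.rpow_le_rpow (neg_nonneg.2 hy) (neg_le_neg hxy) hp
      linarith

lemma gridKernel_eq (H : ℝ) (n k : ℕ) (u : ℝ) :
    gridKernel H n k u =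
      H * (oddPow (2 * H - 1) ((k + 1 : ℕ) / n - u) - oddPow (2 * H - 1) (k / n - u)) := by
  unfold gridKernel fbmCovDeriv
  ring

lemma betaWeight_grid_nonneg (a : ℝ) {n k : ℕ} (hk : k < n) : 0 ≤ betaWeight a ((k : ℝ) / n) := by
  have hn' : (0 : ℝ) < n := by exact_mod_cast (Nat.zero_le k).trans_lt hk
  refine betaWeight_nonneg (by positivity) ?_
  rw [div_le_one hn']; exact_mod_cast hk.le

lemma natCast_div_mono (n : ℕ) {j k : ℕ} (h : j ≤ k) : (j : ℝ) / n ≤ (k : ℝ) / n := by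
  gcongr

section
variable {H : ℝ} (h0 : 0 < H)
include h0

lemma intervalIntegrable_gridKernel (n k : ℕ) (a b : ℝ) :
    IntervalIntegrable (gridKernel H n k) volume a b :=
  (intervalIntegrable_fbmCovDeriv h0 _ a b).sub (intervalIntegrable_fbmCovDeriv h0 _ a b)

lemma integral_gridKernel (n j k : ℕ) :
    ∫ u in ((j : ℝ) / n)..((j + 1 : ℕ) / n), gridKernel H n k u = gridIncrCov H n j k := by
  have hle := natCast_div_mono n j.le_succ
  unfold gridKernel gridIncrCov
  rw [intervalIntegral.integral_sub (intervalIntegrable_fbmCovDeriv h0 _ _ _)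
    (intervalIntegrable_fbmCovDeriv h0 _ _ _), integral_fbmCovDeriv h0 _ (by positivity) hle,
    integral_fbmCovDeriv h0 _ (by positivity) hle]

lemma gridIncrCov_self (n j : ℕ) : gridIncrCov H n j j = (1 / n : ℝ) ^ (2 * H) := by
  have e : ((j + 1 : ℕ) / n : ℝ) - j / n = 1 / n := by push_cast; ring
  have h2 : (0 : ℝ) ^ (2 * H) = 0 := Real.zero_rpow (by linarith)
  unfold gridIncrCov fbmCov
  rw [abs_sub_comm ((j : ℝ) / n) ((j + 1 : ℕ) / n), e,
    abs_of_nonneg (by positivity : (0 : ℝ) ≤ 1 / n)]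
  simp only [sub_self, abs_zero, h2]
  ring

/-- The sum over k telescopes to the covariance of the j-th increment with the value at time 1,
which monotonicity of x^(2H) makes nonnegative. -/
lemma sum_gridIncrCov_nonneg {n : ℕ} {j : ℕ} (hj : j < n) :
    0 ≤ ∑ k ∈ Finset.range n, gridIncrCov H n j k := by
  have hn' : (0 : ℝ) < n := by exact_mod_cast (Nat.zero_le j).trans_lt hj
  set F : ℕ → ℝ := fun k => fbmCov H ((j + 1 : ℕ) / n) (k / n) - fbmCov H (j / n) (k / n) with hF
  have e : ∀ k, gridIncrCov H n j k = F (k + 1) - F k := fun k => rfl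
  rw [Finset.sum_congr rfl fun k _ => e k, Finset.sum_range_sub F]
  have hjn : ((j + 1 : ℕ) : ℝ) / n ≤ 1 := by
    rw [div_le_one hn']; exact_mod_cast hj
  have hj0 : 0 ≤ (j : ℝ) / n := by positivity
  have hle := natCast_div_mono n j.le_succ
  have h2 : (0 : ℝ) ^ (2 * H) = 0 := Real.zero_rpow (by linarith)
  simp only [Nat.cast_zero, zero_div, div_self hn'.ne', hF, fbmCov, sub_zero, h2, abs_of_nonneg hj0,
    abs_of_nonneg (hj0.trans hle)]
  rw [abs_sub_comm, abs_sub_comm _ (1 : ℝ), abs_of_nonneg (by linarith : 0 ≤ 1 - (j : ℝ) / n),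
    abs_of_nonneg (by linarith : 0 ≤ 1 - ((j + 1 : ℕ) : ℝ) / n)]
  have g1 := Real.rpow_le_rpow hj0 hle (by linarith : 0 ≤ 2 * H)
  have g2 := Real.rpow_le_rpow (by linarith : 0 ≤ 1 - ((j + 1 : ℕ) : ℝ) / n)
    (by linarith : 1 - ((j + 1 : ℕ) : ℝ) / n ≤ 1 - (j : ℝ) / n) (by linarith : 0 ≤ 2 * H)
  linarith

lemma gridKernel_nonneg (hH : 1 / 2 ≤ H) (n k : ℕ) (u : ℝ) : 0 ≤ gridKernel H n k u := by
  rw [gridKernel_eq]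
  have := natCast_div_mono n k.le_succ
  exact mul_nonneg h0.le (sub_nonneg.2 (oddPow_monotone (by linarith) (by linarith)))

lemma gridKernel_self_nonneg {n k : ℕ} {u : ℝ}
    (hu : u ∈ Set.Ioo ((k : ℝ) / n) ((k + 1 : ℕ) / n)) : 0 ≤ gridKernel H n k u := by
  rw [gridKernel_eq, oddPow_of_pos (by linarith [hu.2]), oddPow_of_nonpos (by linarith [hu.1])]
  have := Real.rpow_nonneg (by linarith [hu.2] : 0 ≤ ((k + 1 : ℕ) : ℝ) / n - u) (2 * H - 1)
  have := Real.rpow_nonneg (by linarith [hu.1] : 0 ≤ -((k : ℝ) / n - u)) (2 * H - 1)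
  exact mul_nonneg h0.le (by linarith)

/-- Distinct increments are negatively correlated for H ≤ 1/2: away from its singularity the odd
power of exponent 2H-1 ≤ 0 is decreasing, and for j ≠ k the point u lies outside the k-th cell. -/
lemma gridKernel_nonpos (hH : H ≤ 1 / 2) {n j k : ℕ} (hjk : j ≠ k) {u : ℝ}
    (hu : u ∈ Set.Ioo ((j : ℝ) / n) ((j + 1 : ℕ) / n)) : gridKernel H n k u ≤ 0 := by
  rw [gridKernel_eq]
  have hle := natCast_div_mono n k.le_succ
  refine mul_nonpos_of_nonneg_of_nonpos h0.le ?_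
  rcases hjk.lt_or_gt with h | h
  · have h3 := natCast_div_mono n (Nat.succ_le_of_lt h)
    have h4 : 0 < (k : ℝ) / n - u := by linarith [hu.2]
    rw [oddPow_of_pos h4, oddPow_of_pos (by linarith)]
    have := Real.rpow_le_rpow_of_nonpos (z := 2 * H - 1) h4
      (by linarith : _ ≤ ((k + 1 : ℕ) : ℝ) / n - u) (by linarith)
    linarith
  · have h3 := natCast_div_mono n (Nat.succ_le_of_lt h)
    have h4 : ((k + 1 : ℕ) : ℝ) / n - u < 0 := by linarith [hu.1]
    rw [oddPow_of_nonpos h4.le, oddPow_of_nonpos (by linarith)]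
    have := Real.rpow_le_rpow_of_nonpos (z := 2 * H - 1) (neg_pos.2 h4)
      (by linarith : _ ≤ -((k : ℝ) / n - u)) (by linarith)
    linarith

lemma integral_abs_gridKernel (hH : H ≤ 1 / 2) (n j k : ℕ) :
    ∫ u in ((j : ℝ) / n)..((j + 1 : ℕ) / n), |gridKernel H n k u| =
      if j = k then gridIncrCov H n j k else -gridIncrCov H n j k := by
  have hle := natCast_div_mono n j.le_succ
  rw [← integral_gridKernel h0, intervalIntegral.integral_of_le hle,
    intervalIntegral.integral_of_le hle, integral_Ioc_eq_integral_Ioo,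
    integral_Ioc_eq_integral_Ioo]
  split_ifs with h
  · subst h
    exact setIntegral_congr_fun measurableSet_Ioo fun u hu =>
      abs_of_nonneg (gridKernel_self_nonneg h0 hu)
  · rw [← integral_neg]
    exact setIntegral_congr_fun measurableSet_Ioo fun u hu =>
      abs_of_nonpos (gridKernel_nonpos h0 hH h hu)

/-- Only the diagonal term is positive, so the sum of absolute values is twice the diagonal minus
the full row sum. The row sum is nonnegative and the diagonal is n^(-2H) ≤ 1. -/
lemma sum_integral_abs_gridKernel_le (hH : H ≤ 1 / 2) {n j : ℕ} (hj : j < n) :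
    ∑ k ∈ Finset.range n, ∫ u in ((j : ℝ) / n)..((j + 1 : ℕ) / n), |gridKernel H n k u| ≤ 2 := by
  have hn : 1 ≤ n := by omega
  have hn' : (1 : ℝ) ≤ n := by exact_mod_cast hn
  have e : ∀ k, ∫ u in ((j : ℝ) / n)..((j + 1 : ℕ) / n), |gridKernel H n k u| =
      (if j = k then 2 * gridIncrCov H n j k else 0) - gridIncrCov H n j k := fun k => by
    rw [integral_abs_gridKernel h0 hH]
    split_ifs <;> ring
  rw [Finset.sum_congr rfl fun k _ => e k, Finset.sum_sub_distrib, Finset.sum_ite_eq,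
    if_pos (Finset.mem_range.2 hj), gridIncrCov_self h0]
  have h1 := sum_gridIncrCov_nonneg h0 hj
  have h2 : (1 / n : ℝ) ^ (2 * H) ≤ 1 :=
    Real.rpow_le_one (by positivity) ((div_le_one (by linarith)).2 hn') (by linarith)
  linarith

variable (h1 : H < 1)
include h1

lemma integral_betaWeight_mul_gridKernel {n k : ℕ} (hk : k < n) :
    IntegrableOn (fun u => betaWeight (1 / 2 - H) u * gridKernel H n k u) (Set.Ioo 0 1) ∧
    ∫ u in Set.Ioo 0 1, betaWeight (1 / 2 - H) u * gridKernel H n k u =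
      2 * H * Real.Gamma (3 / 2 - H) * Real.Gamma (H + 1 / 2) * (1 / n) := by
  have hn' : (0 : ℝ) < n := by exact_mod_cast (Nat.zero_le k).trans_lt hk
  have hk1 : ((k + 1 : ℕ) : ℝ) / n ≤ 1 := by
    rw [div_le_one hn']; exact_mod_cast hk
  have hle := natCast_div_mono n k.le_succ
  obtain ⟨i1, e1⟩ := integral_betaWeight_mul_fbmCovDeriv h0 h1 (by positivity) hk1
  obtain ⟨i2, e2⟩ := integral_betaWeight_mul_fbmCovDeriv h0 h1 (r := (k : ℝ) / n) (by positivity)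
    (hle.trans hk1)
  simp only [gridKernel, mul_sub]
  refine ⟨i1.sub i2, ?_⟩
  rw [integral_sub i1 i2, e1, e2]
  push_cast
  ring

omit h1 in
lemma sum_betaWeight_gridIncrCov {n : ℕ} (hn : 0 < n) (k : ℕ) :
    IntegrableOn (fun u => betaWeight (1 / 2 - H) ((⌊(n : ℝ) * u⌋₊ : ℝ) / n) * gridKernel H n k u)
      (Set.Ioo 0 1) ∧
    ∑ j ∈ Finset.range n, betaWeight (1 / 2 - H) ((j : ℝ) / n) * gridIncrCov H n j k =
    ∫ u in Set.Ioo 0 1, betaWeight (1 / 2 - H) ((⌊(n : ℝ) * u⌋₊ : ℝ) / n) * gridKernel H n k u := by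
  obtain ⟨hi, he⟩ := sum_mul_integral_grid hn (fun j => betaWeight (1 / 2 - H) ((j : ℝ) / n))
    (intervalIntegrable_gridKernel h0 n k 0 1)
  rw [intervalIntegral.integral_of_le zero_le_one, integral_Ioc_eq_integral_Ioo] at he
  refine ⟨(intervalIntegrable_iff_integrableOn_Ioo zero_le_one).1 hi, he ▸ ?_⟩
  exact Finset.sum_congr rfl fun j _ => by rw [integral_gridKernel h0]

/-- For H ≥ 1/2 the kernel is nonnegative, so the discretized weight can be replaced by twice the
true weight, and the integral equation evaluates each inner sum. -/
lemma sum_sum_betaWeight_le_of_half_le (hH : 1 / 2 ≤ H) {n : ℕ} (hn : 0 < n) :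
    ∑ k ∈ Finset.range n, betaWeight (1 / 2 - H) ((k : ℝ) / n) *
      ∑ j ∈ Finset.range n, betaWeight (1 / 2 - H) ((j : ℝ) / n) * gridIncrCov H n j k ≤
    2 * (2 * H * Real.Gamma (3 / 2 - H) * Real.Gamma (H + 1 / 2)) *
      ∑ k ∈ Finset.range n, betaWeight (1 / 2 - H) ((k : ℝ) / n) * (1 / n) := by
  rw [Finset.mul_sum]
  refine Finset.sum_le_sum fun k hk => ?_
  have hk := Finset.mem_range.1 hk
  obtain ⟨i1, e1⟩ := integral_betaWeight_mul_gridKernel h0 h1 hk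
  obtain ⟨i2, e2⟩ := sum_betaWeight_gridIncrCov h0 hn k
  have hw := betaWeight_grid_nonneg (1 / 2 - H) hk
  have : ∑ j ∈ Finset.range n, betaWeight (1 / 2 - H) ((j : ℝ) / n) * gridIncrCov H n j k ≤
      2 * (2 * H * Real.Gamma (3 / 2 - H) * Real.Gamma (H + 1 / 2) * (1 / n)) := by
    rw [e2, ← e1, ← integral_const_mul]
    refine setIntegral_mono_on i2 (Integrable.const_mul i1 2) measurableSet_Ioo fun u hu => ?_
    rw [← mul_assoc]
    exact mul_le_mul_of_nonneg_right (betaWeight_floor_le (by linarith) (by linarith) hn hu)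
      (gridKernel_nonneg h0 hH n k u)
  calc _ ≤ _ := mul_le_mul_of_nonneg_left this hw
    _ = _ := by ring

omit h0 h1 in
-- Both factors of the weight are monotone and at most 1. The bound uses only the ends x and z of
-- the cell, so that it telescopes over the grid.
lemma abs_betaWeight_sub_le {a x y z : ℝ} (ha : 0 ≤ a) (hx : 0 ≤ x) (hxy : x ≤ y) (hyz : y ≤ z)
    (hz : z ≤ 1) :
    |betaWeight a x - betaWeight a y| ≤ (z ^ a - x ^ a) + ((1 - x) ^ a - (1 - z) ^ a) := by
  have p1 := Real.rpow_le_rpow hx hxy ha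
  have p2 := Real.rpow_le_rpow (hx.trans hxy) hyz ha
  have q1 := Real.rpow_le_rpow (by linarith) (by linarith : 1 - y ≤ 1 - x) ha
  have q2 := Real.rpow_le_rpow (by linarith) (by linarith : 1 - z ≤ 1 - y) ha
  have p3 : y ^ a ≤ 1 := Real.rpow_le_one (by linarith) (by linarith) ha
  have q3 : (1 - x) ^ a ≤ 1 := Real.rpow_le_one (by linarith) (by linarith) ha
  have p4 := Real.rpow_nonneg (hx.trans hxy) a
  have q4 := Real.rpow_nonneg (by linarith : 0 ≤ 1 - x) a
  have e : betaWeight a x - betaWeight a y =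
      y ^ a * ((1 - x) ^ a - (1 - y) ^ a) - (y ^ a - x ^ a) * (1 - x) ^ a := by
    unfold betaWeight; ring
  rw [e, abs_le]
  constructor <;> nlinarith [mul_nonneg p4 (sub_nonneg.2 q1), mul_nonneg (sub_nonneg.2 p1) q4]

/-- For H ≤ 1/2 the kernel changes sign, but the weight has bounded variation. The true weight
contributes the Gamma term; the discretization error is at most the total oscillation 2 times the
row bound 2 of `sum_integral_abs_gridKernel_le`, hence the 4. -/
lemma sum_sum_betaWeight_le_of_le_half (hH : H ≤ 1 / 2) {n : ℕ} (hn : 0 < n) :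
    ∑ k ∈ Finset.range n, betaWeight (1 / 2 - H) ((k : ℝ) / n) *
      ∑ j ∈ Finset.range n, betaWeight (1 / 2 - H) ((j : ℝ) / n) * gridIncrCov H n j k ≤
    2 * H * Real.Gamma (3 / 2 - H) * Real.Gamma (H + 1 / 2) + 4 := by
  have hn' : (0 : ℝ) < n := by exact_mod_cast hn
  set a := 1 / 2 - H with ha
  have ha0 : 0 ≤ a := by linarith
  set c := 2 * H * Real.Gamma (3 / 2 - H) * Real.Gamma (H + 1 / 2)
  have hc : 0 ≤ c := by
    have := Real.Gamma_pos_of_pos (by linarith : 0 < 3 / 2 - H)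
    have := Real.Gamma_pos_of_pos (by linarith : 0 < H + 1 / 2)
    positivity
  set o : ℕ → ℝ := fun j => (((j + 1 : ℕ) : ℝ) / n) ^ a - ((j : ℝ) / n) ^ a +
    ((1 - (j : ℝ) / n) ^ a - (1 - ((j + 1 : ℕ) : ℝ) / n) ^ a) with ho
  have hj1 : ∀ j < n, ((j + 1 : ℕ) : ℝ) / n ≤ 1 := fun j hj => by
    rw [div_le_one hn']; exact_mod_cast hj
  have ho0 : ∀ j < n, 0 ≤ o j := fun j hj =>
    (abs_nonneg _).trans (abs_betaWeight_sub_le ha0 (by positivity) (natCast_div_mono n j.le_succ)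
      le_rfl (hj1 j hj))
  have hosum : ∑ j ∈ Finset.range n, o j ≤ 2 := by
    set F : ℕ → ℝ := fun j => ((j : ℝ) / n) ^ a - (1 - (j : ℝ) / n) ^ a with hF
    have e : ∀ j, o j = F (j + 1) - F j := fun j => by
      simp only [ho, hF]; ring
    rw [Finset.sum_congr rfl fun j _ => e j, Finset.sum_range_sub F]
    simp only [hF, Nat.cast_zero, zero_div, div_self hn'.ne', sub_zero, sub_self, Real.one_rpow]
    have := Real.rpow_nonneg (le_refl (0 : ℝ)) a
    linarith
  have key : ∀ k < n, betaWeight a ((k : ℝ) / n) *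
      ∑ j ∈ Finset.range n, betaWeight a ((j : ℝ) / n) * gridIncrCov H n j k ≤
      c * (1 / n) + ∑ j ∈ Finset.range n, o j *
        ∫ u in ((j : ℝ) / n)..((j + 1 : ℕ) / n), |gridKernel H n k u| := fun k hk => by
    obtain ⟨i1, e1⟩ := integral_betaWeight_mul_gridKernel h0 h1 hk
    obtain ⟨i2, e2⟩ := sum_betaWeight_gridIncrCov h0 hn k
    have hw := betaWeight_grid_nonneg a hk
    have hw1 : betaWeight a ((k : ℝ) / n) ≤ 1 := betaWeight_le_one ha0 (by positivity)
      ((natCast_div_mono n k.le_succ).trans (hj1 k hk))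
    obtain ⟨i3, e3⟩ := sum_mul_integral_grid hn o (intervalIntegrable_gridKernel h0 n k 0 1).abs
    rw [intervalIntegral.integral_of_le zero_le_one, integral_Ioc_eq_integral_Ioo] at e3
    rw [intervalIntegrable_iff_integrableOn_Ioo zero_le_one] at i3
    have hS : ∑ j ∈ Finset.range n, betaWeight a ((j : ℝ) / n) * gridIncrCov H n j k ≤
      c * (1 / n) + ∑ j ∈ Finset.range n, o j *
        ∫ u in ((j : ℝ) / n)..((j + 1 : ℕ) / n), |gridKernel H n k u| := by
      rw [e2, e3, ← e1, ← integral_add i1 i3]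
      refine setIntegral_mono_ae_restrict i2 (i1.add i3) ?_
      filter_upwards [ae_restrict_mem measurableSet_Ioo] with u hu
      obtain ⟨f0, f1⟩ := floor_div_mem hn hu
      have f2 : u ≤ ((⌊(n : ℝ) * u⌋₊ + 1 : ℕ) : ℝ) / n := by
        rw [le_div_iff₀' hn']
        push_cast
        exact (Nat.lt_floor_add_one _).le
      have f3 : ⌊(n : ℝ) * u⌋₊ < n := by
        rw [Nat.floor_lt (mul_nonneg hn'.le hu.1.le)]
        nlinarith [hu.2]
      have hd := abs_betaWeight_sub_le ha0 f0 f1 f2 (hj1 _ f3)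
      have := (le_abs_self _).trans ((abs_mul (betaWeight a ((⌊(n : ℝ) * u⌋₊ : ℝ) / n) -
        betaWeight a u) (gridKernel H n k u)).trans_le
          (mul_le_mul_of_nonneg_right hd (abs_nonneg _)))
      linarith
    have hr : 0 ≤ c * (1 / n) + ∑ j ∈ Finset.range n, o j *
        ∫ u in ((j : ℝ) / n)..((j + 1 : ℕ) / n), |gridKernel H n k u| := by
      refine add_nonneg (by positivity) (Finset.sum_nonneg fun j hj => ?_)
      exact mul_nonneg (ho0 j (Finset.mem_range.1 hj)) (intervalIntegral.integral_nonneg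
        (natCast_div_mono n j.le_succ) fun u _ => abs_nonneg _)
    calc _ ≤ betaWeight a ((k : ℝ) / n) * _ := mul_le_mul_of_nonneg_left hS hw
      _ ≤ _ := mul_le_of_le_one_left hr hw1
  calc _ ≤ _ := Finset.sum_le_sum fun k hk => key k (Finset.mem_range.1 hk)
    _ = c + ∑ j ∈ Finset.range n, o j * ∑ k ∈ Finset.range n,
        ∫ u in ((j : ℝ) / n)..((j + 1 : ℕ) / n), |gridKernel H n k u| := by
      rw [Finset.sum_add_distrib, Finset.sum_comm]
      simp only [Finset.sum_const, Finset.card_range, nsmul_eq_mul, Finset.mul_sum]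
      rw [mul_one_div, mul_div_cancel₀ _ hn'.ne']
    _ ≤ c + ∑ j ∈ Finset.range n, o j * 2 := by
      gcongr with j hj
      · exact ho0 j (Finset.mem_range.1 hj)
      · exact sum_integral_abs_gridKernel_le h0 hH (Finset.mem_range.1 hj)
    _ ≤ _ := by
      rw [← Finset.sum_mul]
      linarith

/-- The variances of the Riemann-type sums for the Wiener integral of the weight are bounded. -/
theorem exists_sum_sum_betaWeight_le :
    ∃ C, ∀ n : ℕ, ∑ k ∈ Finset.range n, betaWeight (1 / 2 - H) ((k : ℝ) / n) *
      ∑ j ∈ Finset.range n, betaWeight (1 / 2 - H) ((j : ℝ) / n) * gridIncrCov H n j k ≤ C := by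
  have hG := Real.Gamma_pos_of_pos (by linarith : 0 < 3 / 2 - H)
  have hG' := Real.Gamma_pos_of_pos (by linarith : 0 < H + 1 / 2)
  rcases le_total H (1 / 2) with h | h
  · refine ⟨2 * H * Real.Gamma (3 / 2 - H) * Real.Gamma (H + 1 / 2) + 4, fun n => ?_⟩
    rcases n.eq_zero_or_pos with rfl | hn
    · simp only [Finset.range_zero, Finset.sum_empty]; positivity
    · exact sum_sum_betaWeight_le_of_le_half h0 h1 h hn
  · obtain ⟨B, hB⟩ := (tendsto_sum_betaWeight_one h0 h1).bddAbove_range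
    refine ⟨2 * (2 * H * Real.Gamma (3 / 2 - H) * Real.Gamma (H + 1 / 2)) * B, fun n => ?_⟩
    have hBn := hB (Set.mem_range_self n)
    rcases n.eq_zero_or_pos with rfl | hn
    · simp only [Finset.range_zero, Finset.sum_empty] at hBn ⊢; positivity
    · refine (sum_sum_betaWeight_le_of_half_le h0 h1 h hn).trans ?_
      gcongr
end

/-! ### Weak convergence and orthogonal projections -/

section Hilbert
variable {E : Type*} [NormedAddCommGroup E] [InnerProductSpace ℝ E]

/-- For a bounded sequence, convergence of inner products extends from a set to its span by
linearity and to the closure by approximation. With a constant sequence it says that vectors with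
equal inner products on S agree on the closed span. -/
lemma tendsto_inner_of_mem_closure_span {m : ℕ → E} {C : ℝ} (hC : ∀ n, ‖m n‖ ≤ C) {y : E} {S : Set E}
    (hS : ∀ s ∈ S, Tendsto (fun n => inner ℝ (m n) s) atTop (𝓝 (inner ℝ y s))) {x : E}
    (hx : x ∈ (Submodule.span ℝ S).topologicalClosure) :
    Tendsto (fun n => inner ℝ (m n) x) atTop (𝓝 (inner ℝ y x)) := by
  have hspan : ∀ z ∈ Submodule.span ℝ S,
      Tendsto (fun n => inner ℝ (m n) z) atTop (𝓝 (inner ℝ y z)) := by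
    intro z hz
    induction hz using Submodule.span_induction with
    | mem z hz => exact hS z hz
    | zero => simp
    | add z w _ _ hz hw => simpa only [inner_add_right] using hz.add hw
    | smul a z _ hz => simpa only [inner_smul_right] using hz.const_mul _
  have hC0 : 0 ≤ C := (norm_nonneg _).trans (hC 0)
  have hD : 0 < C + ‖y‖ + 1 := by positivity
  rw [Metric.tendsto_atTop]
  intro ε hε
  obtain ⟨z, hz, hxz⟩ := Metric.mem_closure_iff.1 hx (ε / (2 * (C + ‖y‖ + 1))) (by positivity)
  obtain ⟨N, hN⟩ := Metric.tendsto_atTop.1 (hspan z hz) (ε / 2) (by positivity)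
  refine ⟨N, fun n hn => ?_⟩
  have h1 := hN n hn
  rw [Real.dist_eq, ← inner_sub_left] at h1 ⊢
  rw [dist_eq_norm, lt_div_iff₀ (by positivity)] at hxz
  have e : inner ℝ (m n - y) x = inner ℝ (m n - y) z + inner ℝ (m n - y) (x - z) := by
    rw [← inner_add_right]; simp
  have h2 : |inner ℝ (m n - y) (x - z)| ≤ (C + ‖y‖) * ‖x - z‖ :=
    (abs_real_inner_le_norm _ _).trans (by gcongr; exact (norm_sub_le _ _).trans (by gcongr; exact hC n))
  rw [e]
  have h3 := abs_add_le (inner ℝ (m n - y) z) (inner ℝ (m n - y) (x - z))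
  have h4 := norm_nonneg (x - z)
  nlinarith

/-- The norm of an orthogonal projection as the limit of inner products with a bounded sequence
that converges weakly to the projection. -/
lemma norm_sq_starProjection_of_tendsto {m : ℕ → E} {C L : ℝ} (hC : ∀ n, ‖m n‖ ≤ C) {y : E}
    {S : Set E} [(Submodule.span ℝ S).topologicalClosure.HasOrthogonalProjection]
    (hS : ∀ s ∈ S, Tendsto (fun n => inner ℝ (m n) s) atTop (𝓝 (inner ℝ y s)))
    (hm : ∀ n, m n ∈ Submodule.span ℝ S) (hL : Tendsto (fun n => inner ℝ (m n) y) atTop (𝓝 L)) :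
    ‖(Submodule.span ℝ S).topologicalClosure.starProjection y‖ ^ 2 = L := by
  set K := (Submodule.span ℝ S).topologicalClosure
  have hp : K.starProjection y ∈ K := Submodule.starProjection_apply_mem _ _
  have h1 := tendsto_inner_of_mem_closure_span hC hS hp
  have h2 : ∀ n, inner ℝ (m n) y = inner ℝ (m n) (K.starProjection y) := fun n => by
    have := Submodule.sub_starProjection_mem_orthogonal (K := K) y (m n)
      (Submodule.le_topologicalClosure _ (hm n))
    rw [inner_sub_right] at this
    linarith
  have h3 : inner ℝ y (K.starProjection y) = ‖K.starProjection y‖ ^ 2 := by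
    have := Submodule.sub_starProjection_mem_orthogonal (K := K) y _ hp
    rw [inner_sub_right, real_inner_self_eq_norm_sq, real_inner_comm] at this
    linarith
  simp only [h2] at hL
  rw [← h3]
  exact tendsto_nhds_unique h1 hL

end Hilbert

/-! ### Closed Gaussian subspaces of L² -/

section GaussianClosure
variable {Ω : Type*} [MeasurableSpace Ω] {P : Measure Ω} [IsProbabilityMeasure P]

/-- A centered Gaussian element of `L²`, in terms of its characteristic function. -/
def IsGaussianLp (f : Lp ℝ 2 P) : Prop :=
  ∀ t : ℝ, charFun (P.map f) t = Complex.exp ((-(‖f‖ ^ 2 * t ^ 2 / 2) : ℝ) : ℂ)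

omit [IsProbabilityMeasure P] in
lemma aemeasurable_coeFn_Lp (f : Lp ℝ 2 P) : AEMeasurable f P := (Lp.aestronglyMeasurable f).aemeasurable

/-- An L² limit is an almost sure limit along a subsequence, so characteristic functions converge by
dominated convergence; the norms, and hence the variances, converge too. -/
lemma isGaussianLp_of_tendsto {f : ℕ → Lp ℝ 2 P} {g : Lp ℝ 2 P} (hf : ∀ n, IsGaussianLp (f n))
    (h : Tendsto f atTop (𝓝 g)) : IsGaussianLp g := by
  intro t
  obtain ⟨ns, hns, hae⟩ := (tendstoInMeasure_of_tendsto_Lp h).exists_seq_tendsto_ae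
  have e : ∀ k : Lp ℝ 2 P, charFun (P.map k) t = ∫ ω, Complex.exp (t * k ω * Complex.I) ∂P :=
    fun k => by
      rw [charFun_apply_real, integral_map (aemeasurable_coeFn_Lp k)
        (Continuous.aestronglyMeasurable (by fun_prop))]
  have h1 : Tendsto (fun n => charFun (P.map (f (ns n))) t) atTop (𝓝 (charFun (P.map g) t)) := by
    simp only [e]
    refine tendsto_integral_of_dominated_convergence (fun _ => 1) (fun n => ?_) (by simp)
      (fun n => Eventually.of_forall fun ω => ?_) ?_
    · exact (Continuous.comp_aestronglyMeasurable (g := fun x : ℝ => Complex.exp (t * x * Complex.I))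
        (by fun_prop) (Lp.aestronglyMeasurable _))
    · rw [← Complex.ofReal_mul, Complex.norm_exp_ofReal_mul_I]
    · filter_upwards [hae] with ω hω
      exact (Continuous.tendsto (f := fun x : ℝ => Complex.exp (t * x * Complex.I))
        (by fun_prop) _).comp hω
  have h2 : Tendsto (fun n => charFun (P.map (f (ns n))) t) atTop
      (𝓝 (Complex.exp ((-(‖g‖ ^ 2 * t ^ 2 / 2) : ℝ) : ℂ))) := by
    have h3 := ((h.comp hns.tendsto_atTop).norm.pow 2)
    simp only [fun n => hf (ns n) t]
    refine (Continuous.tendsto (f := fun x : ℝ => Complex.exp ((-(x * t ^ 2 / 2) : ℝ) : ℂ))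
        (by fun_prop) _).comp h3
  exact tendsto_nhds_unique h1 h2

lemma IsGaussianLp.map_eq {f : Lp ℝ 2 P} (hf : IsGaussianLp f) :
    P.map f = gaussianReal 0 (‖f‖ ^ 2).toNNReal := by
  have := Measure.isProbabilityMeasure_map (aemeasurable_coeFn_Lp f)
  refine Measure.ext_of_charFun (funext fun t => ?_)
  rw [hf t, charFun_gaussianReal]
  congr 1
  rw [Real.coe_toNNReal _ (sq_nonneg _)]
  simp

lemma IsGaussianLp.integral_eq_zero {f : Lp ℝ 2 P} (hf : IsGaussianLp f) : ∫ ω, f ω ∂P = 0 := by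
  have := integral_map (aemeasurable_coeFn_Lp f) (f := fun x : ℝ => x) (by fun_prop)
  rw [← this, hf.map_eq, integral_id_gaussianReal]

omit [IsProbabilityMeasure P] in
lemma norm_sq_Lp_two (f : Lp ℝ 2 P) : ‖f‖ ^ 2 = ∫ ω, f ω ^ 2 ∂P := by
  rw [← real_inner_self_eq_norm_sq, L2.inner_def]
  simp [sq]

omit [IsProbabilityMeasure P] in
lemma HasGaussianLaw.isGaussianLp {f : Lp ℝ 2 P} (hf : HasGaussianLaw f P)
    (h0 : ∫ ω, f ω ∂P = 0) : IsGaussianLp f := by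
  intro t
  rw [hf.map_eq_gaussianReal, h0, charFun_gaussianReal,
    variance_of_integral_eq_zero (aemeasurable_coeFn_Lp f) h0, ← norm_sq_Lp_two]
  congr 1
  rw [Real.coe_toNNReal _ (sq_nonneg _)]
  simp

variable {T : Type*} {X : T → Ω → ℝ}

lemma IsGaussianProcess.isGaussianLp_of_mem_span (hX : IsGaussianProcess X P)
    (h0 : ∀ t, ∫ ω, X t ω ∂P = 0) (hX2 : ∀ t, MemLp (X t) 2 P) {f : Lp ℝ 2 P}
    (hf : f ∈ Submodule.span ℝ (Set.range fun t => (hX2 t).toLp)) : IsGaussianLp f := by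
  obtain ⟨c, rfl⟩ := Finsupp.mem_span_range_iff_exists_finsupp.1 hf
  have hae : (c.sum fun t a => a • (hX2 t).toLp : Lp ℝ 2 P) =ᵐ[P]
      fun ω => ∑ t ∈ c.support, c t • X t ω := by
    rw [Finsupp.sum]
    have h1 : ∀ᵐ ω ∂P, ∀ t ∈ c.support, (c t • (hX2 t).toLp : Lp ℝ 2 P) ω = c t • X t ω := by
      rw [Finset.eventually_all]
      intro t _
      filter_upwards [Lp.coeFn_smul (c t) (hX2 t).toLp, (hX2 t).coeFn_toLp] with ω h1 h2
      rw [h1, Pi.smul_apply, h2]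
    filter_upwards [Lp.coeFn_finsetSum c.support fun t => (c t • (hX2 t).toLp : Lp ℝ 2 P), h1]
      with ω h1 h2
    rw [h1, Finset.sum_apply]
    exact Finset.sum_congr rfl h2
  refine HasGaussianLaw.isGaussianLp ?_ ?_
  · exact (hX.smul c).hasGaussianLaw_fun_sum.congr hae.symm
  · rw [integral_congr_ae hae, integral_finsetSum]
    · refine Finset.sum_eq_zero fun t _ => ?_
      rw [integral_smul, h0, smul_zero]
    · exact fun t _ => Integrable.smul (c t) ((hX2 t).integrable one_le_two)

/-- The closed span in `L²` of a centered Gaussian process consists of centered Gaussian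
variables. -/
lemma IsGaussianProcess.isGaussianLp_of_mem_closure (hX : IsGaussianProcess X P)
    (h0 : ∀ t, ∫ ω, X t ω ∂P = 0) (hX2 : ∀ t, MemLp (X t) 2 P) {f : Lp ℝ 2 P}
    (hf : f ∈ (Submodule.span ℝ (Set.range fun t => (hX2 t).toLp)).topologicalClosure) :
    IsGaussianLp f := by
  obtain ⟨x, hx, hxf⟩ := mem_closure_iff_seq_limit.1 hf
  exact isGaussianLp_of_tendsto
    (fun n => IsGaussianProcess.isGaussianLp_of_mem_span hX h0 hX2 (hx n)) hxf

/-- A linear subspace of Gaussian variables is a Gaussian process. -/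
lemma isGaussianProcess_of_submodule (K : Submodule ℝ (Lp ℝ 2 P)) (hK : ∀ f ∈ K, IsGaussianLp f) :
    IsGaussianProcess (fun (f : K) => ((f : Lp ℝ 2 P) : Ω → ℝ)) P where
  hasGaussianLaw I := by
    classical
    have hm : AEMeasurable (fun ω => I.restrict (fun f : K => (f : Lp ℝ 2 P) ω)) P :=
      aemeasurable_pi_lambda _ fun i => aemeasurable_coeFn_Lp _
    constructor
    refine isGaussian_of_map_eq_gaussianReal fun L => ?_
    rw [AEMeasurable.map_map_of_aemeasurable (by fun_prop) hm]
    set g : K := ∑ i : I, L (Pi.single i 1) • (i : K) with hg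
    have hae : (L ∘ fun ω => I.restrict (fun f : K => (f : Lp ℝ 2 P) ω)) =ᵐ[P] (g : Lp ℝ 2 P) := by
      have e : (g : Lp ℝ 2 P) = ∑ i : I, L (Pi.single i 1) • ((i : K) : Lp ℝ 2 P) := by
        simp [hg]
      have h1 : ∀ᵐ ω ∂P, ∀ i ∈ (Finset.univ : Finset I),
          (L (Pi.single i 1) • ((i : K) : Lp ℝ 2 P) : Lp ℝ 2 P) ω =
            L (Pi.single i 1) • ((i : K) : Lp ℝ 2 P) ω := by
        rw [Finset.eventually_all]
        intro i _
        filter_upwards [Lp.coeFn_smul (L (Pi.single i 1)) ((i : K) : Lp ℝ 2 P)] with ω h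
        exact h
      rw [e]
      filter_upwards [Lp.coeFn_finsetSum Finset.univ
        fun i : I => (L (Pi.single i 1) • ((i : K) : Lp ℝ 2 P) : Lp ℝ 2 P), h1] with ω h1 h2
      rw [h1, Finset.sum_apply, Finset.sum_congr rfl h2, Function.comp_apply]
      refine (LinearMap.pi_apply_eq_sum_univ L.toLinearMap _).trans ?_
      refine Finset.sum_congr rfl fun i _ => ?_
      have hs : (fun j => if i = j then (1 : ℝ) else 0) = Pi.single i 1 := by
        ext j; simp [Pi.single_apply, eq_comm]
      rw [hs, smul_eq_mul, smul_eq_mul, mul_comm]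
      rfl
    rw [Measure.map_congr hae]
    exact ⟨_, _, (hK g g.2).map_eq⟩

end GaussianClosure

/-! ### Normalization and scaling of the covariance -/

/-- Each Z_H is a standard fractional Brownian motion. For H ≠ 1/2 this is the reflection formula
for Γ(-2H) Γ(2H+1) with sin 2πH = 2 sin πH cos πH; H = 1/2 falls under the other branch of the
definition. -/
lemma fieldConst_self {H : ℝ} (h : H ∈ Set.Ioo (0 : ℝ) 1) : fieldConst H H = 1 := by
  obtain ⟨h0, h1⟩ := h
  have hG := Real.Gamma_pos_of_pos (by linarith : 0 < 2 * H + 1)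
  have hs : 0 < Real.sin (Real.pi * H) :=
    Real.sin_pos_of_pos_of_lt_pi (by positivity) (by nlinarith [Real.pi_pos])
  unfold fieldConst
  split_ifs with hH
  · have : H = 1 / 2 := by linarith
    subst this
    norm_num [show Real.pi * (1 / 2) = Real.pi / 2 by ring]
  · have h2 := Real.Gamma_mul_Gamma_one_sub (-(2 * H))
    have h3 : Real.sin (Real.pi * -(2 * H)) = -(2 * Real.sin (Real.pi * H) * Real.cos (Real.pi * H)) := by
      rw [← Real.sin_two_mul, ← Real.sin_neg]; ring_nf
    have h4 : Real.cos (Real.pi * H) ≠ 0 := by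
      intro h4
      rcases lt_or_gt_of_ne (fun h => hH (by linarith) : H ≠ 1 / 2) with h | h
      · exact (Real.cos_pos_of_mem_Ioo ⟨by nlinarith [Real.pi_pos], by nlinarith [Real.pi_pos]⟩).ne' h4
      · exact (Real.cos_neg_of_pi_div_two_lt_of_lt (by nlinarith [Real.pi_pos])
          (by nlinarith [Real.pi_pos])).ne h4
    rw [h3, show 1 - -(2 * H) = 2 * H + 1 by ring] at h2
    have h5 : Real.Gamma (-(2 * H)) = -Real.pi / (2 * Real.sin (Real.pi * H) *
        Real.cos (Real.pi * H) * Real.Gamma (2 * H + 1)) := by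
      generalize Real.sin (Real.pi * H) = S at *
      generalize Real.cos (Real.pi * H) = C at *
      rw [eq_div_iff (by positivity)]
      field_simp at h2 ⊢
      linear_combination h2
    rw [mul_assoc (-(2 / Real.pi)), Real.mul_self_sqrt (by positivity), sub_self, zero_mul,
      Real.cos_zero, show H + H = 2 * H by ring, show 2 * H * (Real.pi / 2) = Real.pi * H by ring, h5]
    have := Real.pi_pos
    field_simp

lemma fbmCov_mul {H t u r : ℝ} (ht : 0 ≤ t) (hu : 0 ≤ u) (hr : 0 ≤ r) :
    fbmCov H (t * u) (t * r) = t ^ (2 * H) * fbmCov H u r := by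
  unfold fbmCov
  rw [← mul_sub, abs_mul, abs_of_nonneg ht, Real.mul_rpow ht hu, Real.mul_rpow ht hr,
    Real.mul_rpow ht (abs_nonneg _)]
  ring

/-! ### The projection of Z_{1-H}(t) and its variance -/

section Projection

variable {Ω : Type*} [MeasurableSpace Ω] {P : Measure Ω}
  {Z : ℝ → ℝ≥0 → Ω → ℝ} (hZ : IsFractionalGaussianField Z P)
include hZ

lemma IsFractionalGaussianField.memLp_two (p : Set.Ioo (0 : ℝ) 1 × ℝ≥0) :
    MemLp (Z (p.1 : ℝ) p.2) 2 P :=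
  (hZ.gaussian.hasGaussianLaw_eval p).memLp_two

/-- The field as a family in `L²`. -/
noncomputable def fieldLp (p : Set.Ioo (0 : ℝ) 1 × ℝ≥0) : Lp ℝ 2 P := (hZ.memLp_two p).toLp

lemma inner_fieldLp (p q : Set.Ioo (0 : ℝ) 1 × ℝ≥0) :
    inner ℝ (fieldLp hZ p) (fieldLp hZ q) = fieldConst p.1 q.1 / 2 *
      ((p.2 : ℝ) ^ (p.1 + q.1 : ℝ) + (q.2 : ℝ) ^ (p.1 + q.1 : ℝ) -
        |(p.2 : ℝ) - (q.2 : ℝ)| ^ (p.1 + q.1 : ℝ)) := by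
  rw [← hZ.covariance _ p.1.2 _ q.1.2, L2.inner_def]
  refine integral_congr_ae ?_
  filter_upwards [(hZ.memLp_two p).coeFn_toLp, (hZ.memLp_two q).coeFn_toLp] with ω h1 h2
  rw [fieldLp, fieldLp, h1, h2]
  simp [mul_comm]

lemma inner_fieldLp_self (H : Set.Ioo (0 : ℝ) 1) (s t : ℝ≥0) :
    inner ℝ (fieldLp hZ (H, s)) (fieldLp hZ (H, t)) = fbmCov H s t := by
  rw [inner_fieldLp, fieldConst_self H.2, fbmCov, ← two_mul]
  ring

/-- The closed linear span in `L²` of `Z_H(r)`, `r ≤ t`. -/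
noncomputable def pastSpan (H : Set.Ioo (0 : ℝ) 1) (t : ℝ≥0) : Submodule ℝ (Lp ℝ 2 P) :=
  (Submodule.span ℝ ((fun r => fieldLp hZ (H, r)) '' Set.Iic t)).topologicalClosure

instance (H : Set.Ioo (0 : ℝ) 1) (t : ℝ≥0) : CompleteSpace (pastSpan hZ H t) := by
  unfold pastSpan; infer_instance

/-- The parameter `1 - H`. -/
def dualIndex (H : Set.Ioo (0 : ℝ) 1) : Set.Ioo (0 : ℝ) 1 :=
  ⟨1 - H, by linarith [H.2.2], by linarith [H.2.1]⟩

/-- The orthogonal projection of `Z_{1-H}(t)` to the closed span of `Z_H(r)`, `r ≤ t`. -/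
noncomputable def projM (H : Set.Ioo (0 : ℝ) 1) (t : ℝ≥0) : Lp ℝ 2 P :=
  (pastSpan hZ H t).starProjection (fieldLp hZ (dualIndex H, t))

/-- The exponents add up to 1, so the covariance is a_H (r + t - (t - r))/2. Its independence of t
makes M_H a martingale, and its linearity in r makes the beta weight the solution. -/
lemma inner_fieldLp_dualIndex (H : Set.Ioo (0 : ℝ) 1) {r t : ℝ≥0} (hrt : r ≤ t) :
    inner ℝ (fieldLp hZ (H, r)) (fieldLp hZ (dualIndex H, t)) = fieldConst H (1 - H) * r := by
  rw [inner_fieldLp]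
  have h : ((r : ℝ) : ℝ) ≤ t := by exact_mod_cast hrt
  simp only [dualIndex, add_sub_cancel, Real.rpow_one]
  rw [abs_sub_comm, abs_of_nonneg (by linarith)]
  ring

lemma inner_projM_of_mem (H : Set.Ioo (0 : ℝ) 1) (t : ℝ≥0) {x : Lp ℝ 2 P} (hx : x ∈ pastSpan hZ H t) :
    inner ℝ x (projM hZ H t) = inner ℝ x (fieldLp hZ (dualIndex H, t)) := by
  have := Submodule.sub_starProjection_mem_orthogonal (K := pastSpan hZ H t)
    (fieldLp hZ (dualIndex H, t)) x hx
  rw [inner_sub_right] at this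
  rw [projM]; linarith

lemma projM_mem (H : Set.Ioo (0 : ℝ) 1) (t : ℝ≥0) : projM hZ H t ∈ pastSpan hZ H t :=
  Submodule.starProjection_apply_mem _ _

lemma pastSpan_mono (H : Set.Ioo (0 : ℝ) 1) {s t : ℝ≥0} (hst : s ≤ t) :
    pastSpan hZ H s ≤ pastSpan hZ H t :=
  Submodule.topologicalClosure_mono (Submodule.span_mono (Set.image_mono (Set.Iic_subset_Iic.2 hst)))

/-- The projections form a family with orthogonal increments. -/
lemma inner_projM_of_le (H : Set.Ioo (0 : ℝ) 1) {s t : ℝ≥0} (hst : s ≤ t) :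
    inner ℝ (projM hZ H s) (projM hZ H t) = ‖projM hZ H s‖ ^ 2 := by
  rw [← real_inner_self_eq_norm_sq, inner_projM_of_mem hZ H s (projM_mem hZ H s),
    inner_projM_of_mem hZ H t (pastSpan_mono hZ H hst (projM_mem hZ H s))]
  -- Z_{1-H}(s) and Z_{1-H}(t) have the same inner products with every Z_H(r), r ≤ s, hence with the
  -- whole closed span; a constant sequence is used.
  have := tendsto_inner_of_mem_closure_span (m := fun _ => fieldLp hZ (dualIndex H, t)) (C := _)
    (fun _ => le_rfl) (y := fieldLp hZ (dualIndex H, s))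
    (S := (fun r => fieldLp hZ (H, r)) '' Set.Iic s) ?_ (projM_mem hZ H s)
  · rw [real_inner_comm, real_inner_comm (fieldLp hZ (dualIndex H, s))]
    exact tendsto_nhds_unique tendsto_const_nhds this
  · rintro _ ⟨r, hr, rfl⟩
    rw [real_inner_comm, real_inner_comm (fieldLp hZ (H, r)), inner_fieldLp_dualIndex hZ H hr,
      inner_fieldLp_dualIndex hZ H (hr.trans hst)]
    exact tendsto_const_nhds

/-- Riemann-type sums for the Wiener integral of the weight on `[0, t]`. -/
noncomputable def riemannLp (H : Set.Ioo (0 : ℝ) 1) (t : ℝ≥0) (n : ℕ) : Lp ℝ 2 P :=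
  ∑ j ∈ Finset.range n, betaWeight (1 / 2 - H) ((j : ℝ) / n) •
    (fieldLp hZ (H, t * ((j + 1 : ℕ) / n)) - fieldLp hZ (H, t * (j / n)))

lemma riemannLp_mem (H : Set.Ioo (0 : ℝ) 1) (t : ℝ≥0) (n : ℕ) :
    riemannLp hZ H t n ∈ Submodule.span ℝ ((fun r => fieldLp hZ (H, r)) '' Set.Iic t) := by
  refine Submodule.sum_mem _ fun j hj => Submodule.smul_mem _ _ (Submodule.sub_mem _ ?_ ?_)
  all_goals
    refine Submodule.subset_span ⟨_, ?_, rfl⟩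
    rw [Set.mem_Iic]
    refine mul_le_of_le_one_right zero_le (div_le_one_of_le₀ ?_ zero_le)
    have := Finset.mem_range.1 hj
    exact_mod_cast (by omega)

lemma inner_riemannLp (H : Set.Ioo (0 : ℝ) 1) (t r : ℝ≥0) (n : ℕ) :
    inner ℝ (riemannLp hZ H t n) (fieldLp hZ (H, t * r)) = (t : ℝ) ^ (2 * H : ℝ) *
      ∑ j ∈ Finset.range n, betaWeight (1 / 2 - H) ((j : ℝ) / n) *
        (fbmCov H ((j + 1 : ℕ) / n) r - fbmCov H (j / n) r) := by
  rw [riemannLp, sum_inner, Finset.mul_sum]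
  refine Finset.sum_congr rfl fun j _ => ?_
  rw [real_inner_smul_left, inner_sub_left, inner_fieldLp_self, inner_fieldLp_self]
  push_cast
  rw [fbmCov_mul (by positivity) (by positivity) (by positivity),
    fbmCov_mul (by positivity) (by positivity) (by positivity)]
  ring

lemma inner_riemannLp_dual (H : Set.Ioo (0 : ℝ) 1) (t : ℝ≥0) (n : ℕ) :
    inner ℝ (riemannLp hZ H t n) (fieldLp hZ (dualIndex H, t)) = fieldConst H (1 - H) * t *
      ∑ j ∈ Finset.range n, betaWeight (1 / 2 - H) ((j : ℝ) / n) * (1 / n) := by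
  rw [riemannLp, sum_inner, Finset.mul_sum]
  refine Finset.sum_congr rfl fun j hj => ?_
  have hj := Finset.mem_range.1 hj
  rw [real_inner_smul_left, inner_sub_left, inner_fieldLp_dualIndex, inner_fieldLp_dualIndex]
  · push_cast; ring
  all_goals
    refine mul_le_of_le_one_right zero_le (div_le_one_of_le₀ ?_ zero_le)
    exact_mod_cast (by omega)

lemma norm_sq_riemannLp (H : Set.Ioo (0 : ℝ) 1) (t : ℝ≥0) (n : ℕ) :
    ‖riemannLp hZ H t n‖ ^ 2 = (t : ℝ) ^ (2 * H : ℝ) *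
      ∑ k ∈ Finset.range n, betaWeight (1 / 2 - H) ((k : ℝ) / n) *
        ∑ j ∈ Finset.range n, betaWeight (1 / 2 - H) ((j : ℝ) / n) * gridIncrCov H n j k := by
  rw [← real_inner_self_eq_norm_sq]
  have key : ∀ x : Lp ℝ 2 P, inner ℝ x (riemannLp hZ H t n) = ∑ k ∈ Finset.range n,
      inner ℝ x (betaWeight (1 / 2 - H) ((k : ℝ) / n) •
        (fieldLp hZ (H, t * ((k + 1 : ℕ) / n)) - fieldLp hZ (H, t * (k / n)))) := fun x => by
    rw [riemannLp, inner_sum]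
  rw [key, Finset.mul_sum]
  refine Finset.sum_congr rfl fun k _ => ?_
  have e : ∀ j : ℕ, betaWeight (1 / 2 - H) ((j : ℝ) / n) * gridIncrCov H n j k =
      betaWeight (1 / 2 - H) ((j : ℝ) / n) * (fbmCov H ((j + 1 : ℕ) / n) ((k + 1 : ℕ) / n : ℝ≥0) -
        fbmCov H (j / n) ((k + 1 : ℕ) / n : ℝ≥0)) -
      betaWeight (1 / 2 - H) ((j : ℝ) / n) * (fbmCov H ((j + 1 : ℕ) / n) (k / n : ℝ≥0) -
        fbmCov H (j / n) (k / n : ℝ≥0)) := fun j => by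
    rw [gridIncrCov]
    push_cast
    ring
  rw [real_inner_smul_right, inner_sub_right, inner_riemannLp, inner_riemannLp,
    Finset.sum_congr rfl fun j _ => e j, Finset.sum_sub_distrib]
  ring

/-- The variance of the projection of `Z_{1-H}(t)`. -/
theorem norm_sq_projM (H : Set.Ioo (0 : ℝ) 1) (t : ℝ≥0) :
    ‖projM hZ H t‖ ^ 2 = constM H * (t : ℝ) ^ (2 - 2 * H : ℝ) := by
  obtain ⟨h0, h1⟩ := H.2
  rcases eq_or_ne t 0 with rfl | ht
  · have : fieldLp hZ (dualIndex H, 0) = 0 := by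
      rw [← norm_eq_zero, ← sq_eq_zero_iff, ← real_inner_self_eq_norm_sq, inner_fieldLp_self]
      have : (0 : ℝ) ^ (2 * (dualIndex H : ℝ)) = 0 :=
        Real.zero_rpow (by have := (dualIndex H).2.1; positivity)
      simp [fbmCov, this]
    rw [projM, this, map_zero, NNReal.coe_zero, Real.zero_rpow (by linarith)]
    simp
  have ht0 : (0 : ℝ) < t := by exact_mod_cast pos_iff_ne_zero.2 ht
  have hG1 := Real.Gamma_pos_of_pos (by linarith : 0 < 3 / 2 - (H : ℝ))
  have hG2 := Real.Gamma_pos_of_pos (by linarith : 0 < (H : ℝ) + 1 / 2)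
  have hG3 := Real.Gamma_pos_of_pos (by linarith : 0 < 3 - 2 * (H : ℝ))
  set c := 2 * H * Real.Gamma (3 / 2 - H) * Real.Gamma (H + 1 / 2) with hc
  have hc0 : c ≠ 0 := by positivity
  set a := fieldConst H (1 - H) with ha
  -- Normalization for which the scaled sums have limiting inner product a r with Z_H(r): scaling
  -- contributes t^(2H) and the integral equation contributes c r/t.
  set b : ℝ := a / c * (t : ℝ) ^ (1 - 2 * H : ℝ) with hb
  have htt : (t : ℝ) ^ (1 - 2 * H : ℝ) * (t : ℝ) ^ (2 * H : ℝ) = t := by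
    rw [← Real.rpow_add ht0]; simp
  have htt' : (t : ℝ) ^ (1 - 2 * H : ℝ) * (t : ℝ) = (t : ℝ) ^ (2 - 2 * H : ℝ) := by
    rw [← Real.rpow_add_one ht0.ne']; ring_nf
  obtain ⟨C, hC⟩ := exists_sum_sum_betaWeight_le h0 h1
  refine norm_sq_starProjection_of_tendsto (m := fun n => b • riemannLp hZ H t n)
    (C := √(b ^ 2 * ((t : ℝ) ^ (2 * H : ℝ) * C))) (fun n => ?_) ?_
    (fun n => Submodule.smul_mem _ _ (riemannLp_mem hZ H t n)) ?_
  · refine Real.le_sqrt_of_sq_le ?_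
    rw [norm_smul, mul_pow, norm_sq_riemannLp, Real.norm_eq_abs, sq_abs]
    gcongr
    exact hC n
  · rintro _ ⟨r, hr, rfl⟩
    have hr1 : ((r / t : ℝ≥0) : ℝ) ≤ 1 := by
      exact_mod_cast div_le_one_of_le₀ hr zero_le
    have hrt : t * (r / t) = r := mul_div_cancel₀ r ht
    have e : ∀ n, inner ℝ (b • riemannLp hZ H t n) (fieldLp hZ (H, r)) = a / c * t *
        ∑ j ∈ Finset.range n, betaWeight (1 / 2 - H) ((j : ℝ) / n) *
        (fbmCov H ((j + 1 : ℕ) / n) (r / t : ℝ≥0) - fbmCov H (j / n) (r / t : ℝ≥0)) := fun n => by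
      conv_lhs => rw [← hrt]
      rw [real_inner_smul_left, inner_riemannLp, hb]
      generalize (∑ j ∈ Finset.range n, _ : ℝ) = S
      linear_combination (a / c * S) * htt
    simp only [e]
    rw [real_inner_comm, inner_fieldLp_dualIndex hZ H hr]
    convert! (tendsto_sum_betaWeight_fbmCov h0 h1 (NNReal.coe_nonneg _) hr1).const_mul (a / c * t)
      using 2
    rw [← hc]
    push_cast
    rw [← ha]
    field_simp
  · have e : ∀ n, inner ℝ (b • riemannLp hZ H t n) (fieldLp hZ (dualIndex H, t)) =
        a ^ 2 / c * (t : ℝ) ^ (2 - 2 * H : ℝ) *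
        ∑ j ∈ Finset.range n, betaWeight (1 / 2 - H) ((j : ℝ) / n) * (1 / n) := fun n => by
      rw [real_inner_smul_left, inner_riemannLp_dual, hb, ← htt']
      ring
    simp only [e]
    convert! (tendsto_sum_betaWeight_one h0 h1).const_mul (a ^ 2 / c * (t : ℝ) ^ (2 - 2 * H : ℝ))
      using 2
    rw [constM, ← ha, hc]
    field_simp

end Projection

/-! ### M_H as a Gaussian process with the covariance of a time-changed Brownian motion -/

section Martingale
variable {Ω : Type*} [MeasurableSpace Ω] {P : Measure Ω}
  {Z : ℝ → ℝ≥0 → Ω → ℝ} (hZ : IsFractionalGaussianField Z P)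
include hZ

/-- The closed linear span in `L²` of the whole field. -/
noncomputable def fieldSpan : Submodule ℝ (Lp ℝ 2 P) :=
  (Submodule.span ℝ (Set.range (fieldLp hZ))).topologicalClosure

lemma fieldLp_mem_fieldSpan (p : Set.Ioo (0 : ℝ) 1 × ℝ≥0) : fieldLp hZ p ∈ fieldSpan hZ :=
  Submodule.le_topologicalClosure _ (Submodule.subset_span ⟨p, rfl⟩)

lemma projM_mem_fieldSpan (H : Set.Ioo (0 : ℝ) 1) (t : ℝ≥0) : projM hZ H t ∈ fieldSpan hZ := by
  refine Submodule.topologicalClosure_mono (Submodule.span_mono ?_) (projM_mem hZ H t)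
  rintro _ ⟨r, _, rfl⟩
  exact ⟨_, rfl⟩

lemma pastSigma_le (H : Set.Ioo (0 : ℝ) 1) (t : ℝ≥0) : pastSigma Z H t ≤ ‹MeasurableSpace Ω› := by
  refine iSup₂_le fun r _ => ?_
  have := hZ.measurable H H.2 r
  rw [← BorelSpace.measurable_eq (α := ℝ)]
  exact this.comap_le

omit [MeasurableSpace Ω] hZ in
lemma measurable_pastSigma {H : Set.Ioo (0 : ℝ) 1} {r t : ℝ≥0} (hr : r ≤ t) :
    Measurable[pastSigma Z H t] (Z H r) := by
  rw [measurable_iff_comap_le]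
  conv_lhs => rw [BorelSpace.measurable_eq (α := ℝ)]
  exact le_iSup₂_of_le r hr le_rfl

lemma aestronglyMeasurable_projM (H : Set.Ioo (0 : ℝ) 1) (t : ℝ≥0) :
    AEStronglyMeasurable[pastSigma Z H t] (projM hZ H t) P := by
  have hle : (Submodule.span ℝ ((fun r => fieldLp hZ (H, r)) '' Set.Iic t)).topologicalClosure ≤
      lpMeas ℝ ℝ (pastSigma Z H t) 2 P := by
    refine Submodule.topologicalClosure_minimal _ (Submodule.span_le.2 ?_)
      (isClosed_aestronglyMeasurable (pastSigma_le hZ H t))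
    rintro _ ⟨r, hr, rfl⟩
    rw [SetLike.mem_coe, mem_lpMeas_iff_aestronglyMeasurable]
    exact ⟨Z H r, (measurable_pastSigma hr).stronglyMeasurable, (hZ.memLp_two (H, r)).coeFn_toLp⟩
  exact mem_lpMeas_iff_aestronglyMeasurable.1 (hle (projM_mem hZ H t))

variable [IsProbabilityMeasure P]

lemma isGaussianLp_of_mem_fieldSpan {f : Lp ℝ 2 P} (hf : f ∈ fieldSpan hZ) : IsGaussianLp f :=
  IsGaussianProcess.isGaussianLp_of_mem_closure hZ.gaussian
    (fun p => hZ.centered p.1 p.1.2 p.2) hZ.memLp_two hf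

lemma isGaussianProcess_fieldSpan :
    IsGaussianProcess (fun (f : fieldSpan hZ) => ((f : Lp ℝ 2 P) : Ω → ℝ)) P :=
  isGaussianProcess_of_submodule _ fun _ hf => isGaussianLp_of_mem_fieldSpan hZ hf

/-- The prediction error is independent of the past. -/
lemma indep_sub_projM (H : Set.Ioo (0 : ℝ) 1) (t : ℝ≥0) :
    Indep (MeasurableSpace.comap (fieldLp hZ (dualIndex H, t) - projM hZ H t : Lp ℝ 2 P)
      inferInstance) (pastSigma Z H t) P := by
  set e : Lp ℝ 2 P := fieldLp hZ (dualIndex H, t) - projM hZ H t with he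
  have hemem : e ∈ fieldSpan hZ :=
    Submodule.sub_mem _ (fieldLp_mem_fieldSpan hZ _) (projM_mem_fieldSpan hZ H t)
  let f : Set.Iic t ⊕ Unit → fieldSpan hZ :=
    Sum.elim (fun r => ⟨fieldLp hZ (H, r), fieldLp_mem_fieldSpan hZ _⟩) (fun _ => ⟨e, hemem⟩)
  -- The past and the error lie in one Gaussian space, the closed span of the field; joint
  -- Gaussianity turns orthogonality into independence.
  have hG : IsGaussianProcess (Sum.elim (fun r : Set.Iic t => Z H r) (fun _ : Unit => (e : Ω → ℝ))) P := by
    refine ((isGaussianProcess_fieldSpan hZ).comp_right f).congr fun s => ?_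
    rcases s with r | _
    · exact (hZ.memLp_two (H, r)).coeFn_toLp
    · exact EventuallyEq.rfl
  have hmZ : ∀ r : Set.Iic t, Measurable (Z H r) := fun r => hZ.measurable H H.2 r
  have hI := IsGaussianProcess.indepFun_of_covariance_eq_zero hG (fun r => (hmZ r).aemeasurable)
    (fun _ => aemeasurable_coeFn_Lp e) (fun r _ => by
      rw [covariance_eq_sub (hZ.memLp_two (H, r)) (Lp.memLp e), hZ.centered H H.2, zero_mul, sub_zero]
      have hmem : fieldLp hZ (H, r) ∈ pastSpan hZ H t :=
        Submodule.le_topologicalClosure _ (Submodule.subset_span ⟨r, r.2, rfl⟩)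
      have h0 : inner ℝ (fieldLp hZ (H, r)) e = 0 := by
        rw [he, inner_sub_right, inner_projM_of_mem hZ H t hmem, sub_self]
      refine Eq.trans ?_ h0
      rw [L2.inner_def]
      refine integral_congr_ae ?_
      filter_upwards [(hZ.memLp_two (H, r)).coeFn_toLp] with ω h1
      rw [fieldLp, h1]
      simp [mul_comm])
  have hI' := (hI.comp measurable_id (measurable_pi_apply ())).symm
  rw [IndepFun_iff_Indep] at hI'
  refine indep_of_indep_of_le_right hI' (iSup₂_le fun r hr => ?_)
  rw [← BorelSpace.measurable_eq (α := ℝ), ← measurable_iff_comap_le]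
  exact (measurable_pi_apply (⟨r, hr⟩ : Set.Iic t)).comp
    (comap_measurable (id ∘ fun ω (s : Set.Iic t) => Z H s ω))

/-- Z_{1-H}(t) is the projection plus an error. The projection is measurable for the past, up to
null sets, and the error is centered and independent of the past, so its conditional expectation
vanishes. -/
lemma martM_ae_eq (H : Set.Ioo (0 : ℝ) 1) (t : ℝ≥0) : martM P Z H t =ᵐ[P] projM hZ H t := by
  set e : Lp ℝ 2 P := fieldLp hZ (dualIndex H, t) - projM hZ H t with he
  have hle := pastSigma_le hZ H t
  have hemem : e ∈ fieldSpan hZ :=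
    Submodule.sub_mem _ (fieldLp_mem_fieldSpan hZ _) (projM_mem_fieldSpan hZ H t)
  have h1 : Z (1 - H) t =ᵐ[P] (e : Ω → ℝ) + (projM hZ H t : Ω → ℝ) := by
    have h2 := (hZ.memLp_two (dualIndex H, t)).coeFn_toLp
    have h3 := Lp.coeFn_sub (fieldLp hZ (dualIndex H, t)) (projM hZ H t)
    filter_upwards [h2, h3] with ω h2 h3
    rw [Pi.add_apply, he, h3, Pi.sub_apply, fieldLp, h2]
    simp [dualIndex]
  have hie := (Lp.memLp e).integrable one_le_two
  have hip := (Lp.memLp (projM hZ H t)).integrable one_le_two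
  have h4 : P[(e : Ω → ℝ) | pastSigma Z H t] =ᵐ[P] fun _ => ∫ ω, e ω ∂P :=
    condExp_indep_eq (Lp.stronglyMeasurable e).measurable.comap_le hle
      (comap_measurable _).stronglyMeasurable (indep_sub_projM hZ H t)
  have h5 := condExp_of_aestronglyMeasurable' hle (aestronglyMeasurable_projM hZ H t) hip
  have h6 := condExp_congr_ae (m := pastSigma Z H t) h1
  filter_upwards [h4, h5, h6, condExp_add hie hip (pastSigma Z H t)] with ω h4 h5 h6 h7
  rw [martM, h6, h7, Pi.add_apply, h4, h5, (isGaussianLp_of_mem_fieldSpan hZ hemem).integral_eq_zero,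
    zero_add]

/-- The process `M_H` is Gaussian. -/
theorem isGaussianProcess_martM (H : Set.Ioo (0 : ℝ) 1) : IsGaussianProcess (martM P Z H) P :=
  ((isGaussianProcess_fieldSpan hZ).comp_right
    fun t => ⟨projM hZ H t, projM_mem_fieldSpan hZ H t⟩).congr fun t => (martM_ae_eq hZ H t).symm

theorem integral_martM (H : Set.Ioo (0 : ℝ) 1) (t : ℝ≥0) : ∫ ω, martM P Z H t ω ∂P = 0 := by
  rw [integral_congr_ae (martM_ae_eq hZ H t)]
  exact (isGaussianLp_of_mem_fieldSpan hZ (projM_mem_fieldSpan hZ H t)).integral_eq_zero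

/-- The covariance of the process `M_H`. -/
theorem integral_martM_mul_martM (H : Set.Ioo (0 : ℝ) 1) {s t : ℝ≥0} (hst : s ≤ t) :
    ∫ ω, martM P Z H s ω * martM P Z H t ω ∂P = constM H * (s : ℝ) ^ (2 - 2 * H : ℝ) := by
  rw [← norm_sq_projM hZ, ← inner_projM_of_le hZ H hst, L2.inner_def]
  refine integral_congr_ae ?_
  filter_upwards [martM_ae_eq hZ H s, martM_ae_eq hZ H t] with ω h1 h2
  rw [h1, h2]
  simp [mul_comm]

end Martingale

/-! ### Power sums along a uniform grid -/

/-- A Taylor bound that stays uniform down to y = 0, from Bernoulli's inequality for y^p and for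
y^(p-1) in y^p = y · y^(p-1). It is needed for p = 2H and p = 2-2H. -/
lemma abs_rpow_sub_one_add_le {y p : ℝ} (hy : 0 ≤ y) (hy1 : y ≤ 1) (hp : 0 < p) (hp2 : p < 2) :
    |y ^ p - 1 + p * (1 - y)| ≤ (1 - y) ^ 2 := by
  rcases hy.eq_or_lt with rfl | hy0
  · rw [Real.zero_rpow hp.ne', abs_le]
    constructor <;> linarith
  obtain ⟨e, rfl⟩ : ∃ e, y = 1 + -e := ⟨1 - y, by ring⟩
  have he : 0 ≤ e := by linarith
  have hmul : (1 + -e) ^ p = (1 + -e) * (1 + -e) ^ (p - 1) := by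
    rw [← Real.rpow_one_add' hy (by simpa using hp.ne')]; ring_nf
  rcases le_or_gt 1 p with h1 | h1
  · have hl := one_add_mul_self_le_rpow_one_add (s := -e) (by linarith) h1
    have hu := rpow_one_add_le_one_add_mul_self (s := -e) (by linarith) (p := p - 1)
      (by linarith) (by linarith)
    have hu' := mul_le_mul_of_nonneg_left hu hy
    rw [← hmul] at hu'
    rw [abs_le]
    constructor <;> nlinarith
  · have hu := rpow_one_add_le_one_add_mul_self (s := -e) (by linarith) hp.le h1.le
    have hl := rpow_one_add_le_one_add_mul_self (s := -e) (by linarith) (p := 1 - p)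
      (by linarith) (by linarith)
    have hinv : (1 + -e) ^ (p - 1) * (1 + -e) ^ (1 - p) = 1 := by
      rw [← Real.rpow_add hy0]; simp
    have hpos : 0 < (1 + -e) ^ (p - 1) := Real.rpow_pos_of_pos hy0 _
    have hge : 1 + (1 - p) * e ≤ (1 + -e) ^ (p - 1) := by
      have h2 := mul_le_mul_of_nonneg_left hl hpos.le
      rw [hinv] at h2
      have h3 : 0 ≤ (1 - p) * e := by nlinarith
      have h4 : 0 ≤ 1 - (1 - p) * e := by nlinarith
      nlinarith [mul_le_mul_of_nonneg_right h2 (by linarith : 0 ≤ 1 + (1 - p) * e),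
        mul_nonneg hpos.le (sq_nonneg ((1 - p) * e))]
    have hl' := mul_le_mul_of_nonneg_left hge hy
    rw [← hmul] at hl'
    rw [abs_le]
    constructor <;> nlinarith

lemma sum_Ioc_sub_pred (f : ℕ → ℝ) {k m : ℕ} (hkm : k ≤ m) :
    ∑ i ∈ Finset.Ioc k m, (f i - f (i - 1)) = f m - f k := by
  induction m, hkm using Nat.le_induction with
  | base => simp
  | succ m hkm ih => rw [Finset.sum_Ioc_succ_top (by lia), ih]; simp

section Grid

variable {H h : ℝ}

/-- Up to a constant, the variance of `t_i ^ (2H-1) * (M t_i - M t_{i-1})`, where `t_i = i h`. -/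
noncomputable def gridVarMart (H h : ℝ) (i : ℕ) : ℝ :=
  ((i * h) ^ (2 * H - 1)) ^ 2 * ((i * h) ^ (2 - 2 * H) - ((i - 1 : ℕ) * h) ^ (2 - 2 * H))

/-- Up to a constant, the variance of `(t_i ^ (2H-1) - t_{i-1} ^ (2H-1)) * M t_{i-1}`. -/
noncomputable def gridVarDrift (H h : ℝ) (i : ℕ) : ℝ :=
  ((i * h) ^ (2 * H - 1) - ((i - 1 : ℕ) * h) ^ (2 * H - 1)) ^ 2 * ((i - 1 : ℕ) * h) ^ (2 - 2 * H)

lemma exists_ratio {i : ℕ} (hi : 1 ≤ i) : ∃ y : ℝ, 0 ≤ y ∧ y ≤ 1 ∧ 1 - y = (i : ℝ)⁻¹ ∧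
    ((i - 1 : ℕ) : ℝ) = i * y := by
  have h1 : (1 : ℝ) ≤ i := by exact_mod_cast hi
  refine ⟨1 - (i : ℝ)⁻¹, ?_, ?_, by ring, ?_⟩
  · linarith [inv_le_one_of_one_le₀ h1]
  · linarith [inv_nonneg.2 (zero_le_one.trans h1)]
  · rw [Nat.cast_pred (by lia)]; field_simp

lemma gridVarMart_eq (hh : 0 < h) {i : ℕ} (hi : 1 ≤ i) {y : ℝ} (hy : 0 ≤ y)
    (hiy : ((i - 1 : ℕ) : ℝ) = i * y) :
    gridVarMart H h i = (i * h) ^ (2 * H) * (1 - y ^ (2 - 2 * H)) := by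
  have h1 : (0 : ℝ) < i * h := by have : (0 : ℝ) < i := by exact_mod_cast hi
                                  positivity
  rw [gridVarMart, hiy, mul_right_comm, Real.mul_rpow h1.le hy, ← Real.rpow_natCast,
    ← Real.rpow_mul h1.le, show (2 * H : ℝ) = (2 * H - 1) * (2 : ℕ) + (2 - 2 * H) by push_cast; ring,
    Real.rpow_add h1]
  ring_nf

lemma gridVarDrift_eq (hh : 0 < h) {i : ℕ} (hi : 1 ≤ i) {y : ℝ} (hy : 0 ≤ y)
    (hiy : ((i - 1 : ℕ) : ℝ) = i * y) :
    gridVarDrift H h i = (i * h) ^ (2 * H) * ((1 - y ^ (2 * H - 1)) ^ 2 * y ^ (2 - 2 * H)) := by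
  have h1 : (0 : ℝ) < i * h := by have : (0 : ℝ) < i := by exact_mod_cast hi
                                  positivity
  rw [gridVarDrift, hiy, mul_right_comm, Real.mul_rpow h1.le hy, Real.mul_rpow h1.le hy,
    show (2 * H : ℝ) = (2 * H - 1) * (2 : ℕ) + (2 - 2 * H) by push_cast; ring,
    Real.rpow_add h1, Real.rpow_mul h1.le, Real.rpow_natCast]
  ring_nf

lemma rpow_mul_inv_sq (hh : 0 < h) {i : ℕ} (hi : 1 ≤ i) :
    ((i : ℝ) * h) ^ (2 * H) * (i : ℝ)⁻¹ ^ 2 = h ^ (2 * H) * (i : ℝ) ^ (2 * H - 2) := by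
  have : (0 : ℝ) < i := by exact_mod_cast hi
  rw [Real.mul_rpow this.le hh.le, Real.rpow_sub this, inv_pow]
  norm_cast
  field_simp

/-- With y = (i-1)/i the variance is (ih)^(2H)(1 - y^(2-2H)) and the last factor is at most 3/i. The
bound i^(2H-1) ≤ m^H is crude but covers all H in (0, 1) at once; with mh = T it decays like h^H. -/
lemma gridVarMart_le (hH0 : 0 < H) (hH1 : H < 1) (hh : 0 < h) {i m : ℕ} (hi : 1 ≤ i) (him : i ≤ m) :
    gridVarMart H h i ≤ 3 * (m * h) ^ H * h ^ H := by
  obtain ⟨y, hy, hy1, hye, hiy⟩ := exists_ratio hi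
  have hi0 : (1 : ℝ) ≤ i := by exact_mod_cast hi
  have him' : (i : ℝ) ≤ m := by exact_mod_cast him
  have hm0 : (1 : ℝ) ≤ m := hi0.trans him'
  rw [gridVarMart_eq hh hi hy hiy]
  have h1 := (abs_le.1 (abs_rpow_sub_one_add_le hy hy1 (p := 2 - 2 * H) (by linarith)
    (by linarith))).1
  have h2 : 1 - y ^ (2 - 2 * H) ≤ 3 * (i : ℝ)⁻¹ := by rw [← hye]; nlinarith
  have h3 : ((i : ℝ) * h) ^ (2 * H) * (i : ℝ)⁻¹ = h ^ (2 * H) * (i : ℝ) ^ (2 * H - 1) := by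
    rw [Real.mul_rpow (by linarith) hh.le, Real.rpow_sub (by linarith), Real.rpow_one]
    field_simp
  have h4 : (i : ℝ) ^ (2 * H - 1) ≤ (m : ℝ) ^ H :=
    (Real.rpow_le_rpow_of_exponent_le hi0 (by linarith)).trans
      (Real.rpow_le_rpow (by linarith) him' hH0.le)
  calc _ ≤ ((i : ℝ) * h) ^ (2 * H) * (3 * (i : ℝ)⁻¹) := by gcongr
    _ = 3 * (h ^ (2 * H) * (i : ℝ) ^ (2 * H - 1)) := by rw [← h3]; ring
    _ ≤ 3 * (h ^ (2 * H) * (m : ℝ) ^ H) := by gcongr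
    _ = _ := by rw [Real.mul_rpow (by linarith) hh.le, two_mul, Real.rpow_add hh]; ring

/-- Replacing 2H-2 by H-1 costs little and makes the sum telescope, since i^H - (i-1)^H ≥ H i^(H-1)
by concavity. -/
lemma sum_Ioc_rpow_le (hH0 : 0 < H) (hH1 : H < 1) (k m : ℕ) :
    ∑ i ∈ Finset.Ioc k m, (i : ℝ) ^ (2 * H - 2) ≤ (m : ℝ) ^ H / H := by
  have key : ∀ i ∈ Finset.Ioc 0 m, (i : ℝ) ^ (2 * H - 2) ≤
      (i : ℝ) ^ H / H - ((i - 1 : ℕ) : ℝ) ^ H / H := by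
    intro i hi
    have hi := (Finset.mem_Ioc.1 hi).1
    obtain ⟨y, hy, hy1, hye, hiy⟩ := exists_ratio hi
    have hi0 : (1 : ℝ) ≤ i := by exact_mod_cast hi
    have h1 := rpow_one_add_le_one_add_mul_self (s := y - 1) (by linarith) hH0.le hH1.le
    rw [show 1 + (y - 1) = y by ring, show y - 1 = -(i : ℝ)⁻¹ by linarith] at h1
    rw [hiy, Real.mul_rpow (by linarith) hy, ← sub_div, le_div_iff₀ hH0]
    calc (i : ℝ) ^ (2 * H - 2) * H ≤ (i : ℝ) ^ (H - 1) * H :=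
        mul_le_mul_of_nonneg_right (Real.rpow_le_rpow_of_exponent_le hi0 (by linarith)) hH0.le
      _ = (i : ℝ) ^ H * (H * (i : ℝ)⁻¹) := by
        rw [Real.rpow_sub (by linarith), Real.rpow_one]; field_simp
      _ ≤ (i : ℝ) ^ H * (1 - y ^ H) := by gcongr; linarith
      _ = _ := by ring
  calc _ ≤ ∑ i ∈ Finset.Ioc 0 m, (i : ℝ) ^ (2 * H - 2) :=
        Finset.sum_le_sum_of_subset_of_nonneg (Finset.Ioc_subset_Ioc_left (by lia))
          fun _ _ _ => by positivity
    _ ≤ ∑ i ∈ Finset.Ioc 0 m, ((i : ℝ) ^ H / H - ((i - 1 : ℕ) : ℝ) ^ H / H) := Finset.sum_le_sum key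
    _ = _ := by
      rw [sum_Ioc_sub_pred (fun i : ℕ => (i : ℝ) ^ H / H) (by lia)]
      simp [Real.zero_rpow hH0.ne']

/-- The factor (2-2H)/(2H) matches the first-order terms of 1 - y^(2-2H) and 1 - y^(2H); what
remains is of order (1-y)² = i^(-2). -/
lemma abs_gridVarMart_sub_le (hH0 : 0 < H) (hH1 : H < 1) (hh : 0 < h) {i : ℕ} (hi : 1 ≤ i) :
    |gridVarMart H h i - (2 - 2 * H) / (2 * H) * ((i * h) ^ (2 * H) - ((i - 1 : ℕ) * h) ^ (2 * H))| ≤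
      (1 + (2 - 2 * H) / (2 * H)) * h ^ (2 * H) * (i : ℝ) ^ (2 * H - 2) := by
  obtain ⟨y, hy, hy1, hye, hiy⟩ := exists_ratio hi
  rw [gridVarMart_eq hh hi hy hiy, hiy, mul_right_comm (i : ℝ), Real.mul_rpow (by positivity) hy,
    mul_assoc _ (h ^ (2 * H)), ← rpow_mul_inv_sq hh hi, ← hye]
  have h1 := abs_le.1 (abs_rpow_sub_one_add_le hy hy1 (p := 2 - 2 * H) (by linarith) (by linarith))
  have h2 := abs_le.1 (abs_rpow_sub_one_add_le hy hy1 (p := 2 * H) (by linarith) (by linarith))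
  have hr : 0 ≤ (2 - 2 * H) / (2 * H) := div_nonneg (by linarith) (by linarith)
  have hr' : (2 - 2 * H) / (2 * H) * (2 * H) = 2 - 2 * H := by field_simp
  set r := (2 - 2 * H) / (2 * H)
  have h3 : |1 - y ^ (2 - 2 * H) - r * (1 - y ^ (2 * H))| ≤ (1 + r) * (1 - y) ^ 2 := by
    have h4 : r * (2 * H * (1 - y)) = (2 - 2 * H) * (1 - y) := by rw [← mul_assoc, hr']
    have h5 := mul_le_mul_of_nonneg_left h2.1 hr
    have h6 := mul_le_mul_of_nonneg_left h2.2 hr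
    rw [abs_le]
    constructor <;> linarith
  have h7 : 0 ≤ ((i : ℝ) * h) ^ (2 * H) := by positivity
  calc _ = ((i : ℝ) * h) ^ (2 * H) * |1 - y ^ (2 - 2 * H) - r * (1 - y ^ (2 * H))| := by
        rw [← abs_of_nonneg h7, ← abs_mul, abs_of_nonneg h7]; ring_nf
    _ ≤ ((i : ℝ) * h) ^ (2 * H) * ((1 + r) * (1 - y) ^ 2) := by gcongr
    _ = _ := by ring

lemma abs_sum_gridVarMart_sub_le (hH0 : 0 < H) (hH1 : H < 1) (hh : 0 < h) {k m : ℕ} (hkm : k ≤ m) :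
    |∑ i ∈ Finset.Ioc k m, gridVarMart H h i
        - (2 - 2 * H) / (2 * H) * ((m * h) ^ (2 * H) - (k * h) ^ (2 * H))| ≤
      (1 + (2 - 2 * H) / (2 * H)) / H * (m * h) ^ H * h ^ H := by
  rw [← sum_Ioc_sub_pred (fun i : ℕ => ((i : ℝ) * h) ^ (2 * H)) hkm, Finset.mul_sum,
    ← Finset.sum_sub_distrib]
  have hr : 0 ≤ (2 - 2 * H) / (2 * H) := div_nonneg (by linarith) (by linarith)
  calc _ ≤ ∑ i ∈ Finset.Ioc k m,
        (1 + (2 - 2 * H) / (2 * H)) * h ^ (2 * H) * (i : ℝ) ^ (2 * H - 2) :=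
        (Finset.abs_sum_le_sum_abs _ _).trans <| Finset.sum_le_sum fun i hi =>
          abs_gridVarMart_sub_le hH0 hH1 hh (by have := (Finset.mem_Ioc.1 hi).1; lia)
    _ ≤ (1 + (2 - 2 * H) / (2 * H)) * h ^ (2 * H) * ((m : ℝ) ^ H / H) := by
        rw [← Finset.mul_sum]
        gcongr
        exact sum_Ioc_rpow_le hH0 hH1 k m
    _ = _ := by rw [Real.mul_rpow (by positivity) hh.le, two_mul H, Real.rpow_add hh]; ring

/-- As |2H-1| < 1, the power y^(2H-1) lies between y and 1/y, so the drift factor is O(1-y) and its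
square gives i^(-2). -/
lemma gridVarDrift_le (hH0 : 0 < H) (hH1 : H < 1) (hh : 0 < h) {i : ℕ} (hi : 1 ≤ i) :
    gridVarDrift H h i ≤ 4 * h ^ (2 * H) * (i : ℝ) ^ (2 * H - 2) := by
  obtain ⟨y, hy, hy1, hye, hiy⟩ := exists_ratio hi
  rw [gridVarDrift_eq hh hi hy hiy, mul_assoc, ← rpow_mul_inv_sq hh hi, ← hye]
  -- In the first cell y = 0, and the factor y^(2-2H) = 0 removes it whatever `0 ^ (2 * H - 1)` is.
  rcases hi.eq_or_lt with rfl | hi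
  · obtain rfl : y = 0 := by simp at hiy; exact hiy.symm
    rw [Real.zero_rpow (by linarith : 2 - 2 * H ≠ 0)]
    simp only [mul_zero]
    positivity
  have hy2 : 1 / 2 ≤ y := by
    have h2 : (2 : ℝ) ≤ i := by exact_mod_cast hi
    have := inv_anti₀ two_pos h2
    linarith
  have hy0 : 0 < y := by linarith
  have h1 : |1 - y ^ (2 * H - 1)| ≤ 2 * (1 - y) := by
    rw [abs_le]
    constructor
    · have h3 : y ^ (2 * H - 1) ≤ y⁻¹ := by
        rw [← Real.rpow_neg_one]
        exact Real.rpow_le_rpow_of_exponent_ge hy0 hy1 (by linarith)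
      have h4 : y⁻¹ - 1 ≤ 2 * (1 - y) := by
        have : y⁻¹ - 1 = (1 - y) * y⁻¹ := by field_simp
        rw [this, mul_comm]
        have : y⁻¹ ≤ 2 := by rw [inv_le_comm₀ hy0 two_pos]; linarith
        gcongr
      linarith
    · have h3 : y ^ (1 : ℝ) ≤ y ^ (2 * H - 1) :=
        Real.rpow_le_rpow_of_exponent_ge hy0 hy1 (by linarith)
      rw [Real.rpow_one] at h3
      linarith
  have h2 : y ^ (2 - 2 * H) ≤ 1 := Real.rpow_le_one hy hy1 (by linarith)
  have h3 : (1 - y ^ (2 * H - 1)) ^ 2 ≤ (2 * (1 - y)) ^ 2 := sq_le_sq' (abs_le.1 h1).1 (abs_le.1 h1).2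
  calc _ ≤ ((i : ℝ) * h) ^ (2 * H) * ((2 * (1 - y)) ^ 2 * 1) := by gcongr
    _ = _ := by ring

end Grid

/-! ### Exponential moments of sums of squares of Gaussian variables -/

lemma integral_exp_mul_sq_gaussianReal {v : ℝ≥0} {l : ℝ} (hl : 2 * l * v < 1) :
    Integrable (fun x => Real.exp (l * x ^ 2)) (gaussianReal 0 v) ∧
      ∫ x, Real.exp (l * x ^ 2) ∂gaussianReal 0 v = (√(1 - 2 * l * v))⁻¹ := by
  rcases eq_or_ne v 0 with rfl | hv
  · rw [gaussianReal_zero_var]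
    exact ⟨integrable_dirac (by simp), by simp⟩
  have hv0 : (0 : ℝ) < v := by exact_mod_cast pos_iff_ne_zero.2 hv
  have hb : 0 < (1 - 2 * l * v) / (2 * v) := div_pos (by linarith) (by linarith)
  have key : ∀ x : ℝ, gaussianPDFReal 0 v x * Real.exp (l * x ^ 2) =
      (√(2 * Real.pi * v))⁻¹ * Real.exp (-((1 - 2 * l * v) / (2 * v)) * x ^ 2) := by
    intro x
    rw [gaussianPDFReal, mul_assoc, ← Real.exp_add]
    congr 2
    field_simp
    ring
  constructor
  · rw [gaussianReal_of_var_ne_zero _ hv, integrable_withDensity_iff_integrable_smul'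
      (measurable_gaussianPDF 0 v) (by simp [gaussianPDF])]
    simp only [gaussianPDF, ENNReal.toReal_ofReal (gaussianPDFReal_nonneg _ _ _), smul_eq_mul, key]
    exact (integrable_exp_neg_mul_sq hb).const_mul _
  · rw [integral_gaussianReal_eq_integral_smul hv]
    simp only [smul_eq_mul, key]
    rw [integral_const_mul, integral_gaussian, ← Real.sqrt_inv, ← Real.sqrt_inv,
      ← Real.sqrt_mul (by positivity)]
    congr 1
    have : 1 - 2 * l * v ≠ 0 := by linarith
    field_simp

section

variable {Ω : Type*} [MeasurableSpace Ω] {P : Measure Ω} {X : Ω → ℝ} {v l : ℝ}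

lemma ProbabilityTheory.HasGaussianLaw.integral_exp_mul_sq (hX : HasGaussianLaw X P) (h0 : ∫ ω, X ω ∂P = 0)
    (hv : ∫ ω, X ω ^ 2 ∂P = v) (hl : 2 * l * v < 1) :
    Integrable (fun ω => Real.exp (l * X ω ^ 2)) P ∧
      ∫ ω, Real.exp (l * X ω ^ 2) ∂P = (√(1 - 2 * l * v))⁻¹ := by
  have := hX.isProbabilityMeasure
  have hv0 : 0 ≤ v := by rw [← hv]; positivity
  have hmap := hX.map_eq_gaussianReal
  rw [h0, variance_eq_integral hX.aemeasurable, h0] at hmap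
  simp only [sub_zero] at hmap
  rw [hv] at hmap
  have key := integral_exp_mul_sq_gaussianReal (v := v.toNNReal) (l := l)
    (by rwa [Real.coe_toNNReal _ hv0])
  rw [← hmap, Real.coe_toNNReal _ hv0] at key
  have hm : AEStronglyMeasurable (fun x : ℝ => Real.exp (l * x ^ 2)) (P.map X) :=
    (by fun_prop : Measurable fun x : ℝ => Real.exp (l * x ^ 2)).aestronglyMeasurable
  rw [integrable_map_measure hm hX.aemeasurable, integral_map hX.aemeasurable hm] at key
  exact key

lemma ProbabilityTheory.HasGaussianLaw.integral_exp_sq_div_le (hX : HasGaussianLaw X P) (h0 : ∫ ω, X ω ∂P = 0)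
    {s : ℝ} (hs : 0 < s) (hv : ∫ ω, X ω ^ 2 ∂P ≤ s) :
    Integrable (fun ω => Real.exp (X ω ^ 2 / (4 * s))) P ∧
      ∫ ω, Real.exp (X ω ^ 2 / (4 * s)) ∂P ≤ 2 := by
  have hle : 2 * (4 * s)⁻¹ * ∫ ω, X ω ^ 2 ∂P ≤ 1 / 2 := by
    calc _ ≤ 2 * (4 * s)⁻¹ * s := by gcongr
      _ = _ := by field_simp; norm_num
  obtain ⟨h1, h2⟩ := hX.integral_exp_mul_sq h0 rfl (l := (4 * s)⁻¹) (by linarith)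
  simp only [div_eq_inv_mul]
  refine ⟨h1, h2.le.trans ?_⟩
  rw [inv_le_comm₀ (Real.sqrt_pos.2 (by linarith)) two_pos]
  exact Real.le_sqrt_of_sq_le (by linarith)

/-- With u = 2lv this bounds the Laplace transform (1-u)^(-1/2) of a Gaussian square; the linear
part of the exponent is removed by centering. -/
lemma one_le_one_sub_mul_exp {u : ℝ} (hu : |u| ≤ 1 / 2) : 1 ≤ (1 - u) * Real.exp (u + u ^ 2) := by
  obtain ⟨h1, h2⟩ := abs_le.1 hu
  have h3 := Real.quadratic_le_exp_of_nonneg (x := u + 1 / 2) (by linarith)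
  have h4 := Real.add_one_le_exp (u + u ^ 2)
  rcases le_total 0 u with h | h
  · have h5 := Real.quadratic_le_exp_of_nonneg (x := u + u ^ 2) (by positivity)
    have h6 : 1 ≤ (1 - u) * (1 + (u + u ^ 2) + (u + u ^ 2) ^ 2 / 2) := by
      have : (1 - u) * (1 + (u + u ^ 2) + (u + u ^ 2) ^ 2 / 2) - 1 =
          u ^ 2 / 2 * (1 - u - u ^ 2 - u ^ 3) := by ring
      have h7 : 0 ≤ 1 - u - u ^ 2 - u ^ 3 := by nlinarith
      nlinarith [mul_nonneg (by positivity : 0 ≤ u ^ 2 / 2) h7]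
    exact h6.trans (mul_le_mul_of_nonneg_left h5 (by linarith))
  · have h6 : 1 ≤ (1 - u) * (u + u ^ 2 + 1) := by nlinarith [mul_nonneg (sq_nonneg u) (neg_nonneg.2 h)]
    exact h6.trans (mul_le_mul_of_nonneg_left h4 (by linarith))

lemma ProbabilityTheory.HasGaussianLaw.integral_exp_mul_sq_sub_le (hX : HasGaussianLaw X P) (h0 : ∫ ω, X ω ∂P = 0)
    (hv : ∫ ω, X ω ^ 2 ∂P = v) (hl : |2 * l * v| ≤ 1 / 2) :
    Integrable (fun ω => Real.exp (l * (X ω ^ 2 - v))) P ∧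
      ∫ ω, Real.exp (l * (X ω ^ 2 - v)) ∂P ≤ Real.exp ((2 * l * v) ^ 2 / 2) := by
  have hl' := (abs_le.1 hl).2
  obtain ⟨h1, h2⟩ := hX.integral_exp_mul_sq h0 hv (l := l) (by linarith)
  simp only [mul_sub, Real.exp_sub, integral_div]
  refine ⟨h1.div_const _, ?_⟩
  rw [h2, div_le_iff₀ (Real.exp_pos _), ← Real.exp_add,
    inv_le_iff_one_le_mul₀ (Real.sqrt_pos.2 (by linarith))]
  refine (Real.one_le_sqrt.2 (one_le_one_sub_mul_exp hl)).trans_eq ?_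
  rw [Real.sqrt_mul (by linarith), mul_comm, ← Real.exp_half]
  ring_nf

/-- Concentration of a sum of squares of independent centered Gaussian variables. -/
lemma integral_exp_abs_sum_sq_sub_le {ι : Type*} [Fintype ι] {X : ι → Ω → ℝ}
    (hX : HasGaussianLaw (fun ω i => X i ω) P) (hm : ∀ i, Measurable (X i))
    (h0 : ∀ i, ∫ ω, X i ω ∂P = 0) (hcov : ∀ i j, i ≠ j → cov[X i, X j; P] = 0)
    {w : ι → ℝ} (hw : ∀ i, ∫ ω, X i ω ^ 2 ∂P = w i) (hv0 : 0 < v) (hv : v ≤ 1 / 16)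
    (hwv : ∀ i, w i ≤ v) {L : ℝ} (hL : ∑ i, w i ≤ L) :
    Integrable (fun ω => Real.exp (|∑ i, (X i ω ^ 2 - w i)| / √v)) P ∧
      ∫ ω, Real.exp (|∑ i, (X i ω ^ 2 - w i)| / √v) ∂P ≤ 2 * Real.exp (2 * L) := by
  have := hX.isProbabilityMeasure
  have hw0 : ∀ i, 0 ≤ w i := fun i => by rw [← hw]; positivity
  have hsv : 0 < √v := Real.sqrt_pos.2 hv0
  have hss : √v * √v = v := Real.mul_self_sqrt hv0.le
  have hind : iIndepFun (fun i ω => X i ω ^ 2 - w i) P :=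
    (hX.iIndepFun_of_covariance_eq_zero hcov).comp (fun i x => x ^ 2 - w i) fun i => by fun_prop
  have hm' : ∀ i, Measurable fun ω => X i ω ^ 2 - w i := fun i => ((hm i).pow_const 2).sub_const _
  -- Both signs l = ±1/√v are needed for the absolute value. Then (2 l w_i)² = 4 w_i²/v ≤ 4 w_i,
  -- which sums to a bounded exponent, and v ≤ 1/16 keeps |2 l w_i| ≤ 1/2.
  have key : ∀ l : ℝ, l ^ 2 = v⁻¹ →
      Integrable (fun ω => Real.exp (l * ∑ i, (X i ω ^ 2 - w i))) P ∧
        ∫ ω, Real.exp (l * ∑ i, (X i ω ^ 2 - w i)) ∂P ≤ Real.exp (2 * L) := by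
    intro l hl
    have hb : ∀ i, (2 * l * w i) ^ 2 ≤ 4 * w i := by
      intro i
      calc (2 * l * w i) ^ 2 = 4 * (v⁻¹ * w i) * w i := by rw [← hl]; ring
        _ ≤ 4 * (v⁻¹ * v) * w i := by have := hw0 i; have := hwv i; gcongr
        _ = _ := by rw [inv_mul_cancel₀ hv0.ne', mul_one]
    have hb' : ∀ i, |2 * l * w i| ≤ 1 / 2 := fun i =>
      abs_le_of_sq_le_sq (by linarith [hb i, hwv i]) (by norm_num)
    have hi := fun i => (hX.eval i).integral_exp_mul_sq_sub_le (h0 i) (hw i) (hb' i)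
    have h1 := hind.integrable_exp_mul_sum (t := l) hm' (s := Finset.univ) fun i _ => (hi i).1
    have h2 := hind.mgf_sum (t := l) hm' Finset.univ
    simp only [mgf, Finset.sum_apply] at h1 h2
    refine ⟨h1, h2.le.trans ?_⟩
    calc _ ≤ ∏ i, Real.exp ((2 * l * w i) ^ 2 / 2) :=
          Finset.prod_le_prod (fun i _ => integral_nonneg fun ω => (Real.exp_pos _).le)
            fun i _ => (hi i).2
      _ = Real.exp (∑ i, (2 * l * w i) ^ 2 / 2) := (Real.exp_sum _ _).symm
      _ ≤ Real.exp (∑ i, 2 * w i) := Real.exp_le_exp.2 <| Finset.sum_le_sum fun i _ => by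
          linarith [hb i]
      _ ≤ _ := by rw [← Finset.mul_sum]; gcongr
  obtain ⟨p1, p2⟩ := key (√v)⁻¹ (by rw [inv_pow, Real.sq_sqrt hv0.le])
  obtain ⟨q1, q2⟩ := key (-(√v)⁻¹) (by rw [neg_sq, inv_pow, Real.sq_sqrt hv0.le])
  have hle : ∀ ω, Real.exp (|∑ i, (X i ω ^ 2 - w i)| / √v) ≤
      Real.exp ((√v)⁻¹ * ∑ i, (X i ω ^ 2 - w i)) + Real.exp (-(√v)⁻¹ * ∑ i, (X i ω ^ 2 - w i)) := by
    intro ω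
    rcases abs_choice (∑ i, (X i ω ^ 2 - w i)) with h | h <;> rw [h, div_eq_inv_mul]
    · linarith [Real.exp_pos (-(√v)⁻¹ * ∑ i, (X i ω ^ 2 - w i))]
    · rw [mul_neg, ← neg_mul]
      linarith [Real.exp_pos ((√v)⁻¹ * ∑ i, (X i ω ^ 2 - w i))]
  have hint : Integrable (fun ω => Real.exp (|∑ i, (X i ω ^ 2 - w i)| / √v)) P := by
    refine (p1.add q1).mono' ?_ (ae_of_all _ fun ω => ?_)
    · exact ((Real.measurable_exp.comp
        ((Finset.measurable_fun_sum _ fun i _ => hm' i).abs.div_const _))).aestronglyMeasurable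
    · rw [Real.norm_of_nonneg (Real.exp_pos _).le]
      exact hle ω
  refine ⟨hint, (integral_mono hint (p1.add q1) hle).trans ?_⟩
  rw [integral_add' p1 q1]
  linarith

/-- An exponential moment of a sum of squares of centered Gaussian variables. -/
lemma integral_exp_sum_sq_div_le [IsProbabilityMeasure P] {ι : Type*} {I : Finset ι} {X : ι → Ω → ℝ}
    (hX : ∀ i ∈ I, HasGaussianLaw (X i) P) (h0 : ∀ i ∈ I, ∫ ω, X i ω ∂P = 0)
    {s : ι → ℝ} (hs : ∀ i ∈ I, 0 < s i) (hXs : ∀ i ∈ I, ∫ ω, X i ω ^ 2 ∂P ≤ s i)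
    {W : ℝ} (hW : ∑ i ∈ I, s i ≤ W) :
    Integrable (fun ω => Real.exp ((∑ i ∈ I, X i ω ^ 2) / (4 * W))) P ∧
      ∫ ω, Real.exp ((∑ i ∈ I, X i ω ^ 2) / (4 * W)) ∂P ≤ 2 := by
  rcases I.eq_empty_or_nonempty with rfl | hI
  · simp
  set S := ∑ i ∈ I, s i
  have hS : 0 < S := Finset.sum_pos hs hI
  have hi := fun i (h : i ∈ I) => (hX i h).integral_exp_sq_div_le (h0 i h) (hs i h) (hXs i h)
  have hle : ∀ ω, Real.exp ((∑ i ∈ I, X i ω ^ 2) / (4 * W)) ≤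
      ∑ i ∈ I, s i / S * Real.exp (X i ω ^ 2 / (4 * s i)) := by
    intro ω
    -- Jensen with weights s_i/S reduces to one variable at a time, so no independence is required.
    have hc := convexOn_exp.map_sum_le (t := I) (w := fun i => s i / S)
      (p := fun i => X i ω ^ 2 / (4 * s i)) (fun i h => (div_pos (hs i h) hS).le)
      (by rw [← Finset.sum_div, div_self hS.ne']) (fun _ _ => Set.mem_univ _)
    simp only [smul_eq_mul] at hc
    refine le_trans (Real.exp_le_exp.2 ?_) hc
    calc _ ≤ (∑ i ∈ I, X i ω ^ 2) / (4 * S) := by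
          gcongr
      _ = _ := by
          rw [Finset.sum_div]
          refine Finset.sum_congr rfl fun i h => ?_
          have := hs i h
          field_simp
  have hsum : Integrable (fun ω => ∑ i ∈ I, s i / S * Real.exp (X i ω ^ 2 / (4 * s i))) P :=
    integrable_finsetSum _ fun i h => (hi i h).1.const_mul _
  have hint : Integrable (fun ω => Real.exp ((∑ i ∈ I, X i ω ^ 2) / (4 * W))) P := by
    refine hsum.mono' ?_ (ae_of_all _ fun ω => ?_)
    · exact (Real.measurable_exp.comp_aemeasurable ((Finset.aemeasurable_fun_sum _ fun i h =>
        (hX i h).aemeasurable.pow_const 2).div_const _)).aestronglyMeasurable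
    · rw [Real.norm_of_nonneg (Real.exp_pos _).le]
      exact hle ω
  refine ⟨hint, (integral_mono hint hsum hle).trans ?_⟩
  rw [integral_finsetSum _ fun i h => (hi i h).1.const_mul _]
  calc _ ≤ ∑ i ∈ I, s i / S * 2 := Finset.sum_le_sum fun i h => by
        rw [integral_const_mul]
        exact mul_le_mul_of_nonneg_left (hi i h).2 (div_pos (hs i h) hS).le
    _ = 2 := by rw [← Finset.sum_mul, ← Finset.sum_div, div_self hS.ne', one_mul]

end

/-! ### Convergence from exponential moments -/

/-- The variables `D n` have exponential moments at a scale that decays polynomially. -/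
def ExpMomentDecay {Ω : Type*} [MeasurableSpace Ω] (D : ℕ → Ω → ℝ) (P : Measure Ω) : Prop :=
  ∃ γ K C : ℝ, 0 < γ ∧ ∀ n, AEMeasurable (D n) P ∧ ∃ ε : ℝ, 0 < ε ∧
    ε ≤ K * ((n : ℝ) + 1) ^ (-γ) ∧ Integrable (fun ω => Real.exp (|D n ω| / ε)) P ∧
      ∫ ω, Real.exp (|D n ω| / ε) ∂P ≤ C

section

variable {Ω : Type*} [MeasurableSpace Ω] {P : Measure Ω} {D : ℕ → Ω → ℝ}

lemma integral_abs_pow_le {X : Ω → ℝ} (hX : AEMeasurable X P) {ε : ℝ} (hε : 0 < ε)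
    (hint : Integrable (fun ω => Real.exp (|X ω| / ε)) P) (p : ℕ) :
    Integrable (fun ω => |X ω| ^ p) P ∧
      ∫ ω, |X ω| ^ p ∂P ≤ ε ^ p * p.factorial * ∫ ω, Real.exp (|X ω| / ε) ∂P := by
  have hle : ∀ ω, |X ω| ^ p ≤ ε ^ p * p.factorial * Real.exp (|X ω| / ε) := by
    intro ω
    have h := Real.pow_div_factorial_le_exp (|X ω| / ε) (by positivity) p
    rw [div_le_iff₀ (by positivity), div_pow, div_le_iff₀ (by positivity)] at h
    linarith
  have h1 : Integrable (fun ω => |X ω| ^ p) P := by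
    refine (hint.const_mul (ε ^ p * p.factorial)).mono' ?_ (ae_of_all _ fun ω => ?_)
    · exact (hX.abs.pow_const p).aestronglyMeasurable
    · rw [Real.norm_of_nonneg (by positivity)]
      exact hle ω
  refine ⟨h1, (integral_mono h1 (hint.const_mul _) hle).trans_eq ?_⟩
  rw [integral_const_mul]

/-- From x^p/p! ≤ e^x at x = |D|/ε. The rate γ is the same for all p, so high moments decay as fast
as desired. -/
lemma ExpMomentDecay.exists_moment_le (hD : ExpMomentDecay D P) : ∃ γ : ℝ, 0 < γ ∧ ∀ p : ℕ, ∃ C : ℝ, ∀ n,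
    Integrable (fun ω => |D n ω| ^ p) P ∧
      ∫ ω, |D n ω| ^ p ∂P ≤ C * (((n : ℝ) + 1) ^ (-γ)) ^ p := by
  obtain ⟨γ, K, C, hγ, h⟩ := hD
  refine ⟨γ, hγ, fun p => ⟨K ^ p * p.factorial * C, fun n => ?_⟩⟩
  obtain ⟨hm, ε, hε, hεK, hint, hC⟩ := h n
  obtain ⟨h1, h2⟩ := integral_abs_pow_le hm hε hint p
  have hC0 : 0 ≤ ∫ ω, Real.exp (|D n ω| / ε) ∂P := integral_nonneg fun _ => (Real.exp_pos _).le
  have hK0 : 0 ≤ K * ((n : ℝ) + 1) ^ (-γ) := hε.le.trans hεK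
  refine ⟨h1, h2.trans ?_⟩
  calc _ ≤ (K * ((n : ℝ) + 1) ^ (-γ)) ^ p * p.factorial * C := by gcongr
    _ = _ := by rw [mul_pow]; ring

lemma tendsto_rpow_neg_nat {γ : ℝ} (hγ : 0 < γ) :
    Tendsto (fun n : ℕ => ((n : ℝ) + 1) ^ (-γ)) atTop (𝓝 0) :=
  (tendsto_rpow_neg_atTop hγ).comp
    (tendsto_atTop_add_const_right _ _ tendsto_natCast_atTop_atTop)

lemma ExpMomentDecay.tendsto_integral_pow (hD : ExpMomentDecay D P) {p : ℕ} (hp : p ≠ 0) :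
    (∀ n, Integrable (fun ω => |D n ω| ^ p) P) ∧
      Tendsto (fun n => ∫ ω, |D n ω| ^ p ∂P) atTop (𝓝 0) := by
  obtain ⟨γ, hγ, h⟩ := hD.exists_moment_le
  obtain ⟨C, hC⟩ := h p
  refine ⟨fun n => (hC n).1, squeeze_zero (fun n => integral_nonneg fun _ => by positivity)
    (fun n => (hC n).2) ?_⟩
  simpa [hp] using ((tendsto_rpow_neg_nat hγ).pow p).const_mul C

/-- Take p with pγ > 1: the p-th moments are summable, so ∑ |D_n|^p is finite almost surely and its
terms tend to 0. -/
lemma ExpMomentDecay.ae_tendsto (hD : ExpMomentDecay D P) :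
    ∀ᵐ ω ∂P, Tendsto (fun n => D n ω) atTop (𝓝 0) := by
  obtain ⟨γ, hγ, h⟩ := hD.exists_moment_le
  obtain ⟨p, hp⟩ := exists_nat_gt γ⁻¹
  have hp1 : 1 < p * γ := by rwa [inv_lt_iff_one_lt_mul₀ hγ] at hp
  have hp0 : p ≠ 0 := by rintro rfl; norm_num at hp1
  obtain ⟨C, hC⟩ := h p
  have hsum : Summable fun n : ℕ => C * (((n : ℝ) + 1) ^ (-γ)) ^ p := by
    refine Summable.mul_left _ ?_
    convert! (Real.summable_one_div_nat_add_rpow 1 (p * γ)).2 hp1 using 2 with n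
    have : (0 : ℝ) < (n : ℝ) + 1 := by positivity
    rw [abs_of_pos this, ← Real.rpow_natCast, ← Real.rpow_mul this.le, one_div,
      ← Real.rpow_neg this.le]
    ring_nf
  have hm : ∀ n, AEMeasurable (fun ω => ENNReal.ofReal (|D n ω| ^ p)) P :=
    fun n => (hC n).1.aemeasurable.ennreal_ofReal
  have hfin : ∫⁻ ω, ∑' n, ENNReal.ofReal (|D n ω| ^ p) ∂P ≠ ⊤ := by
    rw [lintegral_tsum hm]
    refine ne_top_of_le_ne_top hsum.tsum_ofReal_ne_top (ENNReal.tsum_le_tsum fun n => ?_)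
    rw [← ofReal_integral_eq_lintegral_ofReal (hC n).1 (ae_of_all _ fun _ => by positivity)]
    exact ENNReal.ofReal_le_ofReal (hC n).2
  filter_upwards [ae_lt_top' (AEMeasurable.tsum hm) hfin] with ω hω
  have h1 := ENNReal.tendsto_atTop_zero_of_tsum_ne_top hω.ne
  have h2 := (ENNReal.tendsto_toReal ENNReal.zero_ne_top).comp h1
  simp only [Function.comp_def, ENNReal.toReal_zero] at h2
  have h3 : Tendsto (fun n => |D n ω| ^ p) atTop (𝓝 0) := by
    refine h2.congr fun n => ENNReal.toReal_ofReal (by positivity)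
  have h4 := h3.rpow_const (p := (p : ℝ)⁻¹) (Or.inr (by positivity))
  rw [Real.zero_rpow (by simpa using hp0)] at h4
  refine (tendsto_zero_iff_abs_tendsto_zero _).2 (h4.congr fun n => ?_)
  exact Real.pow_rpow_inv_natCast (abs_nonneg _) hp0

/-- If `S` is the square of the sum of two vectors whose squared lengths `X` and `Y` converge to `I`
and to `0`, then `S` converges to `I`. -/
theorem tendsto_of_expMomentDecay [IsProbabilityMeasure P] {S X Y : ℕ → Ω → ℝ} {L : ℕ → ℝ} {I : ℝ}
    (hL : Tendsto L atTop (𝓝 I)) (hS : ∀ n, MemLp (S n) 2 P)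
    (hY0 : ∀ n ω, 0 ≤ Y n ω)
    (hSXY : ∀ n ω, (S n ω - X n ω - Y n ω) ^ 2 ≤ 4 * (X n ω * Y n ω))
    (hX : ExpMomentDecay (fun n ω => X n ω - L n) P) (hY : ExpMomentDecay Y P) :
    Tendsto (fun n => eLpNorm (fun ω => S n ω - I) 2 P) atTop (𝓝 0) ∧
      ∀ᵐ ω ∂P, Tendsto (fun n => S n ω) atTop (𝓝 I) := by
  constructor
  · obtain ⟨x1, x2⟩ := hX.tendsto_integral_pow two_ne_zero
    obtain ⟨y1, y2⟩ := hY.tendsto_integral_pow two_ne_zero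
    obtain ⟨z1, z2⟩ := hY.tendsto_integral_pow one_ne_zero
    -- Split S - I into X - I, Y and the cross term, whose square is at most 4XY; then 12XY ≤ 12IY +
    -- 6(X-I)² + 6Y². The total is 9(X-I)² + 9Y² + 12IY, and X - I is split at L.
    have hle : ∀ n ω, (S n ω - I) ^ 2 ≤ 18 * |X n ω - L n| ^ 2 + 9 * |Y n ω| ^ 2
        + 12 * I * |Y n ω| ^ 1 + 18 * (L n - I) ^ 2 := by
      intro n ω
      have h1 := hSXY n ω
      rw [sq_abs, sq_abs, pow_one, abs_of_nonneg (hY0 n ω)]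
      generalize S n ω = s at *
      generalize X n ω = x at *
      generalize Y n ω = y at *
      have h2 : (s - I) ^ 2 ≤ 3 * (x - I) ^ 2 + 3 * y ^ 2 + 3 * (s - x - y) ^ 2 := by
        nlinarith [sq_nonneg ((x - I) - y), sq_nonneg ((x - I) - (s - x - y)),
          sq_nonneg (y - (s - x - y))]
      nlinarith [sq_nonneg ((x - I) - y), sq_nonneg ((x - L n) - (L n - I))]
    have hSI : ∀ n, MemLp (fun ω => S n ω - I) 2 P := fun n => (hS n).sub (memLp_const I)
    have hint : Tendsto (fun n => ∫ ω, (S n ω - I) ^ 2 ∂P) atTop (𝓝 0) := by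
      refine squeeze_zero (fun n => integral_nonneg fun _ => by positivity) (fun n =>
        (integral_mono ((memLp_two_iff_integrable_sq (hSI n).1).1 (hSI n))
          (((((x1 n).const_mul 18).add ((y1 n).const_mul 9)).add
            ((z1 n).const_mul (12 * I))).add (integrable_const (18 * (L n - I) ^ 2))) (hle n))) ?_
      have h3 : Tendsto (fun n => (L n - I) ^ 2) atTop (𝓝 0) := by
        simpa using (hL.sub_const I).pow 2
      have h4 := (((x2.const_mul 18).add (y2.const_mul 9)).add (z2.const_mul (12 * I))).add
        (h3.const_mul 18)
      simp only [mul_zero, add_zero] at h4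
      refine h4.congr fun n => ?_
      rw [integral_add' ((((x1 n).const_mul 18).add ((y1 n).const_mul 9)).add
          ((z1 n).const_mul (12 * I))) (integrable_const _),
        integral_add' (((x1 n).const_mul 18).add ((y1 n).const_mul 9)) ((z1 n).const_mul (12 * I)),
        integral_add' ((x1 n).const_mul 18) ((y1 n).const_mul 9)]
      simp [integral_const_mul]
    have h5 := (hint.rpow_const (p := (2 : ℝ)⁻¹) (Or.inr (by norm_num)))
    rw [Real.zero_rpow (by norm_num)] at h5
    have h6 := ENNReal.tendsto_ofReal h5
    rw [ENNReal.ofReal_zero] at h6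
    refine h6.congr fun n => ?_
    rw [(hSI n).eLpNorm_eq_integral_rpow_norm two_ne_zero ENNReal.ofNat_ne_top]
    simp
  · filter_upwards [hX.ae_tendsto, hY.ae_tendsto] with ω h1 h2
    have h3 : Tendsto (fun n => X n ω) atTop (𝓝 I) := by simpa using h1.add hL
    have h4 : Tendsto (fun n => (S n ω - X n ω - Y n ω) ^ 2) atTop (𝓝 0) :=
      squeeze_zero (fun n => sq_nonneg _) (fun n => hSXY n ω)
        (by simpa using (h3.mul h2).const_mul 4)
    have h5 : Tendsto (fun n => S n ω - X n ω - Y n ω) atTop (𝓝 0) := by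
      have := h4.sqrt
      simp only [Real.sqrt_sq_eq_abs, Real.sqrt_zero] at this
      exact (tendsto_zero_iff_abs_tendsto_zero _).2 this
    simpa [sub_sub] using h5.add (h3.add h2)

end

/-! ### The quadratic variation of the Dobrić–Ojeda process -/

lemma coe_gridPoint (T : ℝ≥0) (m i : ℕ) : (gridPoint T m i : ℝ) = i * (T / m : ℝ) := by
  simp [gridPoint, mul_div_assoc]

lemma gridPoint_mono (T : ℝ≥0) (m : ℕ) : Monotone (gridPoint T m) := fun i j hij => by
  rw [← NNReal.coe_le_coe, coe_gridPoint, coe_gridPoint]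
  gcongr

/-- The growth of the grid enters the estimates only through m ≥ n. -/
lemma le_gridSize {δ : ℝ} (hδ : 0 < δ) {n : ℕ} (hn : 1 ≤ n) : n ≤ gridSize δ n :=
  Nat.le_floor (Real.self_le_rpow_of_one_le (by exact_mod_cast hn) (by linarith))

/-! ### Splitting the increments into a martingale part and a drift part -/

section Increments

variable {Ω : Type*} [MeasurableSpace Ω] {P : Measure Ω} {M : ℝ≥0 → Ω → ℝ} {H κ : ℝ}

lemma ProbabilityTheory.IsGaussianProcess.integrable_mul (hM : IsGaussianProcess M P) (s t : ℝ≥0) :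
    Integrable (fun ω => M s ω * M t ω) P :=
  ((hM.hasGaussianLaw_eval s).memLp (p := 2) ENNReal.ofNat_ne_top).integrable_mul
    ((hM.hasGaussianLaw_eval t).memLp (p := 2) ENNReal.ofNat_ne_top)

/-- The covariance depends only on the earlier time, so all four terms cancel in pairs. -/
lemma integral_incr_mul_incr (hM : IsGaussianProcess M P)
    (hcov : ∀ s t, s ≤ t → ∫ ω, M s ω * M t ω ∂P = κ * (s : ℝ) ^ (2 - 2 * H))
    {a b c d : ℝ≥0} (hab : a ≤ b) (hbc : b ≤ c) (hcd : c ≤ d) :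
    ∫ ω, (M b ω - M a ω) * (M d ω - M c ω) ∂P = 0 := by
  have h := hM.integrable_mul
  have : ∀ ω, (M b ω - M a ω) * (M d ω - M c ω) =
      M b ω * M d ω - M b ω * M c ω - (M a ω * M d ω - M a ω * M c ω) := fun ω => by ring
  simp only [this]
  have h1 : Integrable (fun ω => M b ω * M d ω - M b ω * M c ω) P := (h b d).sub (h b c)
  have h2 : Integrable (fun ω => M a ω * M d ω - M a ω * M c ω) P := (h a d).sub (h a c)
  rw [integral_sub h1 h2, integral_sub (h b d) (h b c),
    integral_sub (h a d) (h a c), hcov b d (hbc.trans hcd), hcov b c hbc,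
    hcov a d (hab.trans (hbc.trans hcd)), hcov a c (hab.trans hbc)]
  ring

lemma integral_incr_sq (hM : IsGaussianProcess M P)
    (hcov : ∀ s t, s ≤ t → ∫ ω, M s ω * M t ω ∂P = κ * (s : ℝ) ^ (2 - 2 * H))
    {a b : ℝ≥0} (hab : a ≤ b) :
    ∫ ω, (M b ω - M a ω) ^ 2 ∂P = κ * ((b : ℝ) ^ (2 - 2 * H) - (a : ℝ) ^ (2 - 2 * H)) := by
  have h := hM.integrable_mul
  have : ∀ ω, (M b ω - M a ω) ^ 2 =
      M b ω * M b ω - M a ω * M b ω - (M a ω * M b ω - M a ω * M a ω) := fun ω => by ring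
  simp only [this]
  have h1 : Integrable (fun ω => M b ω * M b ω - M a ω * M b ω) P := (h b b).sub (h a b)
  have h2 : Integrable (fun ω => M a ω * M b ω - M a ω * M a ω) P := (h a b).sub (h a a)
  rw [integral_sub h1 h2, integral_sub (h b b) (h a b),
    integral_sub (h a b) (h a a), hcov b b le_rfl, hcov a b hab, hcov a a le_rfl]
  ring

/-- The martingale part of the increment of `c * t ^ (2H-1) * M t` over a grid step. -/
noncomputable def martIncr (M : ℝ≥0 → Ω → ℝ) (H c : ℝ) (T : ℝ≥0) (m i : ℕ) (ω : Ω) : ℝ :=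
  c * (gridPoint T m i : ℝ) ^ (2 * H - 1) * (M (gridPoint T m i) ω - M (gridPoint T m (i - 1)) ω)

/-- The drift part of the increment of `c * t ^ (2H-1) * M t` over a grid step. -/
noncomputable def driftIncr (M : ℝ≥0 → Ω → ℝ) (H c : ℝ) (T : ℝ≥0) (m i : ℕ) (ω : Ω) : ℝ :=
  c * ((gridPoint T m i : ℝ) ^ (2 * H - 1) - (gridPoint T m (i - 1) : ℝ) ^ (2 * H - 1)) *
    M (gridPoint T m (i - 1)) ω

variable (H) (c : ℝ) (T : ℝ≥0) (m : ℕ)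

lemma isGaussianProcess_martIncr (hM : IsGaussianProcess M P) :
    IsGaussianProcess (martIncr M H c T m) P := by
  classical
  refine hM.of_isGaussianProcess fun i => ⟨{gridPoint T m i, gridPoint T m (i - 1)},
    (c * (gridPoint T m i : ℝ) ^ (2 * H - 1)) • (ContinuousLinearMap.proj ⟨gridPoint T m i, by simp⟩ -
      ContinuousLinearMap.proj ⟨gridPoint T m (i - 1), by simp⟩), fun ω => ?_⟩
  simp [martIncr]

lemma hasGaussianLaw_driftIncr (hM : IsGaussianProcess M P) (i : ℕ) :
    HasGaussianLaw (driftIncr M H c T m i) P :=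
  (hM.hasGaussianLaw_eval (gridPoint T m (i - 1))).fun_smul _

lemma integral_martIncr (hM : IsGaussianProcess M P) (h0 : ∀ t, ∫ ω, M t ω ∂P = 0) (i : ℕ) :
    ∫ ω, martIncr M H c T m i ω ∂P = 0 := by
  simp only [martIncr]
  rw [integral_const_mul, integral_sub (hM.hasGaussianLaw_eval _).integrable
    (hM.hasGaussianLaw_eval _).integrable, h0, h0]
  simp

lemma integral_driftIncr (h0 : ∀ t, ∫ ω, M t ω ∂P = 0) (i : ℕ) :
    ∫ ω, driftIncr M H c T m i ω ∂P = 0 := by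
  simp only [driftIncr]
  rw [integral_const_mul, h0, mul_zero]

lemma integral_martIncr_sq (hM : IsGaussianProcess M P)
    (hcov : ∀ s t, s ≤ t → ∫ ω, M s ω * M t ω ∂P = κ * (s : ℝ) ^ (2 - 2 * H)) (i : ℕ) :
    ∫ ω, martIncr M H c T m i ω ^ 2 ∂P = c ^ 2 * κ * gridVarMart H (T / m) i := by
  simp only [martIncr, mul_pow _ (_ - _)]
  rw [integral_const_mul, integral_incr_sq hM hcov (gridPoint_mono T m (Nat.sub_le i 1)),
    coe_gridPoint, coe_gridPoint, gridVarMart]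
  ring

lemma integral_driftIncr_sq
    (hcov : ∀ s t, s ≤ t → ∫ ω, M s ω * M t ω ∂P = κ * (s : ℝ) ^ (2 - 2 * H)) (i : ℕ) :
    ∫ ω, driftIncr M H c T m i ω ^ 2 ∂P = c ^ 2 * κ * gridVarDrift H (T / m) i := by
  simp only [driftIncr, mul_pow _ (M _ _)]
  rw [integral_const_mul]
  simp only [sq (M _ _)]
  rw [hcov _ _ le_rfl, coe_gridPoint, coe_gridPoint, gridVarDrift]
  ring

lemma covariance_martIncr (hM : IsGaussianProcess M P) (h0 : ∀ t, ∫ ω, M t ω ∂P = 0)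
    (hcov : ∀ s t, s ≤ t → ∫ ω, M s ω * M t ω ∂P = κ * (s : ℝ) ^ (2 - 2 * H)) {i j : ℕ}
    (hij : i ≠ j) : cov[martIncr M H c T m i, martIncr M H c T m j; P] = 0 := by
  have := hM.isProbabilityMeasure
  wlog h : i < j generalizing i j
  · rw [covariance_comm]
    exact this hij.symm (by lia)
  have hA := isGaussianProcess_martIncr H c T m hM
  rw [covariance_eq_sub ((hA.hasGaussianLaw_eval i).memLp ENNReal.ofNat_ne_top)
    ((hA.hasGaussianLaw_eval j).memLp ENNReal.ofNat_ne_top), integral_martIncr H c T m hM h0,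
    zero_mul, sub_zero]
  simp only [Pi.mul_apply, martIncr, mul_mul_mul_comm _ (M (gridPoint T m i) _ - _)]
  rw [integral_const_mul, integral_incr_mul_incr hM hcov (gridPoint_mono T m (Nat.sub_le i 1))
    (gridPoint_mono T m (by lia)) (gridPoint_mono T m (Nat.sub_le j 1)), mul_zero]

end Increments

/-! ### Concentration of the two sums of squares -/

section Convergence

variable {Ω : Type*} [MeasurableSpace Ω] {P : Measure Ω} {M : ℝ≥0 → Ω → ℝ} {H κ : ℝ}

lemma mesh_rpow_le {T : ℝ} (hT : 0 < T) (hH0 : 0 < H) {m n : ℕ} (hn : 0 < n) (hnm : n ≤ m) :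
    (T / m) ^ H ≤ T ^ H * (n : ℝ) ^ (-H) := by
  have hn' : (0 : ℝ) < n := by exact_mod_cast hn
  rw [Real.rpow_neg hn'.le, ← div_eq_mul_inv, ← Real.div_rpow hT.le hn'.le]
  gcongr

lemma tendsto_sum_gridVarMart (hH0 : 0 < H) (hH1 : H < 1) {T t₀ : ℝ≥0} (hT : 0 < T) {m k : ℕ → ℕ}
    (hm : Tendsto m atTop atTop) (hkm : ∀ n, k n ≤ m n)
    (hk : Tendsto (fun n => k n * (T / m n : ℝ)) atTop (𝓝 t₀)) :
    Tendsto (fun n => ∑ i ∈ Finset.Ioc (k n) (m n), gridVarMart H (T / m n) i) atTop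
      (𝓝 ((2 - 2 * H) / (2 * H) * ((T : ℝ) ^ (2 * H) - (t₀ : ℝ) ^ (2 * H)))) := by
  have hT' : (0 : ℝ) < T := by exact_mod_cast hT
  have hh : Tendsto (fun n => (T / m n : ℝ)) atTop (𝓝 0) :=
    tendsto_const_nhds.div_atTop (tendsto_natCast_atTop_atTop.comp hm)
  have h1 : Tendsto (fun n => (2 - 2 * H) / (2 * H) *
      ((T : ℝ) ^ (2 * H) - (k n * (T / m n : ℝ)) ^ (2 * H))) atTop
      (𝓝 ((2 - 2 * H) / (2 * H) * ((T : ℝ) ^ (2 * H) - (t₀ : ℝ) ^ (2 * H)))) :=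
    ((hk.rpow_const (Or.inr (by linarith))).const_sub _).const_mul _
  have h2 : Tendsto (fun n => (1 + (2 - 2 * H) / (2 * H)) / H * (T : ℝ) ^ H * (T / m n : ℝ) ^ H)
      atTop (𝓝 0) := by
    have := (hh.rpow_const (p := H) (Or.inr hH0.le)).const_mul
      ((1 + (2 - 2 * H) / (2 * H)) / H * (T : ℝ) ^ H)
    rwa [Real.zero_rpow hH0.ne', mul_zero] at this
  have h3 : Tendsto (fun n => ∑ i ∈ Finset.Ioc (k n) (m n), gridVarMart H (T / m n) i -
      (2 - 2 * H) / (2 * H) * ((T : ℝ) ^ (2 * H) - (k n * (T / m n : ℝ)) ^ (2 * H))) atTop (𝓝 0) := by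
    refine squeeze_zero_norm' ?_ h2
    filter_upwards [hm.eventually_ge_atTop 1] with n hn
    have hn' : (0 : ℝ) < m n := by exact_mod_cast hn
    have := abs_sum_gridVarMart_sub_le hH0 hH1 (div_pos hT' hn') (hkm n)
    rwa [mul_div_cancel₀ _ hn'.ne'] at this
  simpa using h3.add h1

lemma expMomentDecay_martIncr (hM : IsGaussianProcess M P) (hmeas : ∀ t, Measurable (M t))
    (h0 : ∀ t, ∫ ω, M t ω ∂P = 0)
    (hcov : ∀ s t, s ≤ t → ∫ ω, M s ω * M t ω ∂P = κ * (s : ℝ) ^ (2 - 2 * H)) (hκ : 0 ≤ κ)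
    (hH0 : 0 < H) (hH1 : H < 1) (c : ℝ) {T : ℝ≥0} (hT : 0 < T) {m k : ℕ → ℕ} {N : ℕ} (hN0 : 0 < N)
    (hN : (3 * (c ^ 2 * κ) * (T : ℝ) ^ H * (T : ℝ) ^ H + 1) * (N : ℝ) ^ (-H) ≤ 1 / 16)
    (hm : ∀ n, n + N ≤ m n) {L : ℝ}
    (hL : ∀ n, ∑ i ∈ Finset.Ioc (k n) (m n), c ^ 2 * κ * gridVarMart H (T / m n) i ≤ L) :
    ExpMomentDecay (fun n ω => ∑ i ∈ Finset.Ioc (k n) (m n), martIncr M H c T (m n) i ω ^ 2 -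
      ∑ i ∈ Finset.Ioc (k n) (m n), c ^ 2 * κ * gridVarMart H (T / m n) i) P := by
  have hT' : (0 : ℝ) < T := by exact_mod_cast hT
  have hc : 0 ≤ c ^ 2 * κ := by positivity
  -- The product comes from `gridVarMart_le` with mh = T and h ≤ T/(n+N); the `+ 1` keeps v positive
  -- even if c²κ = 0.
  set K := 3 * (c ^ 2 * κ) * (T : ℝ) ^ H * (T : ℝ) ^ H + 1 with hK
  have hK0 : 0 < K := by positivity
  refine ⟨H / 2, √K, 2 * Real.exp (2 * L), by positivity, fun n => ?_⟩
  have hA := isGaussianProcess_martIncr H c T (m n) hM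
  have hAm : ∀ i, Measurable (martIncr M H c T (m n) i) := fun i =>
    ((hmeas _).sub (hmeas _)).const_mul _
  refine ⟨((Finset.measurable_fun_sum _ fun i _ => (hAm i).pow_const 2).sub_const _).aemeasurable, ?_⟩
  have hnN : (0 : ℝ) < n + N := by positivity
  set v := K * ((n : ℝ) + N) ^ (-H) with hv
  have hv0 : 0 < v := by positivity
  have hN1 : (1 : ℝ) ≤ N := by exact_mod_cast hN0
  have hv16 : v ≤ 1 / 16 := hN.trans' <| by
    rw [hv]
    exact mul_le_mul_of_nonneg_left (Real.rpow_le_rpow_of_nonpos (by positivity)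
      (by linarith [n.cast_nonneg (α := ℝ)]) (by linarith)) hK0.le
  have hmn : (0 : ℝ) < m n := by exact_mod_cast (by have := hm n; lia : 0 < m n)
  have hwv : ∀ i ∈ Finset.Ioc (k n) (m n), c ^ 2 * κ * gridVarMart H (T / m n) i ≤ v := by
    intro i hi
    obtain ⟨hi1, hi2⟩ := Finset.mem_Ioc.1 hi
    have h1 := gridVarMart_le hH0 hH1 (div_pos hT' hmn) (i := i) (by lia) hi2
    rw [mul_div_cancel₀ _ hmn.ne'] at h1
    have h2 := mesh_rpow_le hT' hH0 (n := n + N) (by lia) (hm n)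
    push_cast at h2
    calc _ ≤ c ^ 2 * κ * (3 * (T : ℝ) ^ H * ((T : ℝ) ^ H * ((n : ℝ) + N) ^ (-H))) := by
          refine mul_le_mul_of_nonneg_left (h1.trans ?_) hc
          gcongr
      _ = (K - 1) * ((n : ℝ) + N) ^ (-H) := by rw [hK]; ring
      _ ≤ v := by rw [hv]; gcongr; linarith
  have key := integral_exp_abs_sum_sq_sub_le (P := P) (v := v) (L := L)
    (X := fun i : Finset.Ioc (k n) (m n) => martIncr M H c T (m n) i) (hA.hasGaussianLaw _)
    (fun i => hAm i) (fun i => integral_martIncr H c T (m n) hM h0 i)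
    (fun i j hij => covariance_martIncr H c T (m n) hM h0 hcov (Subtype.coe_injective.ne hij))
    (w := fun i => c ^ 2 * κ * gridVarMart H (T / m n) i)
    (fun i => integral_martIncr_sq H c T (m n) hM hcov i) hv0 hv16 (fun i => hwv i i.2)
    ((Finset.sum_coe_sort (Finset.Ioc (k n) (m n))
      fun i => c ^ 2 * κ * gridVarMart H (T / m n) i).trans_le (hL n))
  have hsum : ∀ ω, ∑ i : Finset.Ioc (k n) (m n), (martIncr M H c T (m n) i ω ^ 2 -
      c ^ 2 * κ * gridVarMart H (T / m n) i) =
      ∑ i ∈ Finset.Ioc (k n) (m n), martIncr M H c T (m n) i ω ^ 2 -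
      ∑ i ∈ Finset.Ioc (k n) (m n), c ^ 2 * κ * gridVarMart H (T / m n) i := fun ω => by
    rw [← Finset.sum_sub_distrib, Finset.sum_coe_sort (Finset.Ioc (k n) (m n))
      fun i => martIncr M H c T (m n) i ω ^ 2 - c ^ 2 * κ * gridVarMart H (T / m n) i]
  simp only [hsum] at key
  -- The concentration scale is the square root of the variance bound, hence the rate H/2.
  refine ⟨√v, Real.sqrt_pos.2 hv0, ?_, key⟩
  rw [hv, Real.sqrt_mul hK0.le, Real.sqrt_eq_rpow (_ ^ _), ← Real.rpow_mul hnN.le,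
    show -H * (1 / 2) = -(H / 2) by ring]
  gcongr ?_ * ?_
  exact Real.rpow_le_rpow_of_nonpos (by positivity) (by linarith) (by linarith)

lemma expMomentDecay_driftIncr [IsProbabilityMeasure P] (hM : IsGaussianProcess M P)
    (h0 : ∀ t, ∫ ω, M t ω ∂P = 0)
    (hcov : ∀ s t, s ≤ t → ∫ ω, M s ω * M t ω ∂P = κ * (s : ℝ) ^ (2 - 2 * H)) (hκ : 0 ≤ κ)
    (hH0 : 0 < H) (hH1 : H < 1) (c : ℝ) {T : ℝ≥0} (hT : 0 < T) {m k : ℕ → ℕ}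
    (hm : ∀ n, n + 1 ≤ m n) :
    ExpMomentDecay (fun n ω => ∑ i ∈ Finset.Ioc (k n) (m n), driftIncr M H c T (m n) i ω ^ 2) P := by
  have hT' : (0 : ℝ) < T := by exact_mod_cast hT
  have hc : 0 ≤ c ^ 2 * κ := by positivity
  set K := 4 * (c ^ 2 * κ + 1) / H * (T : ℝ) ^ H * (T : ℝ) ^ H with hK
  have hK0 : 0 < K := by positivity
  refine ⟨H, 4 * K, 2, hH0, fun n => ?_⟩
  have hB := hasGaussianLaw_driftIncr H c T (m n) hM
  refine ⟨Finset.aemeasurable_fun_sum _ fun i _ => (hB i).aemeasurable.pow_const 2, ?_⟩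
  have hmn : (0 : ℝ) < m n := by exact_mod_cast (by have := hm n; lia : 0 < m n)
  have hh : (0 : ℝ) < T / m n := div_pos hT' hmn
  have hi0 : ∀ i ∈ Finset.Ioc (k n) (m n), 1 ≤ i := fun i hi => by
    have := (Finset.mem_Ioc.1 hi).1
    lia
  have key := integral_exp_sum_sq_div_le (P := P) (I := Finset.Ioc (k n) (m n))
    (X := driftIncr M H c T (m n)) (fun i _ => hB i)
    (fun i _ => integral_driftIncr H c T (m n) h0 i)
    -- Here too `+ 1` only makes the weights of the convex combination strictly positive.
    (s := fun i => (c ^ 2 * κ + 1) * (4 * (T / m n : ℝ) ^ (2 * H) * (i : ℝ) ^ (2 * H - 2)))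
    (fun i hi => by have : (0 : ℝ) < i := by exact_mod_cast hi0 i hi
                    positivity)
    (fun i hi => by
      rw [integral_driftIncr_sq H c T (m n) hcov]
      calc _ ≤ c ^ 2 * κ * (4 * (T / m n : ℝ) ^ (2 * H) * (i : ℝ) ^ (2 * H - 2)) := by
            gcongr
            exact gridVarDrift_le hH0 hH1 hh (hi0 i hi)
        _ ≤ _ := by gcongr; linarith)
    (W := K * ((n : ℝ) + 1) ^ (-H)) (by
      rw [← Finset.mul_sum, ← Finset.mul_sum]
      have h1 := sum_Ioc_rpow_le hH0 hH1 (k n) (m n)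
      have h2 := mesh_rpow_le hT' hH0 (n := n + 1) (by lia) (hm n)
      push_cast at h2
      have h3 : (T / m n : ℝ) ^ H * (m n : ℝ) ^ H = (T : ℝ) ^ H := by
        rw [← Real.mul_rpow hh.le hmn.le, div_mul_cancel₀ _ hmn.ne']
      calc _ ≤ (c ^ 2 * κ + 1) * (4 * (T / m n : ℝ) ^ (2 * H) * ((m n : ℝ) ^ H / H)) := by gcongr
        _ = 4 * (c ^ 2 * κ + 1) / H * ((T / m n : ℝ) ^ H * (m n : ℝ) ^ H) * (T / m n : ℝ) ^ H := by
          rw [two_mul, Real.rpow_add hh]; ring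
        _ ≤ 4 * (c ^ 2 * κ + 1) / H * (T : ℝ) ^ H * ((T : ℝ) ^ H * ((n : ℝ) + 1) ^ (-H)) := by
          rw [h3]; gcongr
        _ = _ := by rw [hK]; ring)
  refine ⟨4 * (K * ((n : ℝ) + 1) ^ (-H)), by positivity, (mul_assoc _ _ _).ge, ?_⟩
  simpa only [abs_of_nonneg (Finset.sum_nonneg fun i _ => sq_nonneg (driftIncr M H c T (m n) i _))]
    using key

/-- A squared increment is in L² because Gaussian variables have fourth moments. -/
lemma memLp_sumSqIncr (hM : IsGaussianProcess M P) (f : ℝ≥0 → ℝ) (T : ℝ≥0) (m k : ℕ) :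
    MemLp (sumSqIncr (fun t ω => f t * M t ω) T m k) 2 P := by
  refine memLp_finsetSum _ fun i _ => ?_
  have h4 : ∀ t, MemLp (fun ω => f t * M t ω) 4 P := fun t =>
    ((hM.hasGaussianLaw_eval t).memLp ENNReal.ofNat_ne_top).const_mul _
  have h := (h4 (gridPoint T m i)).sub (h4 (gridPoint T m (i - 1)))
  refine (memLp_two_iff_integrable_sq (h.1.pow 2)).2 ?_
  refine (h.integrable_norm_pow (p := 4) four_ne_zero).congr (ae_of_all _ fun ω => ?_)
  simp only [Pi.sub_apply, Pi.pow_apply, Real.norm_eq_abs, ← pow_mul]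
  exact Even.pow_abs (by decide) _

end Convergence

theorem mainTheorem5 {Ω : Type*} [MeasurableSpace Ω] (P : Measure Ω) [IsProbabilityMeasure P]
    (Z : ℝ → ℝ≥0 → Ω → ℝ) (hZ : IsFractionalGaussianField Z P)
    (H : ℝ) (hH0 : 0 < H) (hH1 : H < 1)
    (t₀ T : ℝ≥0) (hT : t₀ < T) (δ : ℝ) (hδ : 0 < δ)
    (i₀ : ℕ → ℕ)
    (hi₀ : ∀ n : ℕ, |(i₀ n : ℝ) - (t₀ : ℝ) * (gridSize δ n : ℝ) / (T : ℝ)| ≤ 1) :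
    ((∀ n : ℕ, MemLp (sumSqIncr (dobricOjeda P Z H) T (gridSize δ n) (i₀ n)) 2 P) ∧
      Tendsto (fun n : ℕ =>
        eLpNorm (fun ω => sumSqIncr (dobricOjeda P Z H) T (gridSize δ n) (i₀ n) ω
          - limitI H t₀ T) 2 P) atTop (𝓝 0)) ∧
    (∀ᵐ ω ∂P, Tendsto (fun n : ℕ =>
      sumSqIncr (dobricOjeda P Z H) T (gridSize δ n) (i₀ n) ω) atTop (𝓝 (limitI H t₀ T))) := by
  set M := martM P Z H with hMdef
  have hM : IsGaussianProcess M P := isGaussianProcess_martM hZ ⟨H, hH0, hH1⟩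
  have h0 : ∀ t, ∫ ω, M t ω ∂P = 0 := integral_martM hZ ⟨H, hH0, hH1⟩
  have hcov : ∀ s t, s ≤ t → ∫ ω, M s ω * M t ω ∂P = constM H * (s : ℝ) ^ (2 - 2 * H) :=
    fun s t hst => integral_martM_mul_martM hZ ⟨H, hH0, hH1⟩ hst
  have hmeas : ∀ t, Measurable (M t) := fun t =>
    (stronglyMeasurable_condExp.mono (pastSigma_le hZ ⟨H, hH0, hH1⟩ t)).measurable
  -- The constant is the second moment of M_H(1).
  have hκ : 0 ≤ constM H := by
    have h := hcov 1 1 le_rfl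
    rw [NNReal.coe_one, Real.one_rpow, mul_one] at h
    rw [← h]
    exact integral_nonneg fun ω => mul_self_nonneg _
  have hT0 : 0 < T := hT.bot_lt
  have hT' : (0 : ℝ) < T := by exact_mod_cast hT0
  have hmem := fun n => memLp_sumSqIncr hM (fun t => constPsi H * (t : ℝ) ^ (2 * H - 1)) T
    (gridSize δ n) (i₀ n)
  set c := constPsi H with hc
  have hgrid : Tendsto (gridSize δ) atTop atTop :=
    tendsto_atTop_mono' _ ((eventually_ge_atTop 1).mono fun n hn => le_gridSize hδ hn) tendsto_id
  have hmesh : Tendsto (fun n => (T / gridSize δ n : ℝ)) atTop (𝓝 0) :=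
    tendsto_const_nhds.div_atTop (tendsto_natCast_atTop_atTop.comp hgrid)
  have hleft : ∀ n, 1 ≤ n → |i₀ n * (T / gridSize δ n : ℝ) - t₀| ≤ T / gridSize δ n := by
    intro n hn
    have hg : (0 : ℝ) < gridSize δ n := by
      exact_mod_cast (by have := le_gridSize hδ hn; lia : 0 < gridSize δ n)
    have h := mul_le_mul_of_nonneg_right (hi₀ n) (div_pos hT' hg).le
    rw [one_mul, ← abs_of_pos (div_pos hT' hg), ← abs_mul, abs_of_pos (div_pos hT' hg), sub_mul] at h
    convert! h using 3
    field_simp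
  have hi₀le : ∀ᶠ n in atTop, i₀ n ≤ gridSize δ n := by
    have hpos : (0 : ℝ) < T - t₀ := sub_pos.2 (by exact_mod_cast hT)
    filter_upwards [hmesh.eventually_le_const hpos, eventually_ge_atTop 1] with n h1 h2
    have hg : (0 : ℝ) < gridSize δ n := by
      exact_mod_cast (by have := le_gridSize hδ h2; lia : 0 < gridSize δ n)
    have h3 := (abs_le.1 (hleft n h2)).2
    have h4 : (i₀ n : ℝ) * (T / gridSize δ n) ≤ gridSize δ n * (T / gridSize δ n) := by
      rw [mul_div_cancel₀ _ hg.ne']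
      linarith
    exact_mod_cast le_of_mul_le_mul_right h4 (div_pos hT' hg)
  -- For n ≥ N the variances are at most 1/16 and i₀ does not exceed m; the sequences are shifted by
  -- N so that both hold for every index.
  obtain ⟨N, hN1, hN, hNle⟩ : ∃ N : ℕ, 0 < N ∧
      (3 * (c ^ 2 * constM H) * (T : ℝ) ^ H * (T : ℝ) ^ H + 1) * (N : ℝ) ^ (-H) ≤ 1 / 16 ∧
      ∀ n, N ≤ n → i₀ n ≤ gridSize δ n := by
    have h1 : Tendsto (fun n : ℕ => (3 * (c ^ 2 * constM H) * (T : ℝ) ^ H * (T : ℝ) ^ H + 1) *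
        (n : ℝ) ^ (-H)) atTop (𝓝 0) := by
      simpa using ((tendsto_rpow_neg_atTop hH0).comp tendsto_natCast_atTop_atTop).const_mul
        (3 * (c ^ 2 * constM H) * (T : ℝ) ^ H * (T : ℝ) ^ H + 1)
    have h2 := ((eventually_gt_atTop 0).and ((h1.eventually_le_const (by norm_num :
      (0 : ℝ) < 1 / 16)).and (eventually_forall_ge_atTop.2 hi₀le))).exists
    exact h2
  have hshift : Tendsto (fun n : ℕ => n + N) atTop atTop := tendsto_add_atTop_nat N
  have hlim : Tendsto (fun n => ∑ i ∈ Finset.Ioc (i₀ (n + N)) (gridSize δ (n + N)),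
      c ^ 2 * constM H * gridVarMart H (T / gridSize δ (n + N)) i) atTop (𝓝 (limitI H t₀ T)) := by
    have h1 : Tendsto (fun n => i₀ n * (T / gridSize δ n : ℝ)) atTop (𝓝 t₀) := by
      refine tendsto_iff_norm_sub_tendsto_zero.2 (squeeze_zero' (Eventually.of_forall fun _ =>
        norm_nonneg _) ((eventually_ge_atTop 1).mono hleft) hmesh)
    have h2 := (tendsto_sum_gridVarMart hH0 hH1 hT0 (hgrid.comp hshift)
      (fun n => hNle (n + N) (by lia)) (h1.comp hshift)).const_mul (c ^ 2 * constM H)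
    simp only [← Finset.mul_sum]
    convert! h2 using 2
    rw [limitI, constC, mul_pow, Real.sq_sqrt (mul_nonneg hκ (by linarith))]
    ring
  obtain ⟨L, hL⟩ := hlim.bddAbove_range
  have hconv := tendsto_of_expMomentDecay (P := P) hlim (fun n => hmem (n + N))
    (X := fun n ω => ∑ i ∈ Finset.Ioc (i₀ (n + N)) (gridSize δ (n + N)),
      martIncr M H c T (gridSize δ (n + N)) i ω ^ 2)
    (Y := fun n ω => ∑ i ∈ Finset.Ioc (i₀ (n + N)) (gridSize δ (n + N)),
      driftIncr M H c T (gridSize δ (n + N)) i ω ^ 2)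
    (fun n ω => Finset.sum_nonneg fun i _ => sq_nonneg _)
    (fun n ω => by
      -- S - X - Y is twice the sum of the products of the martingale and drift parts, so this is
      -- Cauchy–Schwarz.
      refine le_trans (le_of_eq ?_) (mul_le_mul_of_nonneg_left (Finset.sum_mul_sq_le_sq_mul_sq
        (Finset.Ioc (i₀ (n + N)) (gridSize δ (n + N)))
        (fun i => martIncr M H c T (gridSize δ (n + N)) i ω)
        (fun i => driftIncr M H c T (gridSize δ (n + N)) i ω)) zero_le_four)
      rw [sumSqIncr, ← Finset.sum_sub_distrib, ← Finset.sum_sub_distrib,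
        show (4 : ℝ) = 2 ^ 2 by norm_num, ← mul_pow, Finset.mul_sum]
      congr 1
      refine Finset.sum_congr rfl fun i _ => ?_
      rw [martIncr, driftIncr]
      ring)
    (expMomentDecay_martIncr hM hmeas h0 hcov hκ hH0 hH1 c hT0 hN1 hN
      (m := fun n => gridSize δ (n + N)) (k := fun n => i₀ (n + N))
      (fun n => le_gridSize hδ (by lia)) fun n => hL ⟨n, rfl⟩)
    (expMomentDecay_driftIncr hM h0 hcov hκ hH0 hH1 c hT0
      (m := fun n => gridSize δ (n + N)) (k := fun n => i₀ (n + N))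
      (fun n => (le_gridSize hδ (by lia)).trans' (by lia)))
  refine ⟨⟨hmem, (tendsto_add_atTop_iff_nat N).1 hconv.1⟩, ?_⟩
  filter_upwards [hconv.2] with ω hω
  exact (tendsto_add_atTop_iff_nat N).1 hω
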